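/- Work in the ring $\mathbb C[[z_1,z_2]]$ and write $\theta_i=z_i\,\partial/\partial z_i$. Let $$\mathcal L_1=\theta_1(\theta_1-3\theta_2)-12z_1(6\theta_1+1)(6\theta_1+5),\qquad \mathcal L_2=\theta_2^3+z_2(3\theta_2-\theta_1)(3\theta_2-\theta_1+1)(3\theta_2-\theta_1+2)$$ be the Picard–Fuchs operators of the mirror of $X_{18}(1,1,1,6,9)$, and $$\Delta_1=(1-432z_1)^3-27z_2(432z_1)^3,\qquad \Delta_2=1+27z_2 .$$ Let $X_0$ be the fundamental period, i.e. the power series solution of $\mathcal L_1w=\mathcal L_2w=0$ with constant term $1$, $$X_0=\sum_{n\ge 3m\ge 0}\frac{(6n)!}{(n-3m)!\,(2n)!\,(3n)!\,(m!)^3}\,z_1^nz_2^m=1+60z_1+\cdots,$$ and let $X_1=X_0\log z_1+S$ be the logarithmic solution with $S\in\mathbb C[[z_1,z_2]]$, $S(0,0)=0$ (so $S=312z_1+2z_2+\cdots$; explicitly, the coefficient of $z_1^nz_2^m$ in $S$ is the derivative at $\rho=0$ of $\Gamma(6(n+\rho)+1)/\big(\Gamma(n+\rho-3m+1)\Gamma(2(n+\rho)+1)\Gamma(3(n+\rho)+1)\Gamma(m+1)^3\big)$).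 Put $$q_E=\exp(X_1/X_0)=z_1\exp(S/X_0)\in\mathbb C[[z_1,z_2]].$$ Let $E_4,E_6$ be the Eisenstein series of $SL(2,\mathbb Z)$ normalised to have constant term $1$ and let $\eta^{24}=q\prod_{k\ge1}(1-q^k)^{24}$; substitute $q=q_E$ in their $q$-expansions. Fractional powers of $E_4(q_E)=1+\cdots$ are the formal ones with constant term $1$. Put $$Z=\frac{z_2}{(1-432z_1)^3\,E_4(q_E)^{9/2}} .$$ **Theorem (Conjecture 3.75).** There are unique sequences $a_n,b_n,c_n,x_n$ ($n\ge0$) of power series in $\mathbb C[[q]]$ such that, in $\mathbb C[[z_1,z_2]]$, $$z_1(1-432z_1)=\frac{\eta(q_E)^{24}}{E_4(q_E)^3}\sum_{n\ge0}a_n(q_E)Z^n,\qquad \frac{\Delta_1\Delta_2}{(1-432z_1)^3}=\sum_{n\ge0}b_n(q_E)Z^n,$$ $$1-864z_1=\frac1{E_4(q_E)^{3/2}}\sum_{n\ge0}c_n(q_E)Z^n,\qquad X_0=E_4(q_E)^{1/4}\sum_{n\ge0}x_n(q_E)Z^n .$$ Their leading terms are $a_0=b_0=x_0=1$ and $c_0=E_6$.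 For every $n\ge0$, $a_n$, $b_n$ and $x_n$ are $q$-expansions of holomorphic modular forms of weight $18n$ for $SL(2,\mathbb Z)$, and $c_n$ is the $q$-expansion of a holomorphic modular form of weight $18n+6$ for $SL(2,\mathbb Z)$; in particular none of them involves $E_2$. Moreover, for every $n\ge1$, $c_n$ and $x_n$ are divisible by $\eta^{24}$: $c_n=\eta^{24}g_n$ and $x_n=\eta^{24}h_n$ with $g_n$, $h_n$ holomorphic modular forms for $SL(2,\mathbb Z)$ of weights $18n-6$ and $18n-12$. -/

import Mathlib

open scoped MatrixGroups PowerSeries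

noncomputable section

namespace X18

open MvPowerSeries

/-! ### Power series in the two complex structure variables and the Picard-Fuchs system -/

/-- Formal power series in `z₁, z₂` with complex coefficients. -/
abbrev Ser : Type := MvPowerSeries (Fin 2) ℂ

/-- The variable `z₁` (elliptic fibre). -/
def z₁ : Ser := X 0

/-- The variable `z₂` (base). -/
def z₂ : Ser := X 1

/-- The pair `(A, B)` stands for the series `A * log z₁ + B`. -/
abbrev LogSer : Type := Ser × Ser

/-- `z₁ ∂/∂z₁` (`i = 0`) or `z₂ ∂/∂z₂` (`i = 1`) on power series. -/
def euler (i : Fin 2) : Module.End ℂ Ser :=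
  LinearMap.mulLeft ℂ (X i) * (pderiv ℂ i : Ser →ₗ[ℂ] Ser)

/-- `z₁ ∂/∂z₁ (A log z₁ + B) = (z₁ ∂A/∂z₁) log z₁ + (A + z₁ ∂B/∂z₁)`. -/
def θ₁ : Module.End ℂ LogSer :=
  LinearMap.prodMap (euler 0) (euler 0) + LinearMap.inr ℂ Ser Ser ∘ₗ LinearMap.fst ℂ Ser Ser

/-- `z₂ ∂/∂z₂ (A log z₁ + B) = (z₂ ∂A/∂z₂) log z₁ + z₂ ∂B/∂z₂`. -/
def θ₂ : Module.End ℂ LogSer := LinearMap.prodMap (euler 1) (euler 1)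

/-- Multiplication by a power series. -/
def mulBy (F : Ser) : Module.End ℂ LogSer := Algebra.lsmul ℂ ℂ LogSer F

/-- `θ₁ (θ₁ - 3 θ₂) - 12 z₁ (6 θ₁ + 1) (6 θ₁ + 5)`. -/
def L₁ : Module.End ℂ LogSer :=
  θ₁ * (θ₁ - 3 * θ₂) - 12 * mulBy z₁ * ((6 * θ₁ + 1) * (6 * θ₁ + 5))

/-- `θ₂ ^ 3 + z₂ (3 θ₂ - θ₁) (3 θ₂ - θ₁ + 1) (3 θ₂ - θ₁ + 2)`. -/
def L₂ : Module.End ℂ LogSer :=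
  θ₂ ^ 3 + mulBy z₂ * ((3 * θ₂ - θ₁) * (3 * θ₂ - θ₁ + 1) * (3 * θ₂ - θ₁ + 2))

/-! ### The periods -/

/-- The coefficient of `z₁ ^ n z₂ ^ m` in the fundamental period, that is
`Γ(6n+1) / (Γ(n-3m+1) Γ(2n+1) Γ(3n+1) Γ(m+1)^3)`, which vanishes for `n < 3m`. -/
def periodCoeff (n m : ℕ) : ℂ :=
  if 3 * m ≤ n then
    ((6 * n).factorial : ℂ) / ((n - 3 * m).factorial * (2 * n).factorial * (3 * n).factorial
      * (m.factorial : ℂ) ^ 3)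
  else 0

/-- The derivative at `ρ = 0` of
`Γ(6(n+ρ)+1) / (Γ(n+ρ-3m+1) Γ(2(n+ρ)+1) Γ(3(n+ρ)+1) Γ(m+1)^3)`. -/
def logCoeff (n m : ℕ) : ℂ :=
  if 3 * m ≤ n then
    periodCoeff n m * ((6 * harmonic (6 * n) - 2 * harmonic (2 * n) - 3 * harmonic (3 * n)
      - harmonic (n - 3 * m) : ℚ) : ℂ)
  else
    (-1) ^ (3 * m - n - 1) * ((3 * m - n - 1).factorial : ℂ) * ((6 * n).factorial : ℂ)
      / ((2 * n).factorial * (3 * n).factorial * (m.factorial : ℂ) ^ 3)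

/-- The fundamental period `X₀`. -/
def X₀ : Ser := fun d => periodCoeff (d 0) (d 1)

/-- The power series part of the period `X₁ = X₀ log z₁ + S`. -/
def S : Ser := fun d => logCoeff (d 0) (d 1)

theorem coeff_euler (i : Fin 2) (F : Ser) (d : Fin 2 →₀ ℕ) :
    coeff d (euler i F) = (d i : ℂ) * coeff d F := by
  have h : euler i F = X i * pderiv ℂ i F := rfl
  rw [h]
  by_cases hd : d i = 0
  · have : (X i : Ser) ∣ X i * pderiv ℂ i F := Dvd.intro _ rfl
    rw [X_dvd_iff.1 this d hd, hd]; simp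
  · have hle : Finsupp.single i 1 ≤ d := by
      rw [Finsupp.single_le_iff]; omega
    obtain ⟨e, rfl⟩ := exists_add_of_le hle
    have h1 := coeff_add_monomial_mul (Finsupp.single i 1) e (pderiv ℂ i F) (1 : ℂ)
    rw [← X_def] at h1
    rw [h1, coeff_pderiv, add_comm e]
    simp; ring

/-- The exponent of `z₁ ^ n z₂ ^ m`. -/
def ex (n m : ℕ) : Fin 2 →₀ ℕ := Finsupp.single 0 n + Finsupp.single 1 m

theorem ex_zero (n m : ℕ) : ex n m 0 = n := by simp [ex]

theorem ex_one (n m : ℕ) : ex n m 1 = m := by simp [ex]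

theorem ser_ext {F G : Ser} (h : ∀ n m, coeff (ex n m) F = coeff (ex n m) G) : F = G := by
  ext d
  have : d = ex (d 0) (d 1) := by
    ext i; fin_cases i <;> simp [ex]
  rw [this]; exact h _ _

theorem coeff_z₁_mul_zero (F : Ser) (m : ℕ) : coeff (ex 0 m) (z₁ * F) = 0 :=
  X_dvd_iff.1 (Dvd.intro F rfl : (X 0 : Ser) ∣ z₁ * F) _ (ex_zero 0 m)

theorem coeff_z₁_mul_succ (F : Ser) (n m : ℕ) :
    coeff (ex (n + 1) m) (z₁ * F) = coeff (ex n m) F := by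
  have h1 := coeff_add_monomial_mul (Finsupp.single 0 1) (ex n m) F (1 : ℂ)
  rw [← X_def, one_mul] at h1
  rw [← h1, z₁]; congr 2
  simp [ex, Finsupp.single_add]; abel

theorem coeff_z₂_mul_zero (F : Ser) (n : ℕ) : coeff (ex n 0) (z₂ * F) = 0 :=
  X_dvd_iff.1 (Dvd.intro F rfl : (X 1 : Ser) ∣ z₂ * F) _ (ex_one n 0)

theorem coeff_z₂_mul_succ (F : Ser) (n m : ℕ) :
    coeff (ex n (m + 1)) (z₂ * F) = coeff (ex n m) F := by
  have h1 := coeff_add_monomial_mul (Finsupp.single 1 1) (ex n m) F (1 : ℂ)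
  rw [← X_def, one_mul] at h1
  rw [← h1, z₂]; congr 2
  simp [ex, Finsupp.single_add]; abel

theorem coeff_θ₁_fst (d : Fin 2 →₀ ℕ) (w : LogSer) :
    coeff d (θ₁ w).1 = (d 0 : ℂ) * coeff d w.1 := by
  simp [θ₁, coeff_euler]

theorem coeff_θ₁_snd (d : Fin 2 →₀ ℕ) (w : LogSer) :
    coeff d (θ₁ w).2 = (d 0 : ℂ) * coeff d w.2 + coeff d w.1 := by
  simp [θ₁, coeff_euler]

theorem coeff_θ₂_fst (d : Fin 2 →₀ ℕ) (w : LogSer) :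
    coeff d (θ₂ w).1 = (d 1 : ℂ) * coeff d w.1 := by
  simp [θ₂, coeff_euler]

theorem coeff_θ₂_snd (d : Fin 2 →₀ ℕ) (w : LogSer) :
    coeff d (θ₂ w).2 = (d 1 : ℂ) * coeff d w.2 := by
  simp [θ₂, coeff_euler]

theorem mulBy_apply (F : Ser) (w : LogSer) : mulBy F w = (F * w.1, F * w.2) := rfl

theorem numeral_eq (k : ℕ) [k.AtLeastTwo] : (OfNat.ofNat k : Module.End ℂ LogSer)
    = (OfNat.ofNat k : ℂ) • 1 := by
  rw [← Algebra.algebraMap_eq_smul_one, map_ofNat]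

theorem L₁_apply (w : LogSer) : L₁ w = θ₁ (θ₁ w) - (3 : ℂ) • θ₁ (θ₂ w)
    - (12 : ℂ) • mulBy z₁ ((36 : ℂ) • θ₁ (θ₁ w) + (36 : ℂ) • θ₁ w + (5 : ℂ) • w) := by
  have h3 : (3 : Module.End ℂ LogSer) = (3 : ℂ) • 1 := numeral_eq 3
  have h6 : (6 : Module.End ℂ LogSer) = (6 : ℂ) • 1 := numeral_eq 6
  have h5 : (5 : Module.End ℂ LogSer) = (5 : ℂ) • 1 := numeral_eq 5
  have h12 : (12 : Module.End ℂ LogSer) = (12 : ℂ) • 1 := numeral_eq 12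
  rw [L₁, h3, h6, h5, h12]
  simp only [LinearMap.sub_apply, Module.End.mul_apply, LinearMap.add_apply, LinearMap.smul_apply,
    Module.End.one_apply, map_sub, map_add, map_smul]
  module

theorem L₂_apply (w : LogSer) : ∃ T : Module.End ℂ LogSer,
    (∀ v, T v = (3 : ℂ) • θ₂ v - θ₁ v) ∧
    L₂ w = θ₂ (θ₂ (θ₂ w)) + mulBy z₂ (T (T (T w + (2 : ℂ) • w) + (T w + (2 : ℂ) • w))) := by
  have h3 : (3 : Module.End ℂ LogSer) = (3 : ℂ) • 1 := numeral_eq 3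
  have h2 : (2 : Module.End ℂ LogSer) = (2 : ℂ) • 1 := numeral_eq 2
  refine ⟨3 * θ₂ - θ₁, fun v => ?_, ?_⟩
  · rw [h3]; simp
  · rw [L₂, h2]; rfl

theorem coeff_L₁_fst_zero (w : LogSer) (m : ℕ) : coeff (ex 0 m) (L₁ w).1 = 0 := by
  rw [L₁_apply]
  simp [mulBy_apply, coeff_θ₁_fst, coeff_z₁_mul_zero, ex_zero]

theorem coeff_L₁_snd_zero (w : LogSer) (m : ℕ) :
    coeff (ex 0 m) (L₁ w).2 = -3 * m * coeff (ex 0 m) w.1 := by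
  rw [L₁_apply]
  simp [mulBy_apply, coeff_θ₁_fst, coeff_θ₁_snd, coeff_θ₂_fst, coeff_θ₂_snd, coeff_z₁_mul_zero,
    ex_zero, ex_one]
  ring

theorem coeff_L₁_fst_succ (w : LogSer) (n m : ℕ) :
    coeff (ex (n + 1) m) (L₁ w).1 = (n + 1) * (n + 1 - 3 * m) * coeff (ex (n + 1) m) w.1
      - 12 * (6 * n + 1) * (6 * n + 5) * coeff (ex n m) w.1 := by
  rw [L₁_apply]
  simp [mulBy_apply, coeff_θ₁_fst, coeff_θ₂_fst, coeff_z₁_mul_succ, ex_zero, ex_one]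
  ring

theorem coeff_L₁_snd_succ (w : LogSer) (n m : ℕ) :
    coeff (ex (n + 1) m) (L₁ w).2 = (n + 1) * (n + 1 - 3 * m) * coeff (ex (n + 1) m) w.2
      + (2 * (n + 1) - 3 * m) * coeff (ex (n + 1) m) w.1
      - 12 * ((6 * n + 1) * (6 * n + 5) * coeff (ex n m) w.2
        + (72 * n + 36) * coeff (ex n m) w.1) := by
  rw [L₁_apply]
  simp [mulBy_apply, coeff_θ₁_fst, coeff_θ₁_snd, coeff_θ₂_fst, coeff_θ₂_snd, coeff_z₁_mul_succ,
    ex_zero, ex_one]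
  ring

theorem coeff_L₂_fst_zero (w : LogSer) (n : ℕ) : coeff (ex n 0) (L₂ w).1 = 0 := by
  obtain ⟨T, -, h⟩ := L₂_apply w
  rw [h]
  simp [mulBy_apply, coeff_θ₂_fst, coeff_z₂_mul_zero, ex_one]

theorem coeff_L₂_snd_zero (w : LogSer) (n : ℕ) : coeff (ex n 0) (L₂ w).2 = 0 := by
  obtain ⟨T, -, h⟩ := L₂_apply w
  rw [h]
  simp [mulBy_apply, coeff_θ₂_snd, coeff_z₂_mul_zero, ex_one]

theorem coeff_L₂_fst_succ (w : LogSer) (n m : ℕ) :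
    coeff (ex n (m + 1)) (L₂ w).1 = (m + 1) ^ 3 * coeff (ex n (m + 1)) w.1
      + (3 * m - n) * (3 * m - n + 1) * (3 * m - n + 2) * coeff (ex n m) w.1 := by
  obtain ⟨T, hT, h⟩ := L₂_apply w
  rw [h]
  simp [mulBy_apply, hT, coeff_θ₁_fst, coeff_θ₂_fst, coeff_z₂_mul_succ, ex_zero, ex_one]
  ring

theorem coeff_L₂_snd_succ (w : LogSer) (n m : ℕ) :
    coeff (ex n (m + 1)) (L₂ w).2 = (m + 1) ^ 3 * coeff (ex n (m + 1)) w.2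
      + (3 * m - n) * (3 * m - n + 1) * (3 * m - n + 2) * coeff (ex n m) w.2
      - (3 * (3 * m - n) ^ 2 + 6 * (3 * m - n) + 2) * coeff (ex n m) w.1 := by
  obtain ⟨T, hT, h⟩ := L₂_apply w
  rw [h]
  simp [mulBy_apply, hT, coeff_θ₁_fst, coeff_θ₂_fst, coeff_θ₁_snd, coeff_θ₂_snd,
    coeff_z₂_mul_succ, ex_zero, ex_one]
  ring

/-- A solution of the Picard-Fuchs system is determined by the constant terms of its two
components. -/
theorem solution_unique (w : LogSer) (h1 : L₁ w = 0) (h2 : L₂ w = 0)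
    (hA : coeff (ex 0 0) w.1 = 0) (hB : coeff (ex 0 0) w.2 = 0) : w = 0 := by
  have hm (m : ℕ) : ((m : ℂ) + 1) ≠ 0 := by exact_mod_cast Nat.succ_ne_zero m
  have key1 : ∀ m n, coeff (ex n m) w.1 = 0 := by
    intro m
    induction m with
    | zero =>
      intro n
      induction n with
      | zero => exact hA
      | succ n ih =>
        have := coeff_L₁_fst_succ w n 0
        simpa [h1, ih, hm] using this
    | succ m ih =>
      intro n
      have := coeff_L₂_fst_succ w n m
      simpa [h2, ih, hm] using this
  have key2 : ∀ m n, coeff (ex n m) w.2 = 0 := by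
    intro m
    induction m with
    | zero =>
      intro n
      induction n with
      | zero => exact hB
      | succ n ih =>
        have := coeff_L₁_snd_succ w n 0
        simpa [h1, ih, hm, key1] using this
    | succ m ih =>
      intro n
      have := coeff_L₂_snd_succ w n m
      simpa [h2, ih, hm, key1] using this
  refine Prod.ext (ser_ext fun n m => ?_) (ser_ext fun n m => ?_)
  · simpa using key1 m n
  · simpa using key2 m n

theorem coeff_X₀ (n m : ℕ) : coeff (ex n m) X₀ = periodCoeff n m := by
  change periodCoeff (ex n m 0) (ex n m 1) = _
  rw [ex_zero, ex_one]

theorem coeff_S (n m : ℕ) : coeff (ex n m) S = logCoeff n m := by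
  change logCoeff (ex n m 0) (ex n m 1) = _
  rw [ex_zero, ex_one]

/-- `Γ(6n+1) / (Γ(2n+1) Γ(3n+1))`. -/
def fib (n : ℕ) : ℂ := ((6 * n).factorial : ℂ) / ((2 * n).factorial * (3 * n).factorial)

/-- The logarithmic derivative of `Γ(6n+1) / (Γ(2n+1) Γ(3n+1))`, up to Euler constants, which
cancel against the one in `drg`. -/
def har (n : ℕ) : ℂ :=
  ((6 * harmonic (6 * n) - 2 * harmonic (2 * n) - 3 * harmonic (3 * n) : ℚ) : ℂ)

/-- `1 / Γ(k+1)` on integers. -/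
def rg : ℤ → ℂ
  | Int.ofNat k => 1 / (k.factorial : ℂ)
  | Int.negSucc _ => 0

/-- The derivative of `1 / Γ(k+1)` on integers, up to Euler constants. -/
def drg : ℤ → ℂ
  | Int.ofNat k => -((harmonic k : ℚ) : ℂ) / (k.factorial : ℂ)
  | Int.negSucc j => (-1) ^ j * (j.factorial : ℂ)

theorem fac_ne (k : ℕ) : (k.factorial : ℂ) ≠ 0 := by exact_mod_cast k.factorial_ne_zero

theorem rg_rec (k : ℤ) : (k : ℂ) * rg k = rg (k - 1) := by
  rcases k with k | k
  · cases k with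
    | zero =>
      have h : (Int.ofNat 0 - 1 : ℤ) = Int.negSucc 0 := rfl
      rw [h]; simp [rg]
    | succ k =>
      have h : (Int.ofNat (k + 1) - 1 : ℤ) = Int.ofNat k := by simp
      rw [h]
      have := fac_ne k
      have h2 : (k : ℂ) + 1 ≠ 0 := by exact_mod_cast Nat.succ_ne_zero k
      simp [rg, Nat.factorial_succ]
      field_simp
  · have h : (Int.negSucc k - 1 : ℤ) = Int.negSucc (k + 1) := rfl
    rw [h]; simp [rg]

theorem drg_rec (k : ℤ) : (k : ℂ) * drg k + rg k = drg (k - 1) := by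
  rcases k with k | k
  · cases k with
    | zero =>
      have h : (Int.ofNat 0 - 1 : ℤ) = Int.negSucc 0 := rfl
      rw [h]; simp [rg, drg]
    | succ k =>
      have h : (Int.ofNat (k + 1) - 1 : ℤ) = Int.ofNat k := by simp
      rw [h]
      have := fac_ne k
      have h2 : (k : ℂ) + 1 ≠ 0 := by exact_mod_cast Nat.succ_ne_zero k
      simp [rg, drg, Nat.factorial_succ, harmonic_succ]
      field_simp
      ring
  · have h : (Int.negSucc k - 1 : ℤ) = Int.negSucc (k + 1) := rfl
    rw [h]; simp [rg, drg, Nat.factorial_succ]; ring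

theorem fib_rec_aux (x P Q R : ℂ) (hQ : Q ≠ 0) (hR : R ≠ 0) (e1 : x + 1 ≠ 0)
    (e2 : 2 * x + 1 ≠ 0) (e3 : 3 * x + 1 ≠ 0) (e4 : 3 * x + 2 ≠ 0) :
    (x + 1) * ((6 * x + 5 + 1) * ((6 * x + 4 + 1) * ((6 * x + 3 + 1) * ((6 * x + 2 + 1) *
      ((6 * x + 1 + 1) * ((6 * x + 1) * P))))) / (2 * (x + 1) * ((2 * x + 1) * Q) *
      (3 * (x + 1) * ((3 * x + 2) * ((3 * x + 1) * R))))) =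
    12 * (6 * x + 1) * (6 * x + 5) * (P / (Q * R)) := by
  rw [mul_div_assoc', mul_div_assoc', div_eq_div_iff (by simp [*]) (by simp [*])]
  ring

theorem fib_rec (n : ℕ) : ((n : ℂ) + 1) * fib (n + 1) = 12 * (6 * n + 1) * (6 * n + 5) * fib n := by
  have h2 := fac_ne (2 * n)
  have h3 := fac_ne (3 * n)
  have e1 : ((n : ℂ) + 1) ≠ 0 := by exact_mod_cast (by omega : n + 1 ≠ 0)
  have e2 : (2 * (n : ℂ) + 1) ≠ 0 := by exact_mod_cast (by omega : 2 * n + 1 ≠ 0)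
  have e3 : (3 * (n : ℂ) + 1) ≠ 0 := by exact_mod_cast (by omega : 3 * n + 1 ≠ 0)
  have e4 : (3 * (n : ℂ) + 2) ≠ 0 := by exact_mod_cast (by omega : 3 * n + 2 ≠ 0)
  simp only [fib, show 6 * (n + 1) = 6 * n + 5 + 1 by ring, show 2 * (n + 1) = 2 * n + 1 + 1 by ring,
    show 3 * (n + 1) = 3 * n + 2 + 1 by ring, Nat.factorial_succ, Nat.cast_mul, Nat.cast_add,
    Nat.cast_one, Nat.cast_ofNat]
  rw [show (2 * (n : ℂ) + 1 + 1) = 2 * (n + 1) by ring, show (3 * (n : ℂ) + 1 + 1) = 3 * n + 2 by ring,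
    show (3 * (n : ℂ) + 2 + 1) = 3 * (n + 1) by ring]
  exact fib_rec_aux _ _ _ _ h2 h3 e1 e2 e3 e4

theorem har_rec (n : ℕ) : har (n + 1) = har n + 6 / (6 * n + 1) + 6 / (6 * n + 5)
    - 1 / ((n : ℂ) + 1) := by
  have e1 : ((n : ℂ) + 1) ≠ 0 := by exact_mod_cast (by omega : n + 1 ≠ 0)
  have e2 : (2 * (n : ℂ) + 1) ≠ 0 := by exact_mod_cast (by omega : 2 * n + 1 ≠ 0)
  have e3 : (3 * (n : ℂ) + 1) ≠ 0 := by exact_mod_cast (by omega : 3 * n + 1 ≠ 0)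
  have e4 : (3 * (n : ℂ) + 2) ≠ 0 := by exact_mod_cast (by omega : 3 * n + 2 ≠ 0)
  have a2 : (6 * (n : ℂ) + 2) = 2 * (3 * n + 1) := by ring
  have a3 : (6 * (n : ℂ) + 3) = 3 * (2 * n + 1) := by ring
  have a4 : (6 * (n : ℂ) + 4) = 2 * (3 * n + 2) := by ring
  have a6 : (6 * (n : ℂ) + 6) = 6 * (n + 1) := by ring
  have b2 : (2 * (n : ℂ) + 2) = 2 * (n + 1) := by ring
  have b3 : (3 * (n : ℂ) + 3) = 3 * (n + 1) := by ring
  have d1 : (6 * (n : ℂ) + 1) ≠ 0 := by exact_mod_cast (by omega : 6 * n + 1 ≠ 0)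
  have d5 : (6 * (n : ℂ) + 5) ≠ 0 := by exact_mod_cast (by omega : 6 * n + 5 ≠ 0)
  simp only [har, show 6 * (n + 1) = 6 * n + 5 + 1 by ring, show 2 * (n + 1) = 2 * n + 1 + 1 by ring,
    show 3 * (n + 1) = 3 * n + 2 + 1 by ring, harmonic_succ]
  push_cast
  simp only [add_assoc]
  norm_num only
  rw [a2, a3, a4, a6, b2, b3]
  simp only [mul_inv, div_eq_mul_inv]
  ring

theorem periodCoeff_eq (n m : ℕ) :
    periodCoeff n m = fib n * rg (n - 3 * m) / (m.factorial : ℂ) ^ 3 := by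
  have h1 := fac_ne (2 * n)
  have h2 := fac_ne (3 * n)
  have h3 := fac_ne m
  have h4 := fac_ne (n - 3 * m)
  rw [periodCoeff]
  split_ifs with h
  · have : (n - 3 * m : ℤ) = Int.ofNat (n - 3 * m) := by
      simp; omega
    rw [this]; simp only [rg, fib]; field_simp
  · have : (n - 3 * m : ℤ) = Int.negSucc (3 * m - n - 1) := by
      omega
    rw [this]; simp [rg]

theorem logCoeff_eq (n m : ℕ) : logCoeff n m =
    fib n * (rg (n - 3 * m) * har n + drg (n - 3 * m)) / (m.factorial : ℂ) ^ 3 := by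
  have h1 := fac_ne (2 * n)
  have h2 := fac_ne (3 * n)
  have h3 := fac_ne m
  have h4 := fac_ne (n - 3 * m)
  rw [logCoeff, periodCoeff_eq]
  split_ifs with h
  · have : (n - 3 * m : ℤ) = Int.ofNat (n - 3 * m) := by
      simp; omega
    rw [this]; simp only [rg, drg, har]; push_cast; field_simp; ring
  · have : (n - 3 * m : ℤ) = Int.negSucc (3 * m - n - 1) := by
      omega
    rw [this]; simp only [rg, drg, fib]; field_simp; ring

theorem har_fib (n : ℕ) : ((n : ℂ) + 1) * fib (n + 1) * (har (n + 1) - har n) + fib (n + 1)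
    = 12 * (72 * n + 36) * fib n := by
  have e1 : ((n : ℂ) + 1) ≠ 0 := by exact_mod_cast (by omega : n + 1 ≠ 0)
  have d1 : (6 * (n : ℂ) + 1) ≠ 0 := by exact_mod_cast (by omega : 6 * n + 1 ≠ 0)
  have d5 : (6 * (n : ℂ) + 5) ≠ 0 := by exact_mod_cast (by omega : 6 * n + 5 ≠ 0)
  have h := fib_rec n
  have u : 6 / (6 * (n : ℂ) + 1) * (6 * n + 1) = 6 := div_mul_cancel₀ _ d1
  have v : 6 / (6 * (n : ℂ) + 5) * (6 * n + 5) = 6 := div_mul_cancel₀ _ d5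
  have w : 1 / ((n : ℂ) + 1) * (n + 1) = 1 := div_mul_cancel₀ _ e1
  rw [har_rec]
  linear_combination (6 / (6 * (n : ℂ) + 1) + 6 / (6 * (n : ℂ) + 5)) * h
    + 12 * (6 * n + 5) * fib n * u + 12 * (6 * n + 1) * fib n * v - fib (n + 1) * w

theorem rg_shift (n m : ℕ) : rg (n - 3 * (m + 1 : ℕ)) =
    ((n : ℂ) - 3 * m) * (n - 3 * m - 1) * (n - 3 * m - 2) * rg (n - 3 * m) := by
  have h1 := rg_rec (n - 3 * m)
  have h2 := rg_rec (n - 3 * m - 1)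
  have h3 := rg_rec (n - 3 * m - 1 - 1)
  rw [show (n - 3 * (m + 1 : ℕ) : ℤ) = n - 3 * m - 1 - 1 - 1 by push_cast; ring, ← h3, ← h2, ← h1]
  push_cast; ring

theorem drg_shift (n m : ℕ) : drg (n - 3 * (m + 1 : ℕ)) =
    ((n : ℂ) - 3 * m) * (n - 3 * m - 1) * (n - 3 * m - 2) * drg (n - 3 * m)
      + (3 * ((n : ℂ) - 3 * m) ^ 2 - 6 * (n - 3 * m) + 2) * rg (n - 3 * m) := by
  have h1 := rg_rec (n - 3 * m)
  have h2 := rg_rec (n - 3 * m - 1)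
  have g1 := drg_rec (n - 3 * m)
  have g2 := drg_rec (n - 3 * m - 1)
  have g3 := drg_rec (n - 3 * m - 1 - 1)
  rw [show (n - 3 * (m + 1 : ℕ) : ℤ) = n - 3 * m - 1 - 1 - 1 by push_cast; ring, ← g3, ← g2, ← g1,
    ← h2, ← h1]
  push_cast; ring

/-- `X₀` solves the Picard-Fuchs system. -/
theorem L₁_X₀ : L₁ (0, X₀) = 0 := by
  refine Prod.ext (ser_ext fun n m => ?_) (ser_ext fun n m => ?_) <;> cases n with
  | zero => simp [coeff_L₁_fst_zero, coeff_L₁_snd_zero]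
  | succ n =>
    simp only [coeff_L₁_fst_succ, coeff_L₁_snd_succ, coeff_X₀, periodCoeff_eq, Prod.fst_zero,
      Prod.snd_zero, map_zero, mul_zero, add_zero, sub_zero]
    try
      have h := rg_rec ((n + 1 : ℕ) - 3 * m)
      have h' := fib_rec n
      rw [show ((n + 1 : ℕ) - 3 * m - 1 : ℤ) = n - 3 * m by push_cast; ring] at h
      rw [← h]
      push_cast
      have := fac_ne m
      field_simp
      push_cast at *
      linear_combination ((n : ℂ) + 1 - 3 * m) * rg (n + 1 - 3 * m) * h'

theorem L₂_X₀ : L₂ (0, X₀) = 0 := by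
  refine Prod.ext (ser_ext fun n m => ?_) (ser_ext fun n m => ?_) <;> cases m with
  | zero => simp [coeff_L₂_fst_zero, coeff_L₂_snd_zero]
  | succ m =>
    simp only [coeff_L₂_fst_succ, coeff_L₂_snd_succ, coeff_X₀, periodCoeff_eq, Prod.fst_zero,
      Prod.snd_zero, map_zero, mul_zero, add_zero, sub_zero]
    try
      rw [rg_shift, Nat.factorial_succ]
      have := fac_ne m
      have h2 : (m : ℂ) + 1 ≠ 0 := by exact_mod_cast Nat.succ_ne_zero m
      push_cast
      field_simp
      ring

/-- `X₀ log z₁ + S` solves the Picard-Fuchs system. -/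
theorem L₁_X₁ : L₁ (X₀, S) = 0 := by
  refine Prod.ext (ser_ext fun n m => ?_) (ser_ext fun n m => ?_)
  · cases n with
    | zero => simp [coeff_L₁_fst_zero]
    | succ n =>
      have := congrArg (fun w : LogSer => coeff (ex (n + 1) m) w.2) L₁_X₀
      simp only [coeff_L₁_fst_succ, coeff_L₁_snd_succ] at this ⊢
      simpa [mul_assoc] using this
  · cases n with
    | zero =>
      rw [coeff_L₁_snd_zero, coeff_X₀]
      cases m <;> simp [periodCoeff]
    | succ n =>
      rw [coeff_L₁_snd_succ, coeff_X₀, coeff_X₀, coeff_S, coeff_S]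
      simp only [periodCoeff_eq, logCoeff_eq, Prod.snd_zero, map_zero]
      have h := rg_rec ((n + 1 : ℕ) - 3 * m)
      have g := drg_rec ((n + 1 : ℕ) - 3 * m)
      have h' := fib_rec n
      have k := har_fib n
      rw [show ((n + 1 : ℕ) - 3 * m - 1 : ℤ) = n - 3 * m by push_cast; ring] at h g
      rw [← h, ← g]
      have := fac_ne m
      field_simp
      push_cast at *
      linear_combination (((n : ℂ) + 1 - 3 * m) * rg (n + 1 - 3 * m) * har n
        + ((n : ℂ) + 1 - 3 * m) * drg (n + 1 - 3 * m) + rg (n + 1 - 3 * m)) * h'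
        + ((n : ℂ) + 1 - 3 * m) * rg (n + 1 - 3 * m) * k

theorem L₂_X₁ : L₂ (X₀, S) = 0 := by
  refine Prod.ext (ser_ext fun n m => ?_) (ser_ext fun n m => ?_)
  · cases m with
    | zero => simp [coeff_L₂_fst_zero]
    | succ m =>
      have := congrArg (fun w : LogSer => coeff (ex n (m + 1)) w.2) L₂_X₀
      simp only [coeff_L₂_fst_succ, coeff_L₂_snd_succ] at this ⊢
      simpa using this
  · cases m with
    | zero => simp [coeff_L₂_snd_zero]
    | succ m =>
      rw [coeff_L₂_snd_succ, coeff_X₀, coeff_S, coeff_S]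
      simp only [periodCoeff_eq, logCoeff_eq, Prod.snd_zero, map_zero]
      rw [rg_shift, drg_shift, Nat.factorial_succ]
      have := fac_ne m
      have h2 : (m : ℂ) + 1 ≠ 0 := by exact_mod_cast Nat.succ_ne_zero m
      push_cast
      field_simp
      ring

theorem X₀_const : coeff (ex 0 0) X₀ = 1 := by simp [coeff_X₀, periodCoeff]

theorem S_const : coeff (ex 0 0) S = 0 := by simp [coeff_S, logCoeff]

/-- `X₀` is the only power series solution with constant term `1`. -/
theorem X₀_unique (F : Ser) (h1 : L₁ (0, F) = 0) (h2 : L₂ (0, F) = 0)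
    (h : coeff (ex 0 0) F = 1) : F = X₀ := by
  have := solution_unique ((0, F) - (0, X₀)) (by rw [map_sub, h1, L₁_X₀, sub_zero])
    (by rw [map_sub, h2, L₂_X₀, sub_zero]) (by simp) (by simp [h, X₀_const])
  exact sub_eq_zero.1 (by simpa using congrArg Prod.snd this)

/-- `X₀ log z₁ + S` is the only solution of this shape for which `S` has constant term `0`. -/
theorem S_unique (F : Ser) (h1 : L₁ (X₀, F) = 0) (h2 : L₂ (X₀, F) = 0)
    (h : coeff (ex 0 0) F = 0) : F = S := by
  have := solution_unique ((X₀, F) - (X₀, S)) (by rw [map_sub, h1, L₁_X₁, sub_zero])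
    (by rw [map_sub, h2, L₂_X₁, sub_zero]) (by simp) (by simp [h, S_const])
  exact sub_eq_zero.1 (by simpa using congrArg Prod.snd this)

/-! ### Flat coordinate of the fibre, modular forms of it, and the variable `Z` -/

open UpperHalfPlane in
/-- The `q`-expansion of a function on the upper half plane, `q = exp (2πiτ)`. -/
def qExp (f : ℍ → ℂ) : ℂ⟦X⟧ := qExpansion 1 f

/-- `q_E = exp (X₁ / X₀) = z₁ exp (S / X₀)`. -/
def qE : Ser := z₁ * (PowerSeries.exp ℂ).subst (S * X₀⁻¹)

/-- Substitution of `q = q_E` in a `q`-series. -/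
def atE (φ : ℂ⟦X⟧) : Ser := φ.subst qE

/-- `E₄(q_E)`. -/
def E4 : Ser := atE (qExp ModularForm.E₄)

/-- `η(q_E) ^ 24`. -/
def eta24 : Ser := atE (qExp ModularForm.discriminant)

/-- For a series `F` with constant term `1`, the power `F ^ r = ∑ₖ (r choose k) (F - 1) ^ k`. -/
def ratPow (F : Ser) (r : ℚ) : Ser := (PowerSeries.binomialSeries ℂ r).subst (F - 1)

/-- `Z = z₂ / ((1 - 432 z₁) ^ 3 E₄(q_E) ^ (9/2))`. -/
def Z : Ser := z₂ * ((1 - 432 * z₁) ^ 3 * ratPow E4 (9 / 2))⁻¹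

/-- The series `∑ₙ cₙ(q_E) Z ^ n`. As `z₂ ^ n` divides `Z ^ n`, only the terms with `n ≤ m`
contribute to the coefficient of `z₁ ^ l z₂ ^ m`. -/
def zSeries (c : ℕ → ℂ⟦X⟧) : Ser := fun d =>
  ∑ n ∈ Finset.range (d 1 + 1), coeff d (atE (c n) * Z ^ n)

/-- `F = N * ∑ₙ cₙ(q_E) Z ^ n`, and the coefficients `cₙ` are determined by `F` and `N`. -/
def IsZExpansion (F N : Ser) (c : ℕ → ℂ⟦X⟧) : Prop :=
  F = N * zSeries c ∧ ∀ c' : ℕ → ℂ⟦X⟧, F = N * zSeries c' → c' = c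

/-- `φ` is the `q`-expansion of a (holomorphic) modular form of weight `k` for `SL(2, ℤ)`. -/
def IsModular (k : ℤ) (φ : ℂ⟦X⟧) : Prop := ∃ f : ModularForm 𝒮ℒ k, φ = qExp f

/-- `φ` is `η ^ 24` times a modular form, with total weight `k`. -/
def IsEtaDivisible (k : ℤ) (φ : ℂ⟦X⟧) : Prop :=
  ∃ ψ : ℂ⟦X⟧, IsModular (k - 12) ψ ∧ φ = qExp ModularForm.discriminant * ψ

/-- `(1 - 432 z₁) ^ 3 - 27 z₂ (432 z₁) ^ 3`. -/
def Δ₁ : Ser := (1 - 432 * z₁) ^ 3 - 27 * z₂ * (432 * z₁) ^ 3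

/-- `1 + 27 z₂`. -/
def Δ₂ : Ser := 1 + 27 * z₂

theorem X₀_constantCoeff : constantCoeff X₀ = 1 := by
  have := X₀_const
  rwa [show ex 0 0 = 0 by simp [ex], coeff_zero_eq_constantCoeff_apply] at this

theorem S_constantCoeff : constantCoeff S = 0 := by
  have := S_const
  rwa [show ex 0 0 = 0 by simp [ex], coeff_zero_eq_constantCoeff_apply] at this

/-- The substitution in `qE` is legitimate. -/
theorem hasSubst_log : PowerSeries.HasSubst (S * X₀⁻¹) :=
  PowerSeries.HasSubst.of_constantCoeff_zero (by simp [S_constantCoeff])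

theorem qE_constantCoeff : constantCoeff qE = 0 := by simp [qE, z₁]

/-- The substitution in `atE` is legitimate. -/
theorem hasSubst_qE : PowerSeries.HasSubst qE :=
  PowerSeries.HasSubst.of_constantCoeff_zero qE_constantCoeff

theorem coeff_mul_Z_pow (F : Ser) (n : ℕ) (d : Fin 2 →₀ ℕ) (h : d 1 < n) :
    coeff d (F * Z ^ n) = 0 := by
  refine X_pow_dvd_iff.1 (?_ : (X 1 : Ser) ^ n ∣ F * Z ^ n) d h
  rw [Z, mul_pow]
  exact Dvd.dvd.mul_left (Dvd.intro _ rfl) _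

/-- The substitution in `ratPow E4` is legitimate. -/
theorem hasSubst_E4 : PowerSeries.HasSubst (E4 - 1) := by
  apply PowerSeries.HasSubst.of_constantCoeff_zero
  have h := EisensteinSeries.E_qExpansion_coeff_zero (k := 4) (by norm_num) (by decide)
  have h' : PowerSeries.constantCoeff (qExp ModularForm.E₄ - 1) = 0 := by
    rw [map_sub, map_one, ← PowerSeries.coeff_zero_eq_constantCoeff_apply]
    exact sub_eq_zero.2 h
  have h1 : E4 - 1 = (qExp ModularForm.E₄ - 1).subst qE := by
    rw [PowerSeries.subst_sub hasSubst_qE, ← PowerSeries.coe_substAlgHom hasSubst_qE, map_one,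
      PowerSeries.coe_substAlgHom]; rfl
  rw [h1]
  exact PowerSeries.constantCoeff_subst_eq_zero qE_constantCoeff _ h'

theorem ratPow_add (F : Ser) (h : PowerSeries.HasSubst (F - 1)) (r s : ℚ) :
    ratPow F (r + s) = ratPow F r * ratPow F s := by
  rw [ratPow, PowerSeries.binomialSeries_add, PowerSeries.subst_mul h]; rfl

theorem ratPow_one (F : Ser) (h : PowerSeries.HasSubst (F - 1)) : ratPow F 1 = F := by
  have h1 := PowerSeries.binomialSeries_nat (R := ℚ) (A := ℂ) 1
  rw [Nat.cast_one] at h1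
  rw [ratPow, h1, pow_one, PowerSeries.subst_add h, PowerSeries.subst_X h,
    ← PowerSeries.coe_substAlgHom h, map_one]
  ring

end X18

end

open X18

/-!
# Modular expansion of the periods of the mirror of `X₁₈(1,1,1,6,9)`

The columns of the periods in `z₂` are filtered by degree and parity in `1 - 864 z₁`. Ramanujan's
differential equations show that `E₄(q_E)` and `E₆(q_E)`, divided by powers of a weight factor,
respect this filtration, and its members expand in powers of `Z` with modular coefficients.
-/

open scoped MatrixGroups PowerSeries
open X18

noncomputable section

/-! Write `s = 1 - 864 z₁`, `r = 1 - 432 z₁`, `y = z₂ / r ^ 3`. The proof rests on the filtration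
`Fil j` of series `∑ yᵐ pₘ(s)` with `deg pₘ ≤ 3m + j` and `pₘ` of the parity of `3m + j`; the parity
says that the series is multiplied by `(-1) ^ j` under `(s, y) ↦ (-s, -y)`.

The operator `L₂` makes column `m` of each period equal to `z ^ (3m) (d/dz) ^ (3m) / m!³` applied to
the period at `z₂ = 0`, and `L₁` at `z₂ = 0` is a second-order equation, so these derivatives reduce
to the function and its first derivative. Hence `X₀ = P f₀ + Q v₀` and `S = P g₀ + Q u₀` with the
same `P ∈ Fil 0`, `Q ∈ Fil (-1)` (`exists_periods_eq`). With `T = Q / P` and `w = f₀ + T v₀`, the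
logarithm of `q_E` is a Möbius function of `T` of determinant `1` (`wronskian`), so `θ₂ log q_E =
θ₂T / w ^ 2`.

Put `W = 1 / w`. Ramanujan's equations for `E₂, E₄, E₆` become a system in `z₂` for `E₂ W ^ 2 - 12
v₀ W`, `E₄ W ^ 4`, `E₆ W ^ 6` with the single extra factor `θ₂T ∈ Fil (-1)`. It determines the
columns recursively and respects the filtration (`mem_Fil_of_ramanujan`). Its initial values `s, 1,
s` at `z₂ = 0` are the classical parametrisation by the hypergeometric period (`col₀_ramanujan`).
The unknown `W` cancels in `E₆ / E₄ ^ (3/2) ∈ Fil 1` and in `X₀ / E₄ ^ (1/4) ∈ Fil 0`.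

For `F ∈ Fil d` with first column `p(s)`, the difference `F - p(E₆ / E₄ ^ (3/2))` is `y` times a
member of `Fil (d + 3)`. By degree and parity `E₄ ^ (3d/2) p(E₆ / E₄ ^ (3/2))` is a polynomial in
`E₄, E₆` of weight `6d`, and `y = Z E₄ ^ (9/2)`. Iteration yields the expansion in `Z`
(`exists_zSeries`), and all four functions are covered by it. `E₂` is present only in the auxiliary
system and never in the coefficients.

Modulo `z₁` one has `q_E ≡ 0`, `Z ≡ z₂`, and `X₀` and `s` become `1`; so the higher `cₙ` and `xₙ`
have no constant term and are divisible by `η ^ 24`. -/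

namespace X18

/-! ### Convergent `q`-series, Ramanujan's differential equations and the discriminant -/

section QSeries

open UpperHalfPlane hiding I
open Complex ModularForm Function.Periodic
open scoped Manifold Topology Derivative

/-- `q d/dq` on `q`-series. -/
def qD (φ : ℂ⟦X⟧) : ℂ⟦X⟧ := PowerSeries.X * PowerSeries.derivative ℂ φ

theorem coeff_qD (φ : ℂ⟦X⟧) (m : ℕ) :
    PowerSeries.coeff m (qD φ) = m * PowerSeries.coeff m φ := by
  cases m with
  | zero => simp [qD]
  | succ m => rw [qD, PowerSeries.coeff_succ_X_mul, PowerSeries.coeff_derivative]; push_cast; ring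

/-- The function `F` is the sum of the `q`-series `φ`. -/
def HasQSeries (F : ℍ → ℂ) (φ : ℂ⟦X⟧) : Prop :=
  ∀ τ : ℍ, HasSum (fun m : ℕ => PowerSeries.coeff m φ • qParam 1 (τ : ℂ) ^ m) (F τ)

theorem HasQSeries.sub {F G : ℍ → ℂ} {φ ψ : ℂ⟦X⟧} (hF : HasQSeries F φ) (hG : HasQSeries G ψ) :
    HasQSeries (F - G) (φ - ψ) := fun τ => by
  simpa [sub_smul, sub_mul] using (hF τ).sub (hG τ)

theorem HasQSeries.smul {F : ℍ → ℂ} {φ : ℂ⟦X⟧} (c : ℂ) (hF : HasQSeries F φ) :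
    HasQSeries (c • F) (c • φ) := fun τ => by
  simpa [mul_assoc] using (hF τ).mul_left c

theorem HasQSeries.mul {F G : ℍ → ℂ} {φ ψ : ℂ⟦X⟧} (hF : HasQSeries F φ) (hG : HasQSeries G ψ) :
    HasQSeries (F * G) (φ * ψ) := fun τ => by
  have h1 := (hF τ).summable.norm
  have h2 := (hG τ).summable.norm
  have h := (summable_norm_sum_mul_antidiagonal_of_summable_norm h1 h2).of_norm.hasSum
  rw [← tsum_mul_tsum_eq_tsum_sum_antidiagonal_of_summable_norm h1 h2, (hF τ).tsum_eq,
    (hG τ).tsum_eq] at h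
  refine h.congr_fun fun m => ?_
  rw [PowerSeries.coeff_mul, Finset.sum_smul]
  refine Finset.sum_congr rfl fun i hi => ?_
  rw [← Finset.HasAntidiagonal.mem_antidiagonal.1 hi, pow_add]
  simp only [smul_eq_mul]
  ring

theorem qParam_one_pow (z : ℂ) (m : ℕ) : qParam 1 z ^ m = exp (m * (2 * Real.pi * I * z)) := by
  rw [qParam, ← Complex.exp_nat_mul]; simp

theorem HasQSeries.normalizedDeriv {F : ℍ → ℂ} {φ : ℂ⟦X⟧} (hF : HasQSeries F φ) :
    HasQSeries (D F) (qD φ) := fun τ => by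
  -- On this half plane every term is dominated by its absolute value at the boundary point `σ`,
  -- where the series converges absolutely. This justifies termwise differentiation.
  set U : Set ℂ := {w | τ.im / 2 < w.im} with hU
  have hUo : IsOpen U := isOpen_lt continuous_const Complex.continuous_im
  have hτ : (τ : ℂ) ∈ U := by
    have := τ.im_pos
    simp only [hU, Set.mem_ofPred_eq, coe_im]; linarith
  have hpos : ∀ w ∈ U, 0 < w.im := fun w hw => by
    have := τ.im_pos
    simp only [hU, Set.mem_ofPred_eq] at hw; linarith
  let σ : ℍ := ⟨(τ.im / 2 : ℝ) * I, by have := τ.im_pos; simpa using this⟩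
  have hd : ∀ (m : ℕ) (w : ℂ), HasDerivAt (fun w : ℂ => PowerSeries.coeff m φ • qParam 1 w ^ m)
      ((2 * Real.pi * I) * (PowerSeries.coeff m (qD φ) • qParam 1 w ^ m)) w := fun m w => by
    rw [show (fun w : ℂ => PowerSeries.coeff m φ • qParam 1 w ^ m)
      = fun w : ℂ => PowerSeries.coeff m φ * exp (m * (2 * Real.pi * I * w)) from
      funext fun w => by rw [qParam_one_pow, smul_eq_mul], qParam_one_pow, coeff_qD, smul_eq_mul]
    have h := ((((hasDerivAt_id w).const_mul (2 * Real.pi * I)).const_mul (m : ℂ)).cexp).const_mul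
      (PowerSeries.coeff m φ)
    refine h.congr_deriv ?_
    simp only [id_eq]
    ring
  have key := Complex.hasSum_deriv_of_summable_norm (U := U) (z := (τ : ℂ))
    (F := fun (m : ℕ) (w : ℂ) => PowerSeries.coeff m φ • qParam 1 w ^ m) ((hF σ).summable.norm)
    (fun m w _ => (hd m w).differentiableAt.differentiableWithinAt) hUo
    (fun m w hw => ?_) hτ
  · have hderiv : deriv (fun w => ∑' m : ℕ, PowerSeries.coeff m φ • qParam 1 w ^ m) (τ : ℂ)
        = deriv (F ∘ ofComplex) (τ : ℂ) := by
      refine Filter.EventuallyEq.deriv_eq ?_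
      filter_upwards [hUo.mem_nhds hτ] with w hw
      have := (hF ⟨w, hpos w hw⟩).tsum_eq
      rw [Function.comp_apply, ofComplex_apply_of_im_pos (hpos w hw), ← this]
    rw [hderiv] at key
    have h2 := key.mul_left (2 * Real.pi * I)⁻¹
    have hne : (2 * Real.pi * I : ℂ) ≠ 0 := by simp [Real.pi_ne_zero]
    refine h2.congr_fun fun m => ?_
    rw [(hd m τ).deriv, inv_mul_cancel_left₀ hne]
  · rw [norm_smul, norm_smul, norm_pow, norm_pow]
    refine mul_le_mul_of_nonneg_left (pow_le_pow_left₀ (norm_nonneg _) ?_ _) (norm_nonneg _)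
    rw [norm_qParam, norm_qParam, Real.exp_le_exp]
    have h1 : ((σ : ℍ) : ℂ).im = τ.im / 2 := by simp [σ]
    have h2 : τ.im / 2 < w.im := hw
    rw [h1]
    have := Real.pi_pos
    nlinarith

/-- A function invariant under `SL(2, ℤ)` with a convergent `q`-series is a modular form. -/
theorem HasQSeries.isModular {F : ℍ → ℂ} {φ : ℂ⟦X⟧} (hF : HasQSeries F φ) (hd : MDiff F) {k : ℤ}
    (h : ∀ γ : SL(2, ℤ), F ∣[k] γ = F) : ∃ f : ModularForm 𝒮ℒ k, ⇑f = F ∧ qExp f = φ := by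
  have hb : IsBoundedAtImInfty F := isBoundedAtImInfty_of_hasSum_qExpansion one_pos hF
  let f : ModularForm 𝒮ℒ k :=
    { toFun := F
      slash_action_eq' := fun _ ⟨γ, hγ⟩ => hγ ▸ h γ
      holo' := hd
      bdd_at_cusps' := fun {c} hc => by
        rw [Subgroup.IsArithmetic.isCusp_iff_isCusp_SL2Z] at hc
        rw [OnePoint.isBoundedAt_iff_forall_SL2Z hc]
        intro γ _
        -- Invariance transports boundedness at `∞` to every other cusp.
        rw [h γ]
        exact hb }
  refine ⟨f, rfl, ?_⟩
  ext m
  exact (ModularFormClass.qExpansion_coeff_unique (f := f) one_pos one_mem_strictPeriods_SL hF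
    m).symm

theorem hasQSeries_modularForm {k : ℤ} (f : ModularForm 𝒮ℒ k) : HasQSeries f (qExp f) := fun τ => by
  have : Fact (IsCusp OnePoint.infty 𝒮ℒ) :=
    ⟨Subgroup.isCusp_of_mem_strictPeriods one_pos one_mem_strictPeriods_SL⟩
  exact ModularForm.hasSum_qExpansion f one_pos one_mem_strictPeriods_SL τ

/-- In weight less than `12` a modular form is determined by its constant term. -/
theorem qExp_eq_of_coeff_zero {k : ℕ} (hk : k < 12) {a b : ℤ} (ha : a = k) (hb : b = k)
    (f : ModularForm 𝒮ℒ a) (g : ModularForm 𝒮ℒ b)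
    (h : PowerSeries.coeff 0 (qExp f) = PowerSeries.coeff 0 (qExp g)) : qExp f = qExp g := by
  subst ha hb
  have hs : qExp (f - g) = qExp f - qExp g :=
    ModularForm.qExpansion_sub one_pos one_mem_strictPeriods_SL f g
  have h0 : f - g = 0 := by
    refine ModularForm.sturm_bound_levelOne_nat ?_
    rw [Nat.div_eq_of_lt hk, Nat.cast_zero]
    refine lt_of_lt_of_le (by norm_num : (0 : ℕ∞) < (1 : ℕ)) (PowerSeries.nat_le_order _ _ ?_)
    intro i hi
    obtain rfl : i = 0 := by omega
    have : PowerSeries.coeff 0 (qExp (f - g)) = 0 := by rw [hs, map_sub, h, sub_self]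
    exact this
  rw [sub_eq_zero.1 h0]

/-- The `q`-series of the Eisenstein series of weight two. -/
def e2 : ℂ⟦X⟧ := PowerSeries.mk fun m => if m = 0 then 1 else -24 * (ArithmeticFunction.sigma 1 m : ℂ)

theorem hasQSeries_E2 : HasQSeries EisensteinSeries.E2 e2 := fun τ => by
  have := EisensteinSeries.hasSum_qExpansion_E2 (z := τ)
  simpa only [e2, PowerSeries.coeff_mk, qParam, ofReal_one, div_one] using this

/-- The `q`-series of the Eisenstein series of weight four. -/
abbrev e4 : ℂ⟦X⟧ := qExp ModularForm.E₄

/-- The `q`-series of the Eisenstein series of weight six. -/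
abbrev e6 : ℂ⟦X⟧ := qExp ModularForm.E₆

theorem coeff_e2_zero : PowerSeries.coeff 0 e2 = 1 := by simp [e2]

theorem coeff_e4_zero : PowerSeries.coeff 0 e4 = 1 :=
  EisensteinSeries.E_qExpansion_coeff_zero (k := 4) (by norm_num) (by decide)

theorem coeff_e6_zero : PowerSeries.coeff 0 e6 = 1 :=
  EisensteinSeries.E_qExpansion_coeff_zero (k := 6) (by norm_num) (by decide)

theorem modularForm_slash_SL {k : ℤ} (f : ModularForm 𝒮ℒ k) (γ : SL(2, ℤ)) :
    (⇑f) ∣[k] γ = f := by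
  rw [ModularForm.SL_slash]
  exact f.slash_action_eq' _ ⟨γ, rfl⟩

/-- The Serre derivative of a modular form. -/
theorem serre_isModular {k : ℤ} (f : ModularForm 𝒮ℒ k) : ∃ g : ModularForm 𝒮ℒ (k + 2),
    qExp g = qD (qExp f) - (k / 12 : ℂ) • (e2 * qExp f) := by
  have h1 : HasQSeries (Derivative.serreDerivative k f)
      (qD (qExp f) - (k / 12 : ℂ) • (e2 * qExp f)) := by
    have := (hasQSeries_modularForm f).normalizedDeriv.sub
      ((hasQSeries_E2.mul (hasQSeries_modularForm f)).smul (k / 12 : ℂ))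
    convert this using 1
    ext z
    simp [div_eq_mul_inv, mul_assoc]
  obtain ⟨g, -, hg⟩ := h1.isModular (Derivative.serreDerivative_mdifferentiable _ f.holo')
    fun γ => Derivative.serreDerivative_slash_invariant f.holo' (modularForm_slash_SL f γ)
  exact ⟨g, hg⟩

/-- With `p = 1 / (2πi)` and `u = c / (cτ + d)`, the anomaly of `E₂` is `12 p u` and `D` turns it
into `-12 p² u²`. These terms, and the one from `D` failing to commute with the slash action, cancel
against the square of the anomaly in `E₂² / 12`. -/
theorem D_E2_slash (γ : SL(2, ℤ)) :
    (D EisensteinSeries.E2 - (12⁻¹ : ℂ) • (EisensteinSeries.E2 * EisensteinSeries.E2)) ∣[(4 : ℤ)] γ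
      = D EisensteinSeries.E2 - (12⁻¹ : ℂ) • (EisensteinSeries.E2 * EisensteinSeries.E2) := by
  ext z
  have hpi : (Real.pi : ℂ) ≠ 0 := by simp [Real.pi_ne_zero]
  set p : ℂ := (2 * Real.pi * I)⁻¹ with hp
  have hE : EisensteinSeries.E2 ∣[(2 : ℤ)] γ
      = fun w : ℍ => EisensteinSeries.E2 w + 12 * p * ((γ 1 0 : ℂ) / denom γ w) := by
    rw [EisensteinSeries.E2_slash_action]
    ext w
    have h := denom_ne_zero γ w
    simp only [Pi.sub_apply, Pi.smul_apply, smul_eq_mul, EisensteinSeries.D2, riemannZeta_two, hp]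
    field_simp
    linear_combination (-12 * (γ 1 0 : ℂ)) * I_sq
  have hD : D (EisensteinSeries.E2 ∣[(2 : ℤ)] γ) z
      = D EisensteinSeries.E2 z - 12 * p ^ 2 * ((γ 1 0 : ℂ) / denom γ z) ^ 2 := by
    have h1 := (mdifferentiableAt_iff.mp (E2_mdifferentiable z)).hasDerivAt
    have h2 := (hasDerivAt_denom_zpow γ (-1) z).const_mul (12 * p * (γ 1 0 : ℂ))
    have h3 : (EisensteinSeries.E2 ∣[(2 : ℤ)] γ) ∘ ofComplex =ᶠ[𝓝 (z : ℂ)]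
        fun w => (EisensteinSeries.E2 ∘ ofComplex) w + 12 * p * (γ 1 0 : ℂ) * denom γ w ^ (-1 : ℤ) := by
      filter_upwards [isOpen_upperHalfPlaneSet.mem_nhds z.im_pos] with w hw
      rw [hE]
      simp only [Function.comp_apply, ofComplex_apply_of_im_pos hw, zpow_neg_one]
      ring
    have h := denom_ne_zero γ z
    simp only [Derivative.normalizedDerivOfComplex]
    rw [h3.deriv_eq]
    refine (congrArg _ (h1.add h2).deriv).trans ?_
    have hc : ((γ : GL (Fin 2) ℝ) 1 0 : ℂ) = (γ 1 0 : ℂ) := by simp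
    rw [hc, ← hp, show (-1 - 1 : ℤ) = -2 by norm_num, zpow_neg]
    push_cast
    rw [div_pow, zpow_two]
    ring
  have h := congrFun (Derivative.normalizedDerivOfComplex_SL_slash (k := 2) (γ := γ)
    E2_mdifferentiable) z
  rw [hD] at h
  have h2 := congrFun (ModularForm.mul_slash_SL2 2 2 γ EisensteinSeries.E2 EisensteinSeries.E2) z
  rw [hE] at h2 h
  rw [show (2 + 2 : ℤ) = 4 by norm_num] at h2 h
  rw [ModularForm.SL_slash_apply] at h2 ⊢
  simp only [Pi.sub_apply, Pi.mul_apply, Pi.smul_apply, smul_eq_mul] at h h2 ⊢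
  rw [ModularForm.SL_slash_apply, ← hp] at h
  push_cast at h
  linear_combination -h - 12⁻¹ * h2

theorem serre_E2_isModular : ∃ g : ModularForm 𝒮ℒ 4,
    qExp g = qD e2 - (12⁻¹ : ℂ) • (e2 * e2) := by
  obtain ⟨g, -, hg⟩ := (hasQSeries_E2.normalizedDeriv.sub
    ((hasQSeries_E2.mul hasQSeries_E2).smul 12⁻¹)).isModular
    ((Derivative.normalizedDerivOfComplex_mdifferentiable
      E2_mdifferentiable).sub
      ((E2_mdifferentiable.mul E2_mdifferentiable).const_smul _))
    D_E2_slash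
  exact ⟨g, hg⟩

theorem coeff_zero_mul (φ ψ : ℂ⟦X⟧) :
    PowerSeries.coeff 0 (φ * ψ) = PowerSeries.coeff 0 φ * PowerSeries.coeff 0 ψ := by
  simp

theorem qExp_smul {k : ℤ} (c : ℂ) (f : ModularForm 𝒮ℒ k) :
    qExp (c • f : ModularForm 𝒮ℒ k) = c • qExp f :=
  ModularForm.qExpansion_smul one_pos one_mem_strictPeriods_SL c f

/-- Each of Ramanujan's three equations compares a Serre derivative, of weight `6`, `8` or `4`, with
a multiple of `E₆`, `E₄ ^ 2` or `E₄`. In these weights the constant term decides. -/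
theorem qD_e4 : qD e4 = (3⁻¹ : ℂ) • (e2 * e4 - e6) := by
  obtain ⟨g, hg⟩ := serre_isModular ModularForm.E₄
  have h := qExp_eq_of_coeff_zero (k := 6) (by norm_num) (by norm_num) (by norm_num) g
    ((-3⁻¹ : ℂ) • ModularForm.E₆) ?_
  · rw [hg, qExp_smul] at h
    push_cast at h
    rw [sub_eq_iff_eq_add.1 h]
    module
  · rw [hg, qExp_smul]
    simp only [map_sub, map_smul, coeff_qD, coeff_zero_mul, coeff_e2_zero,
      coeff_e4_zero, coeff_e6_zero]
    norm_num

theorem qD_e6 : qD e6 = (2⁻¹ : ℂ) • (e2 * e6 - e4 ^ 2) := by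
  obtain ⟨g, hg⟩ := serre_isModular ModularForm.E₆
  have hp : qExp (ModularForm.E₄.pow 2) = e4 ^ 2 :=
    ModularForm.qExpansion_pow one_pos one_mem_strictPeriods_SL _ 2
  have h := qExp_eq_of_coeff_zero (k := 8) (by norm_num) (by norm_num) (by norm_num) g
    ((-2⁻¹ : ℂ) • ModularForm.E₄.pow 2) ?_
  · rw [hg, qExp_smul, hp] at h
    push_cast at h
    rw [sub_eq_iff_eq_add.1 h]
    module
  · rw [hg, qExp_smul, hp]
    simp only [map_sub, map_smul, coeff_qD, coeff_zero_mul, coeff_e2_zero, pow_two,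
      coeff_e4_zero, coeff_e6_zero]
    norm_num

theorem qD_e2 : qD e2 = (12⁻¹ : ℂ) • (e2 ^ 2 - e4) := by
  obtain ⟨g, hg⟩ := serre_E2_isModular
  have h := qExp_eq_of_coeff_zero (k := 4) (by norm_num) (by norm_num) (by norm_num) g
    ((-12⁻¹ : ℂ) • ModularForm.E₄) ?_
  · rw [hg, qExp_smul] at h
    rw [sub_eq_iff_eq_add.1 h, pow_two]
    module
  · rw [hg, qExp_smul]
    simp only [map_sub, map_smul, coeff_qD, coeff_zero_mul, coeff_e2_zero,
      coeff_e4_zero]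
    norm_num

/-- `Δ = (E₄ ^ 3 - E₆ ^ 2) / 1728`. -/
theorem qExp_discriminant :
    (1728 : ℂ) • qExp ModularForm.discriminant = e4 ^ 3 - e6 ^ 2 := by
  have h4 := hasQSeries_modularForm ModularForm.E₄
  have h6 := hasQSeries_modularForm ModularForm.E₆
  have h : HasQSeries CuspForm.discriminant
      ((1728⁻¹ : ℂ) • (e4 * e4 * e4 - e6 * e6)) := by
    convert (((h4.mul h4).mul h4).sub (h6.mul h6)).smul 1728⁻¹ using 1
    ext z
    have := ModularForm.discriminant_eq_E₄_cube_sub_E₆_sq z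
    rw [CuspForm.coe_discriminant, this]
    simp only [Pi.smul_apply, Pi.sub_apply, Pi.mul_apply, smul_eq_mul]
    ring
  have h2 : qExp CuspForm.discriminant = (1728⁻¹ : ℂ) • (e4 * e4 * e4 - e6 * e6) := by
    ext m
    exact (ModularFormClass.qExpansion_coeff_unique (f := CuspForm.discriminant) one_pos
      one_mem_strictPeriods_SL h m).symm
  rw [← CuspForm.coe_discriminant, h2, smul_smul]
  norm_num
  ring

theorem coeff_e4_one : PowerSeries.coeff 1 e4 = 240 := ModularForm.E₄_qExpansion_coeff_one

end QSeries

open MvPowerSeries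

/-! ### Columns of a power series in two variables -/

theorem ex_eq (d : Fin 2 →₀ ℕ) : d = ex (d 0) (d 1) := by
  ext i; fin_cases i <;> simp [ex]

theorem ex_add (a b c d : ℕ) : ex a b + ex c d = ex (a + c) (b + d) := by
  ext i; fin_cases i <;> simp [ex]

/-- The coefficient of `z₂ ^ m`, a power series in `z₁`. -/
def col (m : ℕ) : Ser →ₗ[ℂ] ℂ⟦X⟧ where
  toFun F := PowerSeries.mk fun n => coeff (ex n m) F
  map_add' F G := by ext; simp
  map_smul' c F := by ext; simp

@[simp] theorem coeff_col (n m : ℕ) (F : Ser) :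
    PowerSeries.coeff n (col m F) = coeff (ex n m) F := by simp [col]

theorem col_ext {F G : Ser} (h : ∀ m, col m F = col m G) : F = G :=
  ser_ext fun n m => by rw [← coeff_col, h m, coeff_col]

/-- The series with given columns. -/
def ofCol (c : ℕ → ℂ⟦X⟧) : Ser := fun d => PowerSeries.coeff (d 0) (c (d 1))

@[simp] theorem col_ofCol (c : ℕ → ℂ⟦X⟧) (m : ℕ) : col m (ofCol c) = c m := by
  ext n
  rw [coeff_col]
  change PowerSeries.coeff (ex n m 0) (c (ex n m 1)) = _
  rw [ex_zero, ex_one]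

theorem col_mul (m : ℕ) (F G : Ser) :
    col m (F * G) = ∑ p ∈ Finset.HasAntidiagonal.antidiagonal m, col p.1 F * col p.2 G := by
  ext n
  rw [coeff_col, coeff_mul, map_sum]
  simp only [PowerSeries.coeff_mul, coeff_col]
  rw [← Finset.sum_product']
  refine Finset.sum_bij' (fun d _ => ((d.1 1, d.2 1), (d.1 0, d.2 0)))
    (fun p _ => (ex p.2.1 p.1.1, ex p.2.2 p.1.2)) ?_ ?_ ?_ ?_ ?_
  · rintro ⟨a, b⟩ h
    have h := Finset.HasAntidiagonal.mem_antidiagonal.1 h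
    simp only [Finset.mem_product, Finset.HasAntidiagonal.mem_antidiagonal]
    have h0 := DFunLike.congr_fun h 0
    have h1 := DFunLike.congr_fun h 1
    rw [ex_zero] at h0
    rw [ex_one] at h1
    exact ⟨h1, h0⟩
  · rintro ⟨⟨a, b⟩, ⟨c, d⟩⟩ h
    simp only [Finset.mem_product, Finset.HasAntidiagonal.mem_antidiagonal] at h ⊢
    rw [ex_add, h.1, h.2]
  · rintro ⟨a, b⟩ -
    exact Prod.ext (ex_eq a).symm (ex_eq b).symm
  · rintro ⟨⟨a, b⟩, ⟨c, d⟩⟩ -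
    simp [ex_zero, ex_one]
  · rintro ⟨a, b⟩ -
    rw [← ex_eq, ← ex_eq]

theorem col_zero_mul (F G : Ser) : col 0 (F * G) = col 0 F * col 0 G := by simp [col_mul]

theorem col_one (m : ℕ) : col m 1 = if m = 0 then 1 else 0 := by
  ext n
  have h : ex n m = 0 ↔ m = 0 ∧ n = 0 := by
    constructor
    · intro h
      have h0 := DFunLike.congr_fun h 0
      have h1 := DFunLike.congr_fun h 1
      rw [ex_zero] at h0
      rw [ex_one] at h1
      exact ⟨h1, h0⟩
    · rintro ⟨rfl, rfl⟩; simp [ex]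
  rw [coeff_col, coeff_one, if_congr h rfl rfl]
  by_cases hm : m = 0 <;> simp [hm, PowerSeries.coeff_one]

/-- Setting `z₂ = 0`. -/
def col₀ : Ser →ₐ[ℂ] ℂ⟦X⟧ :=
  AlgHom.ofLinearMap (col 0) (by simp [col_one]) col_zero_mul

theorem col₀_apply (F : Ser) : col₀ F = col 0 F := rfl

/-- Power series in `z₁`. -/
def inc : ℂ⟦X⟧ →ₐ[ℂ] Ser :=
  AlgHom.ofLinearMap
    { toFun := fun φ => ofCol fun m => if m = 0 then φ else 0
      map_add' := fun φ ψ => col_ext fun m => by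
        simp only [col_ofCol, map_add]; split_ifs <;> simp
      map_smul' := fun c φ => col_ext fun m => by
        simp only [col_ofCol, map_smul]; split_ifs <;> simp }
    (col_ext fun m => by simp [col_one])
    (fun φ ψ => col_ext fun m => by
      simp only [LinearMap.coe_mk, AddHom.coe_mk, col_mul, col_ofCol]
      by_cases hm : m = 0
      · subst hm; simp
      · rw [if_neg hm]
        refine (Finset.sum_eq_zero fun p hp => ?_).symm
        have := Finset.HasAntidiagonal.mem_antidiagonal.1 hp
        by_cases h1 : p.1 = 0
        · rw [if_neg (by omega : p.2 ≠ 0), mul_zero]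
        · rw [if_neg h1, zero_mul])

theorem col_inc (m : ℕ) (φ : ℂ⟦X⟧) : col m (inc φ) = if m = 0 then φ else 0 :=
  col_ofCol (fun m => if m = 0 then φ else 0) m

theorem col_inc_mul (m : ℕ) (φ : ℂ⟦X⟧) (F : Ser) : col m (inc φ * F) = φ * col m F := by
  rw [col_mul, Finset.Nat.sum_antidiagonal_eq_sum_range_succ_mk, Finset.sum_range_succ']
  simp [col_inc]

theorem col_z₂_mul_zero (F : Ser) : col 0 (z₂ * F) = 0 := by
  ext n; simp [coeff_z₂_mul_zero]

theorem col_z₂_mul_succ (m : ℕ) (F : Ser) : col (m + 1) (z₂ * F) = col m F := by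
  ext n; simp [coeff_z₂_mul_succ]

theorem inc_X : inc PowerSeries.X = z₁ := by
  refine ser_ext fun n m => ?_
  rw [← coeff_col, col_inc]
  have h : z₁ = z₁ * 1 := (mul_one _).symm
  rw [h]
  cases n with
  | zero => rw [coeff_z₁_mul_zero]; split_ifs <;> simp
  | succ n =>
    rw [coeff_z₁_mul_succ, ← coeff_col, col_one]
    split_ifs <;> simp [PowerSeries.coeff_X, PowerSeries.coeff_one]

theorem z₂_pow_dvd_iff (M : ℕ) (F : Ser) : z₂ ^ M ∣ F ↔ ∀ m < M, col m F = 0 := by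
  rw [z₂, X_pow_dvd_iff]
  constructor
  · intro h m hm
    ext n
    rw [coeff_col, h _ (by rwa [ex_one]), map_zero]
  · intro h d hd
    rw [ex_eq d, ← coeff_col, h _ hd, map_zero]

theorem constantCoeff_col₀ (F : Ser) : PowerSeries.constantCoeff (col 0 F) = constantCoeff F := by
  rw [← PowerSeries.coeff_zero_eq_constantCoeff_apply, coeff_col,
    ← coeff_zero_eq_constantCoeff_apply]
  simp [ex]

/-! ### Euler operators and the chain rule -/

theorem euler_mul (i : Fin 2) (F G : Ser) : euler i (F * G) = euler i F * G + F * euler i G := by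
  change X i * pderiv ℂ i (F * G) = X i * pderiv ℂ i F * G + F * (X i * pderiv ℂ i G)
  rw [Derivation.leibniz, smul_eq_mul, smul_eq_mul]
  ring

theorem euler_one (i : Fin 2) : euler i 1 = 0 := by
  change X i * pderiv ℂ i 1 = 0
  simp

/-- An Euler operator as a derivation. -/
def eulerD (i : Fin 2) : Derivation ℂ Ser Ser :=
  Derivation.mk' (euler i) fun F G => by rw [euler_mul]; simp only [smul_eq_mul]; ring

theorem eulerD_apply (i : Fin 2) (F : Ser) : eulerD i F = euler i F := rfl

theorem euler_pow (i : Fin 2) (F : Ser) (n : ℕ) :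
    euler i (F ^ n) = n * F ^ (n - 1) * euler i F := by
  rw [← eulerD_apply, Derivation.leibniz_pow, eulerD_apply]
  simp only [smul_eq_mul, nsmul_eq_mul]
  ring

theorem mul_inv_cancel_ser {F : Ser} (h : constantCoeff F ≠ 0) : F * F⁻¹ = 1 :=
  MvPowerSeries.mul_inv_cancel F h

theorem euler_inv (i : Fin 2) {F : Ser} (h : constantCoeff F ≠ 0) :
    euler i F⁻¹ = -F⁻¹ ^ 2 * euler i F := by
  have h1 := mul_inv_cancel_ser h
  have h2 := congrArg (euler i) h1
  rw [euler_mul, euler_one] at h2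
  linear_combination F⁻¹ * h2 - euler i F⁻¹ * h1

theorem col_euler_zero (m : ℕ) (F : Ser) : col m (euler 0 F) = qD (col m F) := by
  ext n
  rw [coeff_col, coeff_euler, coeff_qD, coeff_col, ex_zero]

theorem col_euler_one (m : ℕ) (F : Ser) : col m (euler 1 F) = (m : ℂ) • col m F := by
  ext n
  rw [coeff_col, coeff_euler, ex_one, map_smul, coeff_col, smul_eq_mul]

/-- `A ^ M` has order at least `M`, so the `A`-adic topology is separated. Identities between
substituted series can thus be checked on truncations. -/
theorem eq_of_forall_pow_dvd {F G A : Ser} (hA : constantCoeff A = 0)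
    (h : ∀ M, A ^ M ∣ F - G) : F = G := by
  rw [← sub_eq_zero]
  ext d
  rw [map_zero]
  obtain ⟨H, hH⟩ := h (d.degree + 1)
  refine coeff_of_lt_order ?_
  rw [hH]
  have h1 := le_order_pow_of_constantCoeff_eq_zero (d.degree + 1) hA
  have h2 := le_order_mul (f := A ^ (d.degree + 1)) (g := H)
  refine lt_of_lt_of_le ?_ (h1.trans (le_self_add.trans h2))
  exact_mod_cast Nat.lt_succ_self _

/-- A power series is a polynomial up to a high power of the variable. -/
theorem exists_trunc (φ : ℂ⟦X⟧) (M : ℕ) : ∃ (p : Polynomial ℂ) (ψ : ℂ⟦X⟧),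
    φ = (p : ℂ⟦X⟧) + PowerSeries.X ^ M * ψ := by
  refine ⟨PowerSeries.trunc M φ, ?_⟩
  have : PowerSeries.X ^ M ∣ φ - (PowerSeries.trunc M φ : ℂ⟦X⟧) := by
    rw [PowerSeries.X_pow_dvd_iff]
    intro m hm
    rw [map_sub, PowerSeries.coeff_coe_trunc_of_lt hm, sub_self]
  obtain ⟨ψ, hψ⟩ := this
  exact ⟨ψ, by rw [← hψ]; ring⟩

/-- The chain rule holds for polynomials, and a tail `X ^ (M + 1) ψ` contributes only multiples of
`A ^ M` to either side, one power being lost to the derivative. -/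
theorem euler_subst (i : Fin 2) {A : Ser} (hA : constantCoeff A = 0) (φ : ℂ⟦X⟧) :
    euler i (φ.subst A) = (PowerSeries.derivative ℂ φ).subst A * euler i A := by
  have hs := PowerSeries.HasSubst.of_constantCoeff_zero hA
  refine eq_of_forall_pow_dvd hA fun M => ?_
  obtain ⟨p, ψ, rfl⟩ := exists_trunc φ (M + 1)
  have h1 : euler i ((p : ℂ⟦X⟧).subst A)
      = (PowerSeries.derivative ℂ (p : ℂ⟦X⟧)).subst A * euler i A := by
    rw [PowerSeries.subst_coe hs, PowerSeries.derivative_coe, PowerSeries.subst_coe hs,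
      ← eulerD_apply, Derivation.comp_aeval_eq, smul_eq_mul, eulerD_apply]
  rw [← PowerSeries.coe_substAlgHom hs] at h1 ⊢
  have h2 : PowerSeries.substAlgHom hs (PowerSeries.X : ℂ⟦X⟧) = A := by
    rw [PowerSeries.coe_substAlgHom, PowerSeries.subst_X hs]
  generalize (PowerSeries.substAlgHom hs : ℂ⟦X⟧ →ₐ[ℂ] Ser) = σ at h1 h2 ⊢
  simp only [map_add, Derivation.leibniz, Derivation.leibniz_pow, smul_eq_mul, nsmul_eq_mul,
    map_mul, map_pow, euler_mul, euler_pow, h1, h2, Nat.add_sub_cancel]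
  generalize ((M + 1 : ℕ) : Ser) = c
  generalize ((M + 1 : ℕ) : ℂ⟦X⟧) = c'
  rw [pow_succ]
  refine ⟨c * euler i A * σ ψ
    + A * euler i (σ ψ) - (A * σ (PowerSeries.derivative ℂ ψ) + σ ψ *
        (σ c' * σ (PowerSeries.derivative ℂ PowerSeries.X))) * euler i A, ?_⟩
  ring

/-! ### Substitution of `q_E` -/

/-- `S / X₀`. -/
def logqE : Ser := S * X₀⁻¹

/-- This is the logarithmic derivative of `q_E`; the extra `1` for `i = 0` comes from `log z₁`. -/
theorem euler_qE (i : Fin 2) : euler i qE = qE * (euler i logqE + if i = 0 then 1 else 0) := by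
  have h : euler i z₁ = z₁ * if i = 0 then 1 else 0 := by
    change X i * pderiv ℂ i (X 0) = _
    rw [pderiv_X]
    fin_cases i <;> simp [z₁]
  have h0 : constantCoeff logqE = 0 := by simp [logqE, S_constantCoeff]
  have hq : qE = z₁ * PowerSeries.subst logqE (PowerSeries.exp ℂ) := rfl
  rw [hq, euler_mul, h, euler_subst i h0, PowerSeries.derivative_exp]
  ring

/-- Substitution of `q_E` as an algebra homomorphism. -/
def atEHom : ℂ⟦X⟧ →ₐ[ℂ] Ser := PowerSeries.substAlgHom hasSubst_qE

theorem atEHom_apply (φ : ℂ⟦X⟧) : atEHom φ = atE φ := by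
  rw [atEHom, PowerSeries.coe_substAlgHom]; rfl

theorem atEHom_X : atEHom PowerSeries.X = qE := by
  rw [atEHom_apply, atE, PowerSeries.subst_X hasSubst_qE]

theorem euler_atE (i : Fin 2) (φ : ℂ⟦X⟧) : euler i (atEHom φ)
    = (euler i logqE + if i = 0 then 1 else 0) * atEHom (qD φ) := by
  rw [qD, map_mul, atEHom_X, atEHom_apply, atEHom_apply, atE, euler_subst i qE_constantCoeff,
    euler_qE, atE]
  ring

theorem constantCoeff_atE (φ : ℂ⟦X⟧) :
    constantCoeff (atEHom φ) = PowerSeries.constantCoeff φ := by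
  obtain ⟨ψ, hψ⟩ : PowerSeries.X ∣ φ - PowerSeries.C (PowerSeries.constantCoeff φ) := by
    rw [PowerSeries.X_dvd_iff]; simp
  rw [sub_eq_iff_eq_add.1 hψ]
  have : atEHom (PowerSeries.C (PowerSeries.constantCoeff φ)) = C (PowerSeries.constantCoeff φ) := by
    rw [atEHom_apply, atE, PowerSeries.subst_C]
  rw [map_add, map_mul, atEHom_X, this]
  simp [qE_constantCoeff]

/-! ### Polynomials in `1 - 864 z₁` with degree bound and parity -/

/-- Polynomials of degree at most `d` and of the parity of `d`. -/
def parPoly (d : ℤ) : Submodule ℂ (Polynomial ℂ) :=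
  Submodule.span ℂ {p | ∃ i k : ℕ, (i : ℤ) + 2 * k = d ∧ p = Polynomial.X ^ i}

theorem X_pow_mem_parPoly {d : ℤ} (i k : ℕ) (h : (i : ℤ) + 2 * k = d) :
    Polynomial.X ^ i ∈ parPoly d := Submodule.subset_span ⟨i, k, h, rfl⟩

theorem one_mem_parPoly : (1 : Polynomial ℂ) ∈ parPoly 0 := by
  simpa using X_pow_mem_parPoly (d := 0) 0 0 (by simp)

theorem X_mem_parPoly : (Polynomial.X : Polynomial ℂ) ∈ parPoly 1 := by
  simpa using X_pow_mem_parPoly (d := 1) 1 0 (by simp)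

theorem parPoly_le (d : ℤ) : parPoly d ≤ parPoly (d + 2) := by
  refine Submodule.span_mono ?_
  rintro _ ⟨i, k, h, rfl⟩
  exact ⟨i, k + 1, by push_cast; omega, rfl⟩

theorem mul_mem_parPoly {a b : ℤ} {p q : Polynomial ℂ} (hp : p ∈ parPoly a) (hq : q ∈ parPoly b) :
    p * q ∈ parPoly (a + b) := by
  have h := Submodule.mul_mem_mul hp hq
  rw [parPoly, parPoly, Submodule.span_mul_span] at h
  refine Submodule.span_mono ?_ h
  rintro _ ⟨_, ⟨i, k, h1, rfl⟩, _, ⟨j, l, h2, rfl⟩, rfl⟩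
  exact ⟨i + j, k + l, by push_cast; omega, (pow_add _ _ _).symm⟩

theorem eq_zero_of_mem_parPoly {d : ℤ} (hd : d < 0) {p : Polynomial ℂ} (hp : p ∈ parPoly d) :
    p = 0 := by
  refine Submodule.span_induction (p := fun p _ => p = 0) ?_ rfl ?_ ?_ hp
  · rintro _ ⟨i, k, h, rfl⟩; omega
  · rintro _ _ _ _ rfl rfl; simp
  · rintro c _ _ rfl; simp

theorem derivative_mem_parPoly {d : ℤ} {p : Polynomial ℂ} (hp : p ∈ parPoly d) :
    Polynomial.derivative p ∈ parPoly (d - 1) := by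
  refine Submodule.span_induction (p := fun p _ => Polynomial.derivative p ∈ parPoly (d - 1))
    ?_ (by simp) ?_ ?_ hp
  · rintro _ ⟨i, k, h, rfl⟩
    rw [Polynomial.derivative_X_pow]
    cases i with
    | zero => simp
    | succ i =>
      rw [← Polynomial.smul_eq_C_mul]
      exact Submodule.smul_mem _ _ (X_pow_mem_parPoly i k (by push_cast at h; omega))
  · intro p q _ _ h1 h2
    rw [map_add]
    exact add_mem h1 h2
  · intro c p _ h
    rw [Polynomial.derivative_smul]
    exact Submodule.smul_mem _ _ h

/-- Parity turns a zero at `1` into zeros at both `1` and `-1`. Modulo `1 - X ^ 2` all monomials of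
one parity agree, so the remainder is a constant times `1` or `X`, and the value at `1` is that
constant. -/
theorem exists_eq_one_sub_X_sq_mul {d : ℤ} {p : Polynomial ℂ} (hp : p ∈ parPoly d)
    (h1 : p.eval 1 = 0) : ∃ q ∈ parPoly (d - 2), p = (1 - Polynomial.X ^ 2) * q := by
  have key : ∃ q ∈ parPoly (d - 2), ∃ c : ℂ,
      p = (1 - Polynomial.X ^ 2) * q + Polynomial.C c * Polynomial.X ^ (d % 2).toNat := by
    refine Submodule.span_induction (p := fun p _ => ∃ q ∈ parPoly (d - 2), ∃ c : ℂ,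
      p = (1 - Polynomial.X ^ 2) * q + Polynomial.C c * Polynomial.X ^ (d % 2).toNat) ?_ ?_ ?_ ?_ hp
    · rintro _ ⟨i, k, h, rfl⟩
      induction i using Nat.strong_induction_on generalizing k with
      | _ i ih =>
        by_cases hi : i < 2
        · refine ⟨0, zero_mem _, 1, ?_⟩
          rw [show (d % 2).toNat = i by omega]
          simp
        · obtain ⟨j, rfl⟩ : ∃ j, i = j + 2 := ⟨i - 2, by omega⟩
          obtain ⟨q, hq, c, hc⟩ := ih j (by omega) (k + 1) (by push_cast at h ⊢; omega)
          refine ⟨q - Polynomial.X ^ j, sub_mem hq (X_pow_mem_parPoly j k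
            (by push_cast at h; omega)), c, ?_⟩
          linear_combination hc
    · exact ⟨0, zero_mem _, 0, by simp⟩
    · rintro _ _ _ _ ⟨q, hq, c, rfl⟩ ⟨q', hq', c', rfl⟩
      exact ⟨q + q', add_mem hq hq', c + c', by rw [map_add]; ring⟩
    · rintro a _ _ ⟨q, hq, c, rfl⟩
      exact ⟨a • q, Submodule.smul_mem _ _ hq, a * c, by
        rw [map_mul, Polynomial.smul_eq_C_mul, Polynomial.smul_eq_C_mul]; ring⟩
  obtain ⟨q, hq, c, rfl⟩ := key
  have : c = 0 := by simpa using h1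
  exact ⟨q, hq, by simp [this]⟩

/-- `1 - 864 z₁` as a series in one variable. -/
def ss : ℂ⟦X⟧ := 1 - 864 * PowerSeries.X

/-- `1 - 432 z₁` as a series in one variable. -/
def rr : ℂ⟦X⟧ := 1 - 432 * PowerSeries.X

/-- Polynomials in `1 - 864 z₁` of degree at most `d` and of the parity of `d`. -/
def par (d : ℤ) : Submodule ℂ ℂ⟦X⟧ := (parPoly d).map (Polynomial.aeval ss).toLinearMap

theorem aeval_mem_par {d : ℤ} {p : Polynomial ℂ} (hp : p ∈ parPoly d) :
    Polynomial.aeval ss p ∈ par d := Submodule.mem_map_of_mem hp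

theorem exists_of_mem_par {d : ℤ} {φ : ℂ⟦X⟧} (h : φ ∈ par d) :
    ∃ p ∈ parPoly d, Polynomial.aeval ss p = φ := h

theorem one_mem_par : (1 : ℂ⟦X⟧) ∈ par 0 := by simpa using aeval_mem_par one_mem_parPoly

theorem ss_mem_par : ss ∈ par 1 := by simpa using aeval_mem_par X_mem_parPoly

theorem par_le (d : ℤ) : par d ≤ par (d + 2) := Submodule.map_mono (parPoly_le d)

theorem mul_mem_par {a b : ℤ} {φ ψ : ℂ⟦X⟧} (hφ : φ ∈ par a) (hψ : ψ ∈ par b) :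
    φ * ψ ∈ par (a + b) := by
  obtain ⟨p, hp, rfl⟩ := exists_of_mem_par hφ
  obtain ⟨q, hq, rfl⟩ := exists_of_mem_par hψ
  rw [← map_mul]
  exact aeval_mem_par (mul_mem_parPoly hp hq)

theorem eq_zero_of_mem_par {d : ℤ} (hd : d < 0) {φ : ℂ⟦X⟧} (h : φ ∈ par d) : φ = 0 := by
  obtain ⟨p, hp, rfl⟩ := exists_of_mem_par h
  rw [eq_zero_of_mem_parPoly hd hp, map_zero]

theorem constantCoeff_ss : PowerSeries.constantCoeff ss = 1 := by simp [ss]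

theorem constantCoeff_rr : PowerSeries.constantCoeff rr = 1 := by simp [rr]

theorem exists_eq_one_sub_ss_sq_mul {d : ℤ} {φ : ℂ⟦X⟧} (h : φ ∈ par d)
    (h1 : PowerSeries.constantCoeff φ = 0) : ∃ ψ ∈ par (d - 2), φ = (1 - ss ^ 2) * ψ := by
  obtain ⟨p, hp, rfl⟩ := exists_of_mem_par h
  have h2 : PowerSeries.constantCoeff (Polynomial.aeval ss p) = p.eval 1 := by
    rw [Polynomial.aeval_def, Polynomial.hom_eval₂, constantCoeff_ss]
    have : (PowerSeries.constantCoeff (R := ℂ)).comp (algebraMap ℂ ℂ⟦X⟧) = RingHom.id ℂ := by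
      ext; simp
    rw [this]; rfl
  obtain ⟨q, hq, rfl⟩ := exists_eq_one_sub_X_sq_mul hp (h2 ▸ h1)
  exact ⟨Polynomial.aeval ss q, aeval_mem_par hq, by simp⟩

/-- `z d/dz` as a derivation. -/
def qDer : Derivation ℂ ℂ⟦X⟧ ℂ⟦X⟧ := (PowerSeries.X : ℂ⟦X⟧) • PowerSeries.derivative ℂ

theorem qDer_apply (φ : ℂ⟦X⟧) : qDer φ = qD φ := rfl

theorem qD_mul (φ ψ : ℂ⟦X⟧) : qD (φ * ψ) = qD φ * ψ + φ * qD ψ := by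
  simp only [← qDer_apply, Derivation.leibniz, smul_eq_mul]; ring

theorem qD_add (φ ψ : ℂ⟦X⟧) : qD (φ + ψ) = qD φ + qD ψ := map_add qDer φ ψ

theorem qD_sub (φ ψ : ℂ⟦X⟧) : qD (φ - ψ) = qD φ - qD ψ := map_sub qDer φ ψ

theorem qD_X : qD PowerSeries.X = PowerSeries.X := by
  simp [qD, PowerSeries.derivative_X]

theorem qD_one : qD 1 = 0 := by rw [← qDer_apply]; simp

theorem qD_ofNat (n : ℕ) [n.AtLeastTwo] : qD (OfNat.ofNat n) = 0 := by
  rw [← qDer_apply]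
  exact Derivation.map_natCast qDer n

theorem qD_ss : qD ss = -864 * PowerSeries.X := by
  rw [ss, qD_sub, qD_one, qD_mul, qD_X, qD_ofNat]; ring

theorem qD_rr : qD rr = -432 * PowerSeries.X := by
  rw [rr, qD_sub, qD_one, qD_mul, qD_X, qD_ofNat]; ring

theorem ofNat_mul_mem {A : Type*} [Semiring A] [Algebra ℂ A] {V : Submodule ℂ A} {a : A}
    (n : ℕ) [n.AtLeastTwo] (h : a ∈ V) : OfNat.ofNat n * a ∈ V := by
  have := nsmul_mem h n
  rw [nsmul_eq_mul] at this
  exact this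

theorem mem_of_ofNat_mul_mem {A : Type*} [Semiring A] [Algebra ℂ A] {V : Submodule ℂ A} {a : A}
    (n : ℕ) [n.AtLeastTwo] (h : OfNat.ofNat n * a ∈ V) : a ∈ V := by
  have h1 : (OfNat.ofNat n : A) * a = (n : ℂ) • a := by
    rw [Algebra.smul_def, map_natCast]; rfl
  rw [h1] at h
  have hn : (n : ℂ) ≠ 0 := by exact_mod_cast (NeZero.ne n)
  simpa [smul_smul, inv_mul_cancel₀ hn] using Submodule.smul_mem V (n : ℂ)⁻¹ h

/-- The singular points `z = 0` and `z = 1/432` of the equation at `z₂ = 0` sit at `s = 1` and `s =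
-1`. -/
theorem X_mul_rr : 1728 * (PowerSeries.X * rr) = 1 - ss ^ 2 := by
  rw [rr, ss]; ring

theorem one_mem_par_two : (1 : ℂ⟦X⟧) ∈ par 2 := by
  have := par_le 0 one_mem_par
  rwa [zero_add] at this

theorem X_mul_rr_mem : PowerSeries.X * rr ∈ par 2 := by
  refine mem_of_ofNat_mul_mem 1728 ?_
  have h := mul_mem_par ss_mem_par ss_mem_par
  rw [one_add_one_eq_two] at h
  rw [X_mul_rr, pow_two]
  exact sub_mem one_mem_par_two h

/-- The factor `r` is what makes differentiation stay within polynomials in `s` and flip the parity: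
`r z ds/dz = -(1 - s²) / 2`. -/
theorem rr_mul_qD_mem {d : ℤ} {φ : ℂ⟦X⟧} (h : φ ∈ par d) : rr * qD φ ∈ par (d + 1) := by
  obtain ⟨p, hp, rfl⟩ := exists_of_mem_par h
  have h2 : qD (Polynomial.aeval ss p) = Polynomial.aeval ss (Polynomial.derivative p) * qD ss :=
    Derivation.comp_aeval_eq (a := ss) qDer p
  have h1 : rr * qD (Polynomial.aeval ss p)
    = -(864 * (Polynomial.aeval ss (Polynomial.derivative p) * (PowerSeries.X * rr))) := by
    rw [h2, qD_ss]; ring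
  rw [h1]
  refine neg_mem (ofNat_mul_mem 864 ?_)
  have := mul_mem_par (aeval_mem_par (derivative_mem_parPoly hp)) X_mul_rr_mem
  rwa [show d - 1 + 2 = d + 1 by ring] at this

/-! ### Series in `z₂ / (1 - 432 z₁) ^ 3` with such coefficients -/

/-- The condition defining `Fil` on the coefficient of `z₂ ^ m`. -/
def FilCol (j : ℤ) (m : ℕ) (F : Ser) : Prop := rr ^ (3 * m) * col m F ∈ par (3 * m + j)

/-- The series `∑ yᵐ pₘ(1 - 864 z₁)`, `y = z₂ / (1 - 432 z₁) ^ 3`, with `pₘ` of degree at most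
`3m + j` and of the parity of `3m + j`. -/
def Fil (j : ℤ) : Submodule ℂ Ser where
  carrier := {F | ∀ m, FilCol j m F}
  add_mem' h1 h2 m := by
    rw [FilCol, map_add, mul_add]; exact add_mem (h1 m) (h2 m)
  zero_mem' m := by rw [FilCol]; simp
  smul_mem' c F h m := by
    rw [FilCol, map_smul, mul_smul_comm]; exact Submodule.smul_mem _ _ (h m)

theorem FilCol.le {j : ℤ} {m : ℕ} {F : Ser} (h : FilCol j m F) : FilCol (j + 2) m F := by
  have := par_le _ h
  rwa [show (3 * m + j + 2 : ℤ) = 3 * m + (j + 2) by ring] at this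

theorem FilCol.sub {j : ℤ} {m : ℕ} {F G : Ser} (h : FilCol j m F) (h' : FilCol j m G) :
    FilCol j m (F - G) := by
  rw [FilCol, map_sub, mul_sub]; exact sub_mem h h'

theorem FilCol.smul {j : ℤ} {m : ℕ} {F : Ser} (c : ℂ) (h : FilCol j m F) :
    FilCol j m (c • F) := by
  rw [FilCol, map_smul, mul_smul_comm]; exact Submodule.smul_mem _ _ h

theorem filCol_mul {i j : ℤ} {m : ℕ} {F G : Ser}
    (h : ∀ p ∈ Finset.HasAntidiagonal.antidiagonal m, col p.1 F = 0 ∨ (FilCol i p.1 F ∧ FilCol j p.2 G)) :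
    FilCol (i + j) m (F * G) := by
  rw [FilCol, col_mul, Finset.mul_sum]
  refine sum_mem fun p hp => ?_
  have hm := Finset.HasAntidiagonal.mem_antidiagonal.1 hp
  rcases h p hp with h0 | ⟨h1, h2⟩
  · rw [h0]; simp
  · have := mul_mem_par h1 h2
    rw [← hm, show rr ^ (3 * (p.1 + p.2)) * (col p.1 F * col p.2 G)
      = rr ^ (3 * p.1) * col p.1 F * (rr ^ (3 * p.2) * col p.2 G) by ring,
      show (3 * (p.1 + p.2 : ℕ) + (i + j) : ℤ) = 3 * p.1 + i + (3 * p.2 + j) by push_cast; ring]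
    exact this

theorem mul_mem_Fil {i j : ℤ} {F G : Ser} (hF : F ∈ Fil i) (hG : G ∈ Fil j) :
    F * G ∈ Fil (i + j) := fun _ => filCol_mul fun _ _ => Or.inr ⟨hF _, hG _⟩

/-- As `F` starts at order one in `z₂`, column `m` of the product sees only the columns of `G` below
`m`. This drives the induction in `mem_Fil_of_ramanujan`. -/
theorem filCol_mul_of_lt {i j : ℤ} {m : ℕ} {F G : Ser} (hF : F ∈ Fil i) (h0 : col 0 F = 0)
    (hG : ∀ n < m, FilCol j n G) : FilCol (i + j) m (F * G) := by
  refine filCol_mul fun p hp => ?_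
  have hm := Finset.HasAntidiagonal.mem_antidiagonal.1 hp
  by_cases hp0 : p.1 = 0
  · exact Or.inl (by rw [hp0, h0])
  · exact Or.inr ⟨hF _, hG _ (by omega)⟩

theorem one_mem_Fil : (1 : Ser) ∈ Fil 0 := fun m => by
  rw [FilCol, col_one]
  by_cases hm : m = 0
  · subst hm; simpa using one_mem_par
  · simp [hm]

theorem inc_mem_Fil {j : ℤ} {φ : ℂ⟦X⟧} (h : φ ∈ par j) : inc φ ∈ Fil j := fun m => by
  rw [FilCol, col_inc]
  by_cases hm : m = 0
  · subst hm; simpa using h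
  · simp [hm]

theorem Fil_le {j : ℤ} {F : Ser} (h : F ∈ Fil j) : F ∈ Fil (j + 2) := fun m => (h m).le

theorem pow_mem_Fil {j : ℤ} {F : Ser} (h : F ∈ Fil j) (n : ℕ) : F ^ n ∈ Fil (n * j) := by
  induction n with
  | zero => simpa using one_mem_Fil
  | succ n ih =>
    have := mul_mem_Fil ih h
    rw [pow_succ]
    convert this using 2
    push_cast; ring

theorem euler_one_mem_Fil {j : ℤ} {F : Ser} (h : F ∈ Fil j) : euler 1 F ∈ Fil j := fun m => by
  rw [FilCol, col_euler_one, mul_smul_comm]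
  exact Submodule.smul_mem _ _ (h m)

theorem aeval_mem_Fil {A : Ser} (hA : A ∈ Fil 0) (p : Polynomial ℂ) :
    Polynomial.aeval A p ∈ Fil 0 := by
  induction p using Polynomial.induction_on' with
  | add p q hp hq => rw [map_add]; exact add_mem hp hq
  | monomial n c =>
    rw [Polynomial.aeval_monomial, ← Algebra.smul_def]
    have := pow_mem_Fil hA n
    rw [mul_zero] at this
    exact Submodule.smul_mem _ _ this

/-- `Fil 0` is a ring, and since `z₂` divides `A`, column `m` depends only on the truncation of `φ`
beyond degree `m`. -/
theorem subst_mem_Fil {A : Ser} (hA : A ∈ Fil 0) (h0 : col 0 A = 0) (φ : ℂ⟦X⟧) :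
    φ.subst A ∈ Fil 0 := fun m => by
  have hc : constantCoeff A = 0 := by rw [← constantCoeff_col₀, h0, map_zero]
  have hs := PowerSeries.HasSubst.of_constantCoeff_zero hc
  obtain ⟨p, ψ, rfl⟩ := exists_trunc φ (m + 1)
  have hd : z₂ ∣ A := by
    have := (z₂_pow_dvd_iff 1 A).2 fun m hm => by rw [show m = 0 by omega, h0]
    simpa using this
  have h1 : z₂ ^ (m + 1) ∣ A ^ (m + 1) * ψ.subst A := (pow_dvd_pow_of_dvd hd _).mul_right _
  rw [PowerSeries.subst_add hs, PowerSeries.subst_mul hs, PowerSeries.subst_pow hs,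
    PowerSeries.subst_X hs, PowerSeries.subst_coe hs, FilCol, map_add,
    (z₂_pow_dvd_iff _ _).1 h1 m (Nat.lt_succ_self m), add_zero (col m _)]
  exact aeval_mem_Fil hA p m

theorem hasSubst_sub_one {F : Ser} (h : constantCoeff F = 1) : PowerSeries.HasSubst (F - 1) :=
  PowerSeries.HasSubst.of_constantCoeff_zero (by rw [map_sub, h, map_one, sub_self])

theorem constantCoeff_of_col {F : Ser} (h : col 0 F = 1) : constantCoeff F = 1 := by
  rw [← constantCoeff_col₀, h, map_one]

theorem ratPow_mem_Fil {F : Ser} (hF : F ∈ Fil 0) (h : col 0 F = 1) (r : ℚ) :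
    ratPow F r ∈ Fil 0 :=
  subst_mem_Fil (sub_mem hF one_mem_Fil) (by rw [map_sub, h, col_one]; simp) _

theorem ratPow_zero (F : Ser) (h : constantCoeff F = 1) : ratPow F 0 = 1 := by
  have hs := hasSubst_sub_one h
  rw [ratPow, PowerSeries.binomialSeries_zero, ← PowerSeries.coe_substAlgHom hs, map_one]

theorem ratPow_neg (F : Ser) (h : constantCoeff F = 1) (r : ℚ) :
    ratPow F r * ratPow F (-r) = 1 := by
  rw [← ratPow_add F (hasSubst_sub_one h), add_neg_cancel, ratPow_zero F h]

theorem ratPow_natCast (F : Ser) (h : constantCoeff F = 1) (n : ℕ) : ratPow F n = F ^ n := by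
  induction n with
  | zero => rw [Nat.cast_zero, ratPow_zero F h, pow_zero]
  | succ n ih =>
    rw [Nat.cast_succ, ratPow_add F (hasSubst_sub_one h), ih, ratPow_one F (hasSubst_sub_one h),
      pow_succ]

theorem ratPow_mul_natCast (F : Ser) (h : constantCoeff F = 1) (r : ℚ) (n : ℕ) :
    ratPow F r ^ n = ratPow F (n * r) := by
  induction n with
  | zero => rw [Nat.cast_zero, zero_mul, ratPow_zero F h, pow_zero]
  | succ n ih =>
    rw [Nat.cast_succ, add_mul, ratPow_add F (hasSubst_sub_one h), ← ih, one_mul, pow_succ]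

theorem inv_mem_Fil {F : Ser} (hF : F ∈ Fil 0) (h : col 0 F = 1) : F⁻¹ ∈ Fil 0 := by
  have h1 := constantCoeff_of_col h
  have h2 : F⁻¹ = ratPow F (-1) := by
    rw [MvPowerSeries.inv_eq_iff_mul_eq_one (by rw [h1]; exact one_ne_zero)]
    have := ratPow_neg F h1 1
    rwa [ratPow_one F (hasSubst_sub_one h1), mul_comm] at this
  rw [h2]
  exact ratPow_mem_Fil hF h _

theorem constantCoeff_subst_of_eq_zero {A : Ser} (hA : constantCoeff A = 0) (φ : ℂ⟦X⟧) :
    constantCoeff (φ.subst A) = PowerSeries.constantCoeff φ := by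
  have hs := PowerSeries.HasSubst.of_constantCoeff_zero hA
  obtain ⟨p, ψ, rfl⟩ := exists_trunc φ 1
  have : constantCoeff (Polynomial.aeval A p) = p.eval 0 := by
    rw [Polynomial.aeval_def, Polynomial.hom_eval₂, hA]
    have : (constantCoeff (R := ℂ) (σ := Fin 2)).comp (algebraMap ℂ Ser) = RingHom.id ℂ := by
      ext; simp [MvPowerSeries.algebraMap_apply]
    rw [this]; rfl
  rw [PowerSeries.subst_add hs, PowerSeries.subst_mul hs, PowerSeries.subst_pow hs,
    PowerSeries.subst_X hs, PowerSeries.subst_coe hs]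
  simp [this, hA, Polynomial.coeff_zero_eq_eval_zero]

theorem constantCoeff_ratPow {F : Ser} (h : constantCoeff F = 1) (r : ℚ) :
    constantCoeff (ratPow F r) = 1 := by
  rw [ratPow, constantCoeff_subst_of_eq_zero (by rw [map_sub, h, map_one, sub_self]),
    PowerSeries.binomialSeries_constantCoeff]

/-- The cofactor of `F - G` in `F ^ n - G ^ n` has constant term `n`, hence is not a zero divisor.
-/
theorem eq_of_pow_eq {F G : Ser} (hF : constantCoeff F = 1) (hG : constantCoeff G = 1) {n : ℕ}
    (hn : n ≠ 0) (h : F ^ n = G ^ n) : F = G := by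
  have h1 := geom_sum₂_mul F G n
  rw [h, sub_self] at h1
  have h2 : constantCoeff (∑ i ∈ Finset.range n, F ^ i * G ^ (n - 1 - i)) = n := by
    simp [hF, hG]
  rcases mul_eq_zero.1 h1 with h3 | h3
  · rw [h3, map_zero] at h2
    exact absurd h2.symm (by exact_mod_cast hn)
  · exact sub_eq_zero.1 h3

/-! ### The periods at `z₂ = 0` -/

/-- The fundamental period at `z₂ = 0`. -/
def f₀ : ℂ⟦X⟧ := col 0 X₀

/-- The series part of the logarithmic period at `z₂ = 0`. -/
def g₀ : ℂ⟦X⟧ := col 0 S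

/-- `(1 - 432 z) z d/dz` of `f₀`. -/
def v₀ : ℂ⟦X⟧ := rr * qD f₀

/-- The series part of `(1 - 432 z) z d/dz` of `f₀ log z + g₀`. -/
def u₀ : ℂ⟦X⟧ := rr * (qD g₀ + f₀)

theorem coeff_ofNat_mul (k : ℕ) [k.AtLeastTwo] (n : ℕ) (φ : ℂ⟦X⟧) :
    PowerSeries.coeff n (OfNat.ofNat k * φ) = k * PowerSeries.coeff n φ := by
  have : (OfNat.ofNat k : ℂ⟦X⟧) = PowerSeries.C (k : ℂ) := by
    rw [map_natCast]; rfl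
  rw [this, PowerSeries.coeff_C_mul]

theorem coeff_rr_mul_succ (n : ℕ) (φ : ℂ⟦X⟧) : PowerSeries.coeff (n + 1) (rr * φ)
    = PowerSeries.coeff (n + 1) φ - 432 * PowerSeries.coeff n φ := by
  rw [rr, sub_mul, one_mul, mul_assoc, map_sub, coeff_ofNat_mul, PowerSeries.coeff_succ_X_mul]
  rfl

theorem coeff_f₀ (n : ℕ) : PowerSeries.coeff n f₀ = coeff (ex n 0) X₀ := coeff_col _ _ _

theorem coeff_g₀ (n : ℕ) : PowerSeries.coeff n g₀ = coeff (ex n 0) S := coeff_col _ _ _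

theorem coeff_f₀_succ (n : ℕ) : ((n : ℂ) + 1) * (n + 1) * PowerSeries.coeff (n + 1) f₀
    = 12 * (6 * n + 1) * (6 * n + 5) * PowerSeries.coeff n f₀ := by
  have h := coeff_L₁_fst_succ (X₀, S) n 0
  rw [L₁_X₁] at h
  simp only [Prod.fst_zero, map_zero, Nat.cast_zero, mul_zero, sub_zero] at h
  rw [coeff_f₀, coeff_f₀]
  linear_combination -h

theorem coeff_g₀_succ (n : ℕ) : ((n : ℂ) + 1) * (n + 1) * PowerSeries.coeff (n + 1) g₀
      + 2 * (n + 1) * PowerSeries.coeff (n + 1) f₀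
    = 12 * ((6 * n + 1) * (6 * n + 5) * PowerSeries.coeff n g₀
      + (72 * n + 36) * PowerSeries.coeff n f₀) := by
  have h := coeff_L₁_snd_succ (X₀, S) n 0
  rw [L₁_X₁] at h
  simp only [Prod.snd_zero, map_zero, Nat.cast_zero, mul_zero, sub_zero] at h
  rw [coeff_f₀, coeff_f₀, coeff_g₀, coeff_g₀]
  linear_combination -h

/-- Since `12 (6n + 1) (6n + 5) = 432 n (n + 1) + 60`, the operator `L₁` at `z₂ = 0` has the
self-adjoint form `θ r θ - 60 z`. The next lemma is the same for the logarithmic solution, where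
`v₀` arises from differentiating `log z`. -/
theorem qD_v₀ : qD v₀ = 60 * (PowerSeries.X * f₀) := by
  ext n
  rw [coeff_qD, coeff_ofNat_mul]
  cases n with
  | zero => simp
  | succ n =>
    rw [PowerSeries.coeff_succ_X_mul, v₀, coeff_rr_mul_succ, coeff_qD, coeff_qD]
    have := coeff_f₀_succ n
    push_cast
    linear_combination this

theorem qD_u₀ : qD u₀ + v₀ = 60 * (PowerSeries.X * g₀) := by
  ext n
  rw [map_add, coeff_qD, coeff_ofNat_mul]
  cases n with
  | zero => simp [v₀, coeff_qD, coeff_zero_mul]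
  | succ n =>
    rw [PowerSeries.coeff_succ_X_mul, v₀, u₀, coeff_rr_mul_succ, coeff_rr_mul_succ, map_add,
      map_add, coeff_qD, coeff_qD, coeff_qD, coeff_qD]
    have := coeff_g₀_succ n
    push_cast
    linear_combination this

theorem constantCoeff_f₀ : PowerSeries.constantCoeff f₀ = 1 := by
  rw [f₀, constantCoeff_col₀, X₀_constantCoeff]

theorem constantCoeff_g₀ : PowerSeries.constantCoeff g₀ = 0 := by
  rw [g₀, constantCoeff_col₀, S_constantCoeff]

theorem constantCoeff_qD (φ : ℂ⟦X⟧) : PowerSeries.constantCoeff (qD φ) = 0 := by simp [qD]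

theorem coeff_f₀_one : PowerSeries.coeff 1 f₀ = 60 := by
  have := coeff_f₀_succ 0
  rw [PowerSeries.coeff_zero_eq_constantCoeff_apply, constantCoeff_f₀] at this
  norm_num at this
  exact this

/-- The Wronskian of the two periods at `z₂ = 0`. -/
theorem wronskian : u₀ * f₀ - v₀ * g₀ = 1 := by
  -- Self-adjointness of `θ r θ - 60 z` makes the Wronskian constant.
  have h : qD (u₀ * f₀ - v₀ * g₀) = 0 := by
    rw [qD_sub, qD_mul, qD_mul, qD_v₀, eq_sub_of_add_eq qD_u₀]
    rw [show u₀ * qD f₀ = rr * (qD g₀ + f₀) * qD f₀ by rw [u₀],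
      show v₀ = rr * qD f₀ from rfl]
    ring
  ext n
  cases n with
  | zero =>
    simp [v₀, u₀, constantCoeff_f₀, constantCoeff_g₀, constantCoeff_qD, constantCoeff_rr]
  | succ n =>
    have h1 := congrArg (PowerSeries.coeff (n + 1)) h
    rw [coeff_qD, map_zero] at h1
    have h2 : ((n + 1 : ℕ) : ℂ) ≠ 0 := by exact_mod_cast Nat.succ_ne_zero n
    rw [(mul_eq_zero.1 h1).resolve_left h2]
    simp [PowerSeries.coeff_one]

/-! ### Higher derivatives of the periods -/

/-- The pair `z ^ k (d/dz) ^ k` applied to `f₀` and to `f₀ log z + g₀`. -/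
def fall : ℕ → ℂ⟦X⟧ × ℂ⟦X⟧
  | 0 => (f₀, g₀)
  | k + 1 => (qD (fall k).1 - (k : ℂ⟦X⟧) * (fall k).1,
    qD (fall k).2 + (fall k).1 - (k : ℂ⟦X⟧) * (fall k).2)

/-- The coefficients of `(1 - 432 z) ^ k z ^ k (d/dz) ^ k f₀` in terms of `f₀` and `v₀`. -/
def fallCoeff : ℕ → ℂ⟦X⟧ × ℂ⟦X⟧
  | 0 => (1, 0)
  | k + 1 => (rr * qD (fallCoeff k).1 + 60 * (PowerSeries.X * rr * (fallCoeff k).2)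
      - (k : ℂ⟦X⟧) * (ss * (fallCoeff k).1),
      (fallCoeff k).1 + rr * qD (fallCoeff k).2 - (k : ℂ⟦X⟧) * (ss * (fallCoeff k).2))

theorem natCast_mul_mem {A : Type*} [Semiring A] [Algebra ℂ A] {V : Submodule ℂ A} {a : A}
    (n : ℕ) (h : a ∈ V) : (n : A) * a ∈ V := by
  rw [← nsmul_eq_mul]; exact nsmul_mem h n

/-- Each step of the recursion raises the degree by one: `r θ` and multiplication by `s` do so,
while `z r` has degree two but multiplies the coefficient of `v₀`, which starts one degree lower. -/
theorem fallCoeff_mem (k : ℕ) :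
    (fallCoeff k).1 ∈ par k ∧ (fallCoeff k).2 ∈ par (k - 1) := by
  induction k with
  | zero => exact ⟨by simpa [fallCoeff] using one_mem_par, by simp [fallCoeff]⟩
  | succ k ih =>
    obtain ⟨h1, h2⟩ := ih
    have e1 : ((k + 1 : ℕ) : ℤ) = k + 1 := by push_cast; rfl
    have e2 : ((k + 1 : ℕ) : ℤ) - 1 = k := by push_cast; ring
    have a1 := rr_mul_qD_mem h1
    have a2 := rr_mul_qD_mem h2
    have b1 := mul_mem_par ss_mem_par h1
    have b2 := mul_mem_par ss_mem_par h2
    have c2 := mul_mem_par X_mul_rr_mem h2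
    rw [show (k : ℤ) - 1 + 1 = k by ring] at a2
    rw [show 1 + (k : ℤ) = k + 1 by ring] at b1
    rw [show 1 + ((k : ℤ) - 1) = k by ring] at b2
    rw [show 2 + ((k : ℤ) - 1) = k + 1 by ring] at c2
    rw [e2, e1]
    exact ⟨sub_mem (add_mem a1 (ofNat_mul_mem 60 c2)) (natCast_mul_mem k b1),
      sub_mem (add_mem h1 a2) (natCast_mul_mem k b2)⟩

theorem rr_mul_qD_rr_pow (k : ℕ) : qD (rr ^ k) * rr = -432 * (k : ℂ⟦X⟧) * PowerSeries.X * rr ^ k := by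
  induction k with
  | zero => simp [qD_one]
  | succ k ih =>
    rw [pow_succ, qD_mul, add_mul, mul_right_comm, ih, qD_rr]
    push_cast; ring

/-- Moving `r ^ k` past `θ - k` produces `-k (r - 432 z) = -k s`. Both solutions obey the same
equation, so the coefficients are common to them. -/
theorem fall_eq (k : ℕ) :
    rr ^ k * (fall k).1 = (fallCoeff k).1 * f₀ + (fallCoeff k).2 * v₀ ∧
    rr ^ k * (fall k).2 = (fallCoeff k).1 * g₀ + (fallCoeff k).2 * u₀ := by
  induction k with
  | zero => simp [fall, fallCoeff]
  | succ k ih =>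
    obtain ⟨h1, h2⟩ := ih
    have d1 := congrArg qD h1
    have d2 := congrArg qD h2
    simp only [qD_mul, qD_add, qD_v₀, eq_sub_of_add_eq qD_u₀] at d1 d2
    have hr := rr_mul_qD_rr_pow k
    have hs : ss = rr - 432 * PowerSeries.X := by rw [ss, rr]; ring
    have hv : v₀ = rr * qD f₀ := rfl
    have hu : u₀ = rr * (qD g₀ + f₀) := rfl
    simp only [fall, fallCoeff, hs]
    constructor
    · linear_combination rr * d1 - ((k : ℂ⟦X⟧) * (rr - 432 * PowerSeries.X)) * h1 - (fall k).1 * hr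
        - (fallCoeff k).1 * hv
    · linear_combination rr * d2 - ((k : ℂ⟦X⟧) * (rr - 432 * PowerSeries.X)) * h2 - (fall k).2 * hr
        - (fallCoeff k).1 * hu + rr * h1

/-- `L₂` passes from column `m` to column `m + 1` by `(θ - 3m) (θ - 3m - 1) (θ - 3m - 2) / (m +
1)³`, which continues the product `θ (θ - 1) ⋯ (θ - 3m + 1)`. -/
theorem col_periods_succ (m : ℕ) (h1 : col m X₀ = (((m.factorial : ℂ) ^ 3)⁻¹) • (fall (3 * m)).1)
    (h2 : col m S = (((m.factorial : ℂ) ^ 3)⁻¹) • (fall (3 * m)).2) :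
    col (m + 1) X₀ = ((((m + 1).factorial : ℂ) ^ 3)⁻¹) • (fall (3 * (m + 1))).1 ∧
    col (m + 1) S = ((((m + 1).factorial : ℂ) ^ 3)⁻¹) • (fall (3 * (m + 1))).2 := by
  have hm : ((m : ℂ) + 1) ≠ 0 := by exact_mod_cast Nat.succ_ne_zero m
  have hf := fac_ne m
  have hk : ∀ (k n : ℕ) (φ : ℂ⟦X⟧), PowerSeries.coeff n ((k : ℂ⟦X⟧) * φ)
      = k * PowerSeries.coeff n φ := fun k n φ => by
    rw [← nsmul_eq_mul, map_nsmul, nsmul_eq_mul]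
  have e1 : ∀ n, coeff (ex n m) X₀ = ((m.factorial : ℂ) ^ 3)⁻¹ * PowerSeries.coeff n (fall (3 * m)).1 :=
    fun n => by rw [← coeff_col, h1, map_smul, smul_eq_mul]
  have e2 : ∀ n, coeff (ex n m) S = ((m.factorial : ℂ) ^ 3)⁻¹ * PowerSeries.coeff n (fall (3 * m)).2 :=
    fun n => by rw [← coeff_col, h2, map_smul, smul_eq_mul]
  constructor
  · ext n
    have h := coeff_L₂_fst_succ (X₀, S) n m
    rw [L₂_X₁] at h
    simp only [Prod.fst_zero, map_zero, e1] at h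
    rw [coeff_col, map_smul, smul_eq_mul, show 3 * (m + 1) = 3 * m + 1 + 1 + 1 by ring]
    simp only [fall, map_sub, coeff_qD, hk]
    have := Nat.factorial_succ m
    rw [this]
    push_cast at h ⊢
    field_simp
    field_simp at h
    linear_combination -h
  · ext n
    have h := coeff_L₂_snd_succ (X₀, S) n m
    rw [L₂_X₁] at h
    simp only [Prod.snd_zero, map_zero, e1, e2] at h
    rw [coeff_col, map_smul, smul_eq_mul, show 3 * (m + 1) = 3 * m + 1 + 1 + 1 by ring]
    simp only [fall, map_sub, map_add, coeff_qD, hk]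
    have := Nat.factorial_succ m
    rw [this]
    push_cast at h ⊢
    field_simp
    field_simp at h
    linear_combination -h

theorem col_periods (m : ℕ) : col m X₀ = (((m.factorial : ℂ) ^ 3)⁻¹) • (fall (3 * m)).1 ∧
    col m S = (((m.factorial : ℂ) ^ 3)⁻¹) • (fall (3 * m)).2 := by
  induction m with
  | zero => simp [fall, f₀, g₀]
  | succ m ih => exact col_periods_succ m ih.1 ih.2

/-- `X₀ = P f₀ + Q v₀` and `S = P g₀ + Q u₀`. -/
theorem exists_periods_eq : ∃ P ∈ Fil 0, ∃ Q ∈ Fil (-1), col 0 P = 1 ∧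
    X₀ = P * inc f₀ + Q * inc v₀ ∧ S = P * inc g₀ + Q * inc u₀ := by
  have hr : rr * rr⁻¹ = 1 := PowerSeries.mul_inv_cancel _ (by rw [constantCoeff_rr]; exact one_ne_zero)
  have hr' : ∀ k : ℕ, rr ^ k * rr⁻¹ ^ k = 1 := fun k => by rw [← mul_pow, hr, one_pow]
  let P : Ser := ofCol fun m => (((m.factorial : ℂ) ^ 3)⁻¹) • (rr⁻¹ ^ (3 * m) * (fallCoeff (3 * m)).1)
  let Q : Ser := ofCol fun m => (((m.factorial : ℂ) ^ 3)⁻¹) • (rr⁻¹ ^ (3 * m) * (fallCoeff (3 * m)).2)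
  have hP : ∀ m, col m P = (((m.factorial : ℂ) ^ 3)⁻¹) • (rr⁻¹ ^ (3 * m) * (fallCoeff (3 * m)).1) :=
    fun m => col_ofCol _ m
  have hQ : ∀ m, col m Q = (((m.factorial : ℂ) ^ 3)⁻¹) • (rr⁻¹ ^ (3 * m) * (fallCoeff (3 * m)).2) :=
    fun m => col_ofCol _ m
  refine ⟨P, fun m => ?_, Q, fun m => ?_, ?_, col_ext fun m => ?_, col_ext fun m => ?_⟩
  · rw [FilCol, hP, mul_smul_comm, ← mul_assoc, hr', one_mul]
    have := (fallCoeff_mem (3 * m)).1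
    push_cast at this
    rw [add_zero]
    exact Submodule.smul_mem _ _ this
  · rw [FilCol, hQ, mul_smul_comm, ← mul_assoc, hr', one_mul]
    have := (fallCoeff_mem (3 * m)).2
    push_cast at this
    exact Submodule.smul_mem _ _ this
  · rw [hP]; simp [fallCoeff]
  · rw [map_add, mul_comm P, mul_comm Q, col_inc_mul, col_inc_mul, hP, hQ, (col_periods m).1,
      mul_smul_comm, mul_smul_comm, ← smul_add]
    congr 1
    linear_combination rr⁻¹ ^ (3 * m) * (fall_eq (3 * m)).1 - (fall (3 * m)).1 * hr' (3 * m)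
  · rw [map_add, mul_comm P, mul_comm Q, col_inc_mul, col_inc_mul, hP, hQ, (col_periods m).2,
      mul_smul_comm, mul_smul_comm, ← smul_add]
    congr 1
    linear_combination rr⁻¹ ^ (3 * m) * (fall_eq (3 * m)).2 - (fall (3 * m)).2 * hr' (3 * m)

/-! ### Uniqueness for the modular parametrisation at `z₂ = 0` -/

theorem coeff_mul_of_lower_zero {A d : ℂ⟦X⟧} {n : ℕ} (h : ∀ k < n, PowerSeries.coeff k d = 0) :
    PowerSeries.coeff n (A * d) = PowerSeries.constantCoeff A * PowerSeries.coeff n d := by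
  rw [PowerSeries.coeff_mul, Finset.Nat.sum_antidiagonal_eq_sum_range_succ_mk,
    Finset.sum_range_succ', Finset.sum_eq_zero, zero_add]
  · simp
  · intro k hk
    rw [h _ (by have := Finset.mem_range.1 hk; omega), mul_zero]

theorem coeff_rr_mul_qD {d : ℂ⟦X⟧} {n : ℕ} (h : ∀ k < n, PowerSeries.coeff k d = 0) :
    PowerSeries.coeff n (rr * qD d) = n * PowerSeries.coeff n d := by
  rw [coeff_mul_of_lower_zero (fun k hk => by rw [coeff_qD, h k hk, mul_zero]), constantCoeff_rr,
    coeff_qD, one_mul]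

/-- The triple `(s, 1, s)` is a solution, and differences are compared coefficientwise. The
linearised system in degree `N` has determinant a multiple of `N² (N - 1)`: degree `0` needs the
constant terms, and the resonance in degree `1` needs the one extra coefficient of `b4`. -/
theorem ramanujan_unique {b2 b4 b6 : ℂ⟦X⟧}
    (h4 : 3 * (rr * qD b4) = b2 * b4 - b6)
    (h6 : 2 * (rr * qD b6) = b2 * b6 - b4 ^ 2)
    (h2 : 12 * (rr * qD b2) = b2 ^ 2 - b4 - 8640 * (PowerSeries.X * rr))
    (c2 : PowerSeries.constantCoeff b2 = 1) (c4 : PowerSeries.constantCoeff b4 = 1)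
    (c6 : PowerSeries.constantCoeff b6 = 1) (c4' : PowerSeries.coeff 1 b4 = 0) :
    b2 = ss ∧ b4 = 1 ∧ b6 = ss := by
  have hx := X_mul_rr
  have e4 : 3 * (rr * qD (b4 - 1)) = b2 * (b4 - 1) + (b2 - ss) - (b6 - ss) := by
    rw [qD_sub, qD_one]; linear_combination h4
  have e6 : 2 * (rr * qD (b6 - ss)) = b2 * (b6 - ss) + ss * (b2 - ss) - (b4 + 1) * (b4 - 1) := by
    rw [qD_sub, qD_ss]; linear_combination h6 + hx
  have e2 : 12 * (rr * qD (b2 - ss)) = (b2 + ss) * (b2 - ss) - (b4 - 1) := by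
    rw [qD_sub, qD_ss]; linear_combination h2 + hx
  have key : ∀ n, PowerSeries.coeff n (b2 - ss) = 0 ∧ PowerSeries.coeff n (b4 - 1) = 0 ∧
      PowerSeries.coeff n (b6 - ss) = 0 := by
    intro n
    induction n using Nat.strong_induction_on with
    | _ n ih =>
      have i2 : ∀ k < n, PowerSeries.coeff k (b2 - ss) = 0 := fun k hk => (ih k hk).1
      have i4 : ∀ k < n, PowerSeries.coeff k (b4 - 1) = 0 := fun k hk => (ih k hk).2.1
      have i6 : ∀ k < n, PowerSeries.coeff k (b6 - ss) = 0 := fun k hk => (ih k hk).2.2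
      have f2 := congrArg (PowerSeries.coeff n) e2
      have f4 := congrArg (PowerSeries.coeff n) e4
      have f6 := congrArg (PowerSeries.coeff n) e6
      rw [coeff_ofNat_mul, coeff_rr_mul_qD i2, map_sub _ ((b2 + ss) * (b2 - ss)),
        coeff_mul_of_lower_zero i2, map_add, c2, constantCoeff_ss] at f2
      rw [coeff_ofNat_mul, coeff_rr_mul_qD i4, map_sub _ (b2 * (b4 - 1) + (b2 - ss)), map_add,
        coeff_mul_of_lower_zero i4, c2] at f4
      rw [coeff_ofNat_mul, coeff_rr_mul_qD i6,
        map_sub _ (b2 * (b6 - ss) + ss * (b2 - ss)), map_add, coeff_mul_of_lower_zero i4,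
        coeff_mul_of_lower_zero i6, coeff_mul_of_lower_zero i2, c2, map_add, c4, constantCoeff_ss,
        map_one] at f6
      have z4 : n < 2 → PowerSeries.coeff n (b4 - 1) = 0 := fun hn => by
        interval_cases n
        · simp [c4]
        · rw [map_sub, c4']; simp [PowerSeries.coeff_one]
      have z2 : n = 0 → PowerSeries.coeff n (b2 - ss) = 0 := by
        rintro rfl; simp [c2, constantCoeff_ss]
      have z6 : n = 0 → PowerSeries.coeff n (b6 - ss) = 0 := by
        rintro rfl; simp [c6, constantCoeff_ss]
      generalize PowerSeries.coeff n (b2 - ss) = t2 at *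
      generalize PowerSeries.coeff n (b4 - 1) = t4 at *
      generalize PowerSeries.coeff n (b6 - ss) = t6 at *
      rcases n with _ | _ | n
      · exact ⟨z2 rfl, z4 (by norm_num), z6 rfl⟩
      · have ht4 := z4 (by norm_num)
        subst ht4
        push_cast at f2 f4 f6
        have ht2 : t2 = 0 := by linear_combination f2 / 10
        exact ⟨ht2, rfl, by linear_combination f4 + ht2⟩
      -- This is `72 N² (N - 1)` at `N = n + 2`, what remains after eliminating `t4` and `t6`.
      · have hn : (72 * ((n : ℂ) + 2) ^ 2 * (n + 1)) ≠ 0 := by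
          have h1 : (n : ℂ) + 2 ≠ 0 := by exact_mod_cast (by omega : n + 2 ≠ 0)
          have h2 : (n : ℂ) + 1 ≠ 0 := by exact_mod_cast (by omega : n + 1 ≠ 0)
          exact mul_ne_zero (mul_ne_zero (by norm_num) (pow_ne_zero 2 h1)) h2
        push_cast at f2 f4 f6
        have ht4 : t4 = (2 - 12 * ((n : ℂ) + 2)) * t2 := by linear_combination f2
        have ht6 : t6 = (1 - 3 * ((n : ℂ) + 2)) * t4 + t2 := by linear_combination f4
        have ht2 : t2 = 0 := by
          refine (mul_eq_zero.1 (?_ : (72 * ((n : ℂ) + 2) ^ 2 * (n + 1)) * t2 = 0)).resolve_left hn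
          rw [ht6, ht4] at f6
          linear_combination f6
        rw [ht2, mul_zero] at ht4
        rw [ht2, ht4, mul_zero, add_zero] at ht6
        exact ⟨ht2, ht4, ht6⟩
  refine ⟨sub_eq_zero.1 ?_, sub_eq_zero.1 ?_, sub_eq_zero.1 ?_⟩ <;> ext n
  · exact (key n).1
  · exact (key n).2.1
  · exact (key n).2.2

theorem col₀_qE : ∃ U : ℂ⟦X⟧, PowerSeries.constantCoeff U = 1 ∧ col 0 qE = PowerSeries.X * U := by
  refine ⟨col 0 ((PowerSeries.exp ℂ).subst (S * X₀⁻¹)), ?_, ?_⟩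
  · rw [constantCoeff_col₀, constantCoeff_subst_of_eq_zero (by simp [S_constantCoeff]),
      PowerSeries.constantCoeff_exp]
  · rw [qE, ← inc_X, col_inc_mul]

/-- At `z₂ = 0`, `q_E = z₁ + O(z₁²)`. -/
theorem coeff_one_col₀_atE (φ : ℂ⟦X⟧) :
    PowerSeries.coeff 1 (col 0 (atEHom φ)) = PowerSeries.coeff 1 φ := by
  obtain ⟨U, hU, hq⟩ := col₀_qE
  obtain ⟨ψ, hψ⟩ : PowerSeries.X ∣ φ - algebraMap ℂ _ (PowerSeries.constantCoeff φ) := by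
    rw [PowerSeries.X_dvd_iff]; simp
  have h1 : col 0 (atEHom φ) = PowerSeries.X * (U * col 0 (atEHom ψ))
      + algebraMap ℂ _ (PowerSeries.constantCoeff φ) := by
    conv_lhs => rw [sub_eq_iff_eq_add.1 hψ]
    rw [map_add, map_mul, AlgHom.commutes, map_add, col_zero_mul, atEHom_X, hq, mul_assoc,
      ← col₀_apply (algebraMap ℂ Ser _), AlgHom.commutes]
  have h2 : PowerSeries.coeff 1 φ = PowerSeries.coeff 1 (PowerSeries.X * ψ) := by
    rw [← hψ, map_sub, PowerSeries.algebraMap_apply, PowerSeries.coeff_C]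
    simp
  rw [h1, h2, map_add, PowerSeries.algebraMap_apply, PowerSeries.coeff_C, if_neg one_ne_zero,
    show (1 : ℕ) = 0 + 1 from rfl, PowerSeries.coeff_succ_X_mul, PowerSeries.coeff_succ_X_mul,
    add_zero, coeff_zero_mul, PowerSeries.coeff_zero_eq_constantCoeff_apply,
    PowerSeries.coeff_zero_eq_constantCoeff_apply, PowerSeries.coeff_zero_eq_constantCoeff_apply,
    hU, one_mul, constantCoeff_col₀, constantCoeff_atE]

/-- The Wronskian in terms of the logarithm of `q_E` at `z₂ = 0`. -/
theorem rr_mul_dlog (ℓ : ℂ⟦X⟧) (hℓ : f₀ * ℓ = g₀) : rr * (1 + qD ℓ) * f₀ ^ 2 = 1 := by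
  have h1 := congrArg qD hℓ
  rw [qD_mul] at h1
  have h2 := wronskian
  have hu : u₀ = rr * (qD g₀ + f₀) := rfl
  have hv : v₀ = rr * qD f₀ := rfl
  rw [hu, hv] at h2
  linear_combination h2 + rr * f₀ * h1 - rr * qD f₀ * hℓ

/-- The classical parametrisation `E₄ = f₀ ^ 4`, `E₆ = s f₀ ^ 6`. By the Wronskian `r θ log q = W ^
2`, so scaling by powers of `W` turns Ramanujan's equations into the system of `ramanujan_unique`;
the term `-12 v₀ W` absorbs the derivative of `W`, and its own derivative gives `8640 = 144 · 60`.
-/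
theorem col₀_ramanujan {W ℓ a2 a4 a6 : ℂ⟦X⟧} (hW : f₀ * W = 1) (hℓ : f₀ * ℓ = g₀)
    (h2 : 12 * qD a2 = (1 + qD ℓ) * (a2 ^ 2 - a4))
    (h4 : 3 * qD a4 = (1 + qD ℓ) * (a2 * a4 - a6))
    (h6 : 2 * qD a6 = (1 + qD ℓ) * (a2 * a6 - a4 ^ 2))
    (c2 : PowerSeries.constantCoeff a2 = 1) (c4 : PowerSeries.constantCoeff a4 = 1)
    (c6 : PowerSeries.constantCoeff a6 = 1) (c4' : PowerSeries.coeff 1 a4 = 240) :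
    a2 * W ^ 2 - 12 * (v₀ * W) = ss ∧ a4 * W ^ 4 = 1 ∧ a6 * W ^ 6 = ss := by
  have hr := rr_mul_dlog ℓ hℓ
  have hd : rr * (1 + qD ℓ) = W ^ 2 := by
    linear_combination W ^ 2 * hr - (rr * (1 + qD ℓ)) * (f₀ * W + 1) * hW
  have hw : rr * qD W = - (W ^ 2 * v₀) := by
    have := congrArg qD hW
    rw [qD_mul, qD_one] at this
    have hv : v₀ = rr * qD f₀ := rfl
    rw [hv]
    linear_combination rr * W * this - rr * qD W * hW
  have hv := qD_v₀
  have cW : PowerSeries.constantCoeff W = 1 := by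
    have := congrArg PowerSeries.constantCoeff hW
    simpa [constantCoeff_f₀] using this
  have cv : PowerSeries.constantCoeff v₀ = 0 := by simp [v₀, constantCoeff_qD]
  have p2 : qD (W ^ 2) = 2 * W * qD W := by rw [pow_two, qD_mul]; ring
  have p4 : qD (W ^ 4) = 4 * W ^ 3 * qD W := by
    rw [show W ^ 4 = W ^ 2 * W ^ 2 by ring, qD_mul, p2]; ring
  have p6 : qD (W ^ 6) = 6 * W ^ 5 * qD W := by
    rw [show W ^ 6 = W ^ 2 * W ^ 4 by ring, qD_mul, p2, p4]; ring
  refine ramanujan_unique ?_ ?_ ?_ ?_ ?_ ?_ ?_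
  · rw [qD_mul, p4]
    linear_combination rr * W ^ 4 * h4 + W ^ 4 * (a2 * a4 - a6) * hd + 12 * a4 * W ^ 3 * hw
  · rw [qD_mul, p6]
    linear_combination rr * W ^ 6 * h6 + W ^ 6 * (a2 * a6 - a4 ^ 2) * hd + 12 * a6 * W ^ 5 * hw
  · rw [qD_sub, qD_mul, qD_mul, qD_mul, qD_ofNat, p2, hv]
    linear_combination rr * W ^ 2 * h2 + W ^ 2 * (a2 ^ 2 - a4) * hd
      + (24 * a2 * W - 144 * v₀) * hw - 8640 * rr * PowerSeries.X * hW
  · simp [c2, cW, cv]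
  · simp [c4, cW]
  · simp [c6, cW]
  -- The resonant coefficient vanishes because `240 - 4 · 60 = 0`.
  · have h1 := congrArg (PowerSeries.coeff 1) hW
    rw [PowerSeries.coeff_one_mul, constantCoeff_f₀, coeff_f₀_one, cW] at h1
    rw [PowerSeries.coeff_one_mul, PowerSeries.coeff_one_pow, map_pow, cW, c4, c4']
    simp only [PowerSeries.coeff_one, one_ne_zero, if_false] at h1
    have h3 : PowerSeries.coeff 1 W = -60 := by linear_combination h1
    rw [h3]
    norm_num

/-! ### The normalised Eisenstein series -/

theorem euler_one_inc (φ : ℂ⟦X⟧) : euler 1 (inc φ) = 0 := col_ext fun m => by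
  rw [col_euler_one, col_inc, map_zero]
  split_ifs with h
  · rw [h, Nat.cast_zero, zero_smul]
  · rw [smul_zero]

theorem col₀_inc (φ : ℂ⟦X⟧) : col₀ (inc φ) = φ := by rw [col₀_apply, col_inc, if_pos rfl]

theorem col₀_euler_zero (F : Ser) : col₀ (euler 0 F) = qD (col₀ F) := col_euler_zero 0 F

/-- There are no polynomials of negative degree. Applied to `Fil (-1)`, this is what makes `T` and
its derivative vanish at `z₂ = 0`. -/
theorem col₀_eq_zero_of_mem_Fil {j : ℤ} (hj : j < 0) {F : Ser} (h : F ∈ Fil j) : col 0 F = 0 := by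
  have := h 0
  rw [FilCol] at this
  simp only [mul_zero, pow_zero, one_mul, Nat.cast_zero, zero_add] at this
  exact eq_zero_of_mem_par hj this

theorem col₀_mem_par {j : ℤ} {F : Ser} (h : F ∈ Fil j) : col 0 F ∈ par j := by
  have := h 0
  rw [FilCol] at this
  simpa only [mul_zero, pow_zero, one_mul, Nat.cast_zero, zero_add] using this

theorem filCol_zero {j : ℤ} {F : Ser} (h : col 0 F ∈ par j) : FilCol j 0 F := by
  rw [FilCol]
  simpa only [mul_zero, pow_zero, one_mul, Nat.cast_zero, zero_add] using h

theorem filCol_of_smul {j : ℤ} {m : ℕ} {F : Ser} {c : ℂ} (hc : c ≠ 0) (h : FilCol j m (c • F)) :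
    FilCol j m F := by
  simpa [smul_smul, inv_mul_cancel₀ hc] using h.smul c⁻¹

theorem filCol_of_euler {j : ℤ} {m : ℕ} (hm : m ≠ 0) {F : Ser} (h : FilCol j m (euler 1 F)) :
    FilCol j m F := by
  refine filCol_of_smul (c := (m : ℂ)) (Nat.cast_ne_zero.2 hm) ?_
  rw [FilCol] at h ⊢
  rwa [col_euler_one] at h

theorem filCol_mul_of_le {i j : ℤ} {m : ℕ} {F G : Ser} (hF : ∀ n ≤ m, FilCol i n F)
    (hG : ∀ n ≤ m, FilCol j n G) : FilCol (i + j) m (F * G) :=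
  filCol_mul fun p hp => Or.inr ⟨hF _ (by
    have := Finset.HasAntidiagonal.mem_antidiagonal.1 hp; omega), hG _ (by
    have := Finset.HasAntidiagonal.mem_antidiagonal.1 hp; omega)⟩

theorem three_mul_euler_e4 (i : Fin 2) : 3 * euler i (atEHom e4) =
    (euler i logqE + if i = 0 then 1 else 0) * (atEHom e2 * atEHom e4 - atEHom e6) := by
  have h : (3 : ℂ⟦X⟧) * qD e4 = e2 * e4 - e6 := by
    rw [qD_e4, ← map_ofNat (algebraMap ℂ ℂ⟦X⟧) 3, ← Algebra.smul_def, smul_smul]; norm_num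
  have := congrArg atEHom h
  rw [map_mul, map_ofNat, map_sub, map_mul] at this
  rw [euler_atE, ← this]; ring

theorem two_mul_euler_e6 (i : Fin 2) : 2 * euler i (atEHom e6) =
    (euler i logqE + if i = 0 then 1 else 0) * (atEHom e2 * atEHom e6 - atEHom e4 ^ 2) := by
  have h : (2 : ℂ⟦X⟧) * qD e6 = e2 * e6 - e4 ^ 2 := by
    rw [qD_e6, ← map_ofNat (algebraMap ℂ ℂ⟦X⟧) 2, ← Algebra.smul_def, smul_smul]; norm_num
  have := congrArg atEHom h
  rw [map_mul, map_ofNat, map_sub, map_mul, map_pow] at this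
  rw [euler_atE, ← this]; ring

theorem twelve_mul_euler_e2 (i : Fin 2) : 12 * euler i (atEHom e2) =
    (euler i logqE + if i = 0 then 1 else 0) * (atEHom e2 ^ 2 - atEHom e4) := by
  have h : (12 : ℂ⟦X⟧) * qD e2 = e2 ^ 2 - e4 := by
    rw [qD_e2, ← map_ofNat (algebraMap ℂ ℂ⟦X⟧) 12, ← Algebra.smul_def, smul_smul]; norm_num
  have := congrArg atEHom h
  rw [map_mul, map_ofNat, map_sub, map_pow] at this
  rw [euler_atE, ← this]; ring

/-- A system of differential equations in `z₂` that preserves the filtration. -/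
theorem mem_Fil_of_ramanujan {D G2 G4 G6 : Ser} (hD : D ∈ Fil (-1))
    (h4 : 3 * euler 1 G4 = D * (G2 * G4 - G6)) (h6 : 2 * euler 1 G6 = D * (G2 * G6 - G4 ^ 2))
    (h2 : 12 * euler 1 G2 = D * (G2 ^ 2 - G4))
    (c2 : col 0 G2 ∈ par 1) (c4 : col 0 G4 ∈ par 0) (c6 : col 0 G6 ∈ par 1) :
    G4 ∈ Fil 0 ∧ G6 ∈ Fil 1 := by
  have hD0 := col₀_eq_zero_of_mem_Fil (by norm_num) hD
  -- The brackets lie in `Fil 1`, `Fil 2`, `Fil 2`, and `D` lowers the index by one. Since `D` has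
  -- no column `0`, the right-hand sides involve only earlier columns, and `θ₂` is inverted by
  -- dividing by `m`.
  have key : ∀ m, FilCol 0 m G4 ∧ FilCol 1 m G6 ∧ FilCol 1 m G2 := by
    intro m
    induction m using Nat.strong_induction_on with
    | _ m ih =>
      by_cases hm : m = 0
      · subst hm
        exact ⟨filCol_zero c4, filCol_zero c6, filCol_zero c2⟩
      have i4 : ∀ n < m, FilCol 0 n G4 := fun n hn => (ih n hn).1
      have i6 : ∀ n < m, FilCol 1 n G6 := fun n hn => (ih n hn).2.1
      have i2 : ∀ n < m, FilCol 1 n G2 := fun n hn => (ih n hn).2.2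
      have mul : ∀ {i j : ℤ} {F G : Ser}, (∀ n < m, FilCol i n F) → (∀ n < m, FilCol j n G) →
          ∀ n < m, FilCol (i + j) n (F * G) := fun hF hG n hn =>
        filCol_mul_of_le (fun k hk => hF k (by omega)) (fun k hk => hG k (by omega))
      have s3 : (3 : Ser) * euler 1 G4 = (3 : ℂ) • euler 1 G4 := by
        rw [Algebra.smul_def, map_ofNat]
      have s2 : (2 : Ser) * euler 1 G6 = (2 : ℂ) • euler 1 G6 := by
        rw [Algebra.smul_def, map_ofNat]
      have s12 : (12 : Ser) * euler 1 G2 = (12 : ℂ) • euler 1 G2 := by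
        rw [Algebra.smul_def, map_ofNat]
      rw [s3] at h4
      rw [s2] at h6
      rw [s12] at h2
      refine ⟨?_, ?_, ?_⟩
      · refine filCol_of_euler hm (filCol_of_smul (c := 3) (by norm_num) ?_)
        rw [h4, show (0 : ℤ) = -1 + 1 by norm_num]
        exact filCol_mul_of_lt hD hD0 fun n hn =>
          FilCol.sub (by simpa using mul i2 i4 n hn) (i6 n hn)
      · refine filCol_of_euler hm (filCol_of_smul (c := 2) (by norm_num) ?_)
        rw [h6, show (1 : ℤ) = -1 + 2 by norm_num]
        exact filCol_mul_of_lt hD hD0 fun n hn =>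
          FilCol.sub (by simpa using mul i2 i6 n hn)
            (by rw [pow_two]; simpa using (mul i4 i4 n hn).le)
      · refine filCol_of_euler hm (filCol_of_smul (c := 12) (by norm_num) ?_)
        rw [h2, show (1 : ℤ) = -1 + 2 by norm_num]
        exact filCol_mul_of_lt hD hD0 fun n hn =>
          FilCol.sub (by rw [pow_two]; simpa using mul i2 i2 n hn) (by simpa using (i4 n hn).le)
  exact ⟨fun m => (key m).1, fun m => (key m).2.1⟩

/-- Up to the weight factor `W`, the period `X₀` and the series `E₄(q_E)`, `E₆(q_E)` lie in the
filtration. -/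
theorem exists_weight_factor : ∃ W : Ser, constantCoeff W = 1 ∧
    X₀ * W ∈ Fil 0 ∧ col 0 (X₀ * W) = 1 ∧
    atEHom e4 * W ^ 4 ∈ Fil 0 ∧ col 0 (atEHom e4 * W ^ 4) = 1 ∧
    atEHom e6 * W ^ 6 ∈ Fil 1 ∧ col 0 (atEHom e6 * W ^ 6) = ss := by
  obtain ⟨P, hPF, Q, hQF, hP0, hX, hS⟩ := exists_periods_eq
  have hPi := mul_inv_cancel_ser (F := P) (by rw [constantCoeff_of_col hP0]; exact one_ne_zero)
  obtain ⟨T, hTF, hQ⟩ : ∃ T ∈ Fil (-1), Q = P * T := by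
    refine ⟨Q * P⁻¹, by simpa using mul_mem_Fil hQF (inv_mem_Fil hPF hP0), ?_⟩
    linear_combination -Q * hPi
  have hT0 := col₀_eq_zero_of_mem_Fil (by norm_num) hTF
  rw [← col₀_apply] at hT0
  -- With this `w`, `X₀ = P w`, and `P` cancels from `S / X₀`. The weight factor is `W = 1 / w`.
  obtain ⟨w, hw⟩ : ∃ w, w = inc f₀ + T * inc v₀ := ⟨_, rfl⟩
  have hw0 : col₀ w = f₀ := by
    rw [hw, map_add, map_mul, hT0, col₀_inc, zero_mul, add_zero]
  have hwc : constantCoeff w = 1 := by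
    rw [← constantCoeff_col₀, ← col₀_apply, hw0, constantCoeff_f₀]
  have hW := mul_inv_cancel_ser (F := w) (by rw [hwc]; exact one_ne_zero)
  have hWinv := euler_inv 1 (F := w) (by rw [hwc]; exact one_ne_zero)
  generalize w⁻¹ = W at hW hWinv
  have hWc : constantCoeff W = 1 := by
    have := congrArg constantCoeff hW
    rwa [map_mul, hwc, one_mul, map_one] at this
  have hW0 : f₀ * col₀ W = 1 := by
    have := congrArg col₀ hW
    rwa [map_mul, hw0, map_one] at this
  have hXw : X₀ = P * w := by rw [hX, hw, hQ]; ring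
  have hXW : X₀ * W = P := by rw [hXw]; linear_combination P * hW
  have hXi := mul_inv_cancel_ser (F := X₀) (by rw [X₀_constantCoeff]; exact one_ne_zero)
  have hL : w * logqE = inc g₀ + T * inc u₀ := by
    have h1 : P * (w * logqE) = P * (inc g₀ + T * inc u₀) := by
      rw [← mul_assoc, ← hXw, logqE]
      rw [hQ] at hS
      linear_combination S * hXi + hS
    calc w * logqE = P⁻¹ * (P * (w * logqE)) := by linear_combination -(w * logqE) * hPi
      _ = _ := by rw [h1]; linear_combination (inc g₀ + T * inc u₀) * hPi
  have hℓ : f₀ * col₀ logqE = g₀ := by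
    have := congrArg col₀ hL
    rwa [map_mul, hw0, map_add, map_mul, hT0, col₀_inc, zero_mul, add_zero] at this
  have hwr : inc u₀ * inc f₀ - inc v₀ * inc g₀ = 1 := by
    rw [← map_mul, ← map_mul, ← map_sub, wronskian, map_one]
  have hθw : euler 1 w = euler 1 T * inc v₀ := by
    rw [hw, map_add, euler_mul, euler_one_inc, euler_one_inc]; ring
  -- Here `logqE = (g₀ + T u₀) / (f₀ + T v₀)` is a Möbius function of `T` with coefficients free of
  -- `z₂` and determinant `u₀ f₀ - v₀ g₀ = 1`.
  have hθL : euler 1 logqE = euler 1 T * W ^ 2 := by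
    have h1 := congrArg (euler 1) hL
    rw [euler_mul, map_add, euler_mul, euler_one_inc, euler_one_inc, hθw] at h1
    have h2 : w ^ 2 * euler 1 logqE = euler 1 T := by
      linear_combination w * h1 - euler 1 T * inc v₀ * hL + euler 1 T * inc u₀ * hw
        + euler 1 T * hwr
    linear_combination W ^ 2 * h2 - euler 1 logqE * (w * W + 1) * hW
  have hθW : euler 1 W = - (euler 1 T * inc v₀ * W ^ 2) := by rw [hWinv, hθw]; ring
  have r4 := three_mul_euler_e4 1
  have r6 := two_mul_euler_e6 1
  have r2 := twelve_mul_euler_e2 1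
  have q4 := congrArg col₀ (three_mul_euler_e4 0)
  have q6 := congrArg col₀ (two_mul_euler_e6 0)
  have q2 := congrArg col₀ (twelve_mul_euler_e2 0)
  rw [if_neg one_ne_zero, add_zero, hθL] at r4 r6 r2
  simp only [if_true, map_mul, map_add, map_sub, map_pow, map_ofNat, map_one, col₀_euler_zero]
    at q4 q6 q2
  have cc : ∀ φ : ℂ⟦X⟧, PowerSeries.coeff 0 φ = 1 →
      PowerSeries.constantCoeff (col₀ (atEHom φ)) = 1 := fun φ h => by
    rw [col₀_apply, constantCoeff_col₀, constantCoeff_atE,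
      ← PowerSeries.coeff_zero_eq_constantCoeff_apply, h]
  obtain ⟨k2, k4, k6⟩ := col₀_ramanujan hW0 hℓ (by rw [q2]; ring) (by rw [q4]; ring)
    (by rw [q6]; ring) (cc _ coeff_e2_zero) (cc _ coeff_e4_zero) (cc _ coeff_e6_zero)
    (by rw [col₀_apply, coeff_one_col₀_atE, coeff_e4_one])
  have p2 : euler 1 (W ^ 2) = 2 * W * euler 1 W := by rw [euler_pow]; norm_num
  have p4 : euler 1 (W ^ 4) = 4 * W ^ 3 * euler 1 W := by rw [euler_pow]; norm_num
  have p6 : euler 1 (W ^ 6) = 6 * W ^ 5 * euler 1 W := by rw [euler_pow]; norm_num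
  have o12 : euler 1 (12 : Ser) = 0 := by
    rw [← map_ofNat inc 12, euler_one_inc]
  have k2' : col 0 (atEHom e2 * W ^ 2 - 12 * (inc v₀ * W)) = ss := by
    rw [← col₀_apply, ← k2]
    simp only [map_mul, map_sub, map_pow, map_ofNat, col₀_inc]
  have k4' : col 0 (atEHom e4 * W ^ 4) = 1 := by
    rw [← col₀_apply, ← k4]
    simp only [map_mul, map_pow]
  have k6' : col 0 (atEHom e6 * W ^ 6) = ss := by
    rw [← col₀_apply, ← k6]
    simp only [map_mul, map_pow]
  -- As `θ₂W = -θ₂T v₀ W²`, the shift of `E₂ W ^ 2` by `-12 v₀ W` accounts for all derivatives of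
  -- the weight factor.
  obtain ⟨m4, m6⟩ := mem_Fil_of_ramanujan (euler_one_mem_Fil hTF)
    (G2 := atEHom e2 * W ^ 2 - 12 * (inc v₀ * W)) (G4 := atEHom e4 * W ^ 4)
    (G6 := atEHom e6 * W ^ 6)
    (by rw [euler_mul, p4, hθW]; linear_combination W ^ 4 * r4)
    (by rw [euler_mul, p6, hθW]; linear_combination W ^ 6 * r6)
    (by
      rw [map_sub, euler_mul, euler_mul, euler_mul, p2, hθW, o12, euler_one_inc]
      linear_combination W ^ 2 * r2)
    (by rw [k2']; exact ss_mem_par) (by rw [k4']; exact one_mem_par)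
    (by rw [k6']; exact ss_mem_par)
  exact ⟨W, hWc, hXW ▸ hPF, by rw [hXW, hP0], m4, k4', m6, k6'⟩

/-! ### Closure properties of modular `q`-expansions -/

theorem IsModular.mul {k l m : ℤ} {φ ψ : ℂ⟦X⟧} (h : IsModular k φ) (h' : IsModular l ψ)
    (hm : k + l = m) : IsModular m (φ * ψ) := by
  obtain ⟨f, rfl⟩ := h
  obtain ⟨g, rfl⟩ := h'
  subst hm
  exact ⟨f.mul g, (ModularForm.qExpansion_mul one_pos one_mem_strictPeriods_SL f g).symm⟩

theorem IsModular.pow {k m : ℤ} {φ : ℂ⟦X⟧} (h : IsModular k φ) (n : ℕ) (hm : n * k = m) :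
    IsModular m (φ ^ n) := by
  obtain ⟨f, rfl⟩ := h
  subst hm
  exact ⟨f.pow n, (ModularForm.qExpansion_pow one_pos one_mem_strictPeriods_SL f n).symm⟩

theorem IsModular.add {k : ℤ} {φ ψ : ℂ⟦X⟧} (h : IsModular k φ) (h' : IsModular k ψ) :
    IsModular k (φ + ψ) := by
  obtain ⟨f, rfl⟩ := h
  obtain ⟨g, rfl⟩ := h'
  exact ⟨f + g, (ModularForm.qExpansion_add one_pos one_mem_strictPeriods_SL f g).symm⟩

theorem IsModular.smul {k : ℤ} {φ : ℂ⟦X⟧} (h : IsModular k φ) (c : ℂ) : IsModular k (c • φ) := by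
  obtain ⟨f, rfl⟩ := h
  exact ⟨c • f, (qExp_smul c f).symm⟩

theorem isModular_zero (k : ℤ) : IsModular k 0 :=
  ⟨0, (UpperHalfPlane.qExpansion_zero 1).symm⟩

theorem IsModular.isEtaDivisible {k : ℤ} {φ : ℂ⟦X⟧} (h : IsModular k φ)
    (h0 : PowerSeries.constantCoeff φ = 0) : IsEtaDivisible k φ := by
  obtain ⟨f, rfl⟩ := h
  rw [← PowerSeries.coeff_zero_eq_constantCoeff_apply] at h0
  exact ⟨_, ⟨_, rfl⟩, ModularForm.qExpansion_eq_qExpansion_discriminant_mul f h0⟩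

/-! ### Injectivity of the substitution `q = q_E` -/

/-- At `z₂ = 0`, `q_E` is `z₁` times a unit, so the lowest term of a nonzero `q`-series survives. -/
theorem col₀_atEHom_injective : Function.Injective (fun φ : ℂ⟦X⟧ => col₀ (atEHom φ)) := by
  intro φ ψ h
  by_contra hne
  obtain ⟨U, hU, hq⟩ := col₀_qE
  have hd : φ - ψ ≠ 0 := sub_ne_zero.2 hne
  have h0 : col₀ (atEHom (φ - ψ)) = 0 := by
    rw [map_sub, map_sub, sub_eq_zero]; exact h
  obtain ⟨n, χ, hχ, hχ0⟩ : ∃ n χ, φ - ψ = PowerSeries.X ^ n * χ ∧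
      PowerSeries.constantCoeff χ ≠ 0 := by
    obtain ⟨χ, hχ⟩ := PowerSeries.X_pow_order_dvd (φ := φ - ψ)
    refine ⟨_, χ, hχ, ?_⟩
    have h1 := PowerSeries.coeff_order hd
    have h2 := PowerSeries.coeff_X_pow_mul χ (φ - ψ).order.toNat 0
    rw [zero_add, ← hχ] at h2
    rwa [h2, PowerSeries.coeff_zero_eq_constantCoeff_apply] at h1
  rw [hχ, map_mul, map_mul, map_pow, map_pow, atEHom_X, col₀_apply qE, hq] at h0
  have hU0 : U ≠ 0 := fun h => by rw [h, map_zero] at hU; exact zero_ne_one hU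
  rcases mul_eq_zero.1 h0 with h1 | h1
  · exact pow_ne_zero n (mul_ne_zero PowerSeries.X_ne_zero hU0) h1
  · refine hχ0 ?_
    rw [← constantCoeff_atE, ← constantCoeff_col₀, ← col₀_apply, h1, map_zero]

/-! ### Reduction modulo `z₁` -/

theorem exists_subst_eq {A : Ser} (hA : constantCoeff A = 0) (φ : ℂ⟦X⟧) :
    ∃ B, φ.subst A = A * B + algebraMap ℂ Ser (PowerSeries.constantCoeff φ) := by
  have hs := PowerSeries.HasSubst.of_constantCoeff_zero hA
  obtain ⟨ψ, hψ⟩ : PowerSeries.X ∣ φ - algebraMap ℂ _ (PowerSeries.constantCoeff φ) := by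
    rw [PowerSeries.X_dvd_iff]; simp
  rw [sub_eq_iff_eq_add] at hψ
  refine ⟨ψ.subst A, ?_⟩
  conv_lhs => rw [hψ]
  rw [← PowerSeries.coe_substAlgHom hs, map_add, map_mul, AlgHom.commutes,
    PowerSeries.substAlgHom_X]

theorem z₁_dvd_subst {A : Ser} (hA : z₁ ∣ A) (φ : ℂ⟦X⟧) :
    z₁ ∣ φ.subst A - C (PowerSeries.constantCoeff φ) := by
  have hc : constantCoeff A = 0 := by
    obtain ⟨B, rfl⟩ := hA
    simp [z₁]
  obtain ⟨B, hB⟩ := exists_subst_eq hc φ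
  rw [hB, MvPowerSeries.algebraMap_apply, Algebra.algebraMap_self_apply, add_sub_cancel_right]
  exact Dvd.dvd.mul_right hA _

theorem col₀_ratPow {F : Ser} (h : col 0 F = 1) (r : ℚ) : col 0 (ratPow F r) = 1 := by
  obtain ⟨B, hB⟩ := exists_subst_eq (A := F - 1)
    (by rw [map_sub, constantCoeff_of_col h, map_one, sub_self]) (PowerSeries.binomialSeries ℂ r)
  rw [ratPow, hB, PowerSeries.binomialSeries_constantCoeff, map_one, ← col₀_apply, map_add,
    map_mul, map_sub, map_one, col₀_apply, h, sub_self, zero_mul, zero_add]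

theorem z₁_dvd_atEHom (φ : ℂ⟦X⟧) : z₁ ∣ atEHom φ - C (PowerSeries.constantCoeff φ) := by
  rw [atEHom_apply]
  exact z₁_dvd_subst (Dvd.intro _ rfl) φ

theorem z₁_dvd_ratPow {F : Ser} (h : z₁ ∣ F - 1) (r : ℚ) : z₁ ∣ ratPow F r - 1 := by
  have := z₁_dvd_subst h (PowerSeries.binomialSeries ℂ r)
  rwa [PowerSeries.binomialSeries_constantCoeff, map_one] at this

theorem z₁_dvd_mul_sub {F G F' G' : Ser} (h : z₁ ∣ F - F') (h' : z₁ ∣ G - G') :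
    z₁ ∣ F * G - F' * G' := by
  have : F * G - F' * G' = (F - F') * G + F' * (G - G') := by ring
  rw [this]
  exact dvd_add (h.mul_right _) (h'.mul_left _)

theorem z₁_dvd_pow_sub {F F' : Ser} (h : z₁ ∣ F - F') (n : ℕ) : z₁ ∣ F ^ n - F' ^ n :=
  h.trans (sub_dvd_pow_sub_pow _ _ n)

theorem z₁_dvd_inv {F : Ser} (h : z₁ ∣ F - 1) : z₁ ∣ F⁻¹ - 1 := by
  have hc : constantCoeff F = 1 := by
    obtain ⟨B, hB⟩ := h
    have := congrArg constantCoeff hB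
    rw [map_sub, map_mul, z₁, constantCoeff_X, zero_mul, map_one] at this
    exact sub_eq_zero.1 this
  have hF := mul_inv_cancel_ser (F := F) (by rw [hc]; exact one_ne_zero)
  have : F⁻¹ - 1 = (F - 1) * (- F⁻¹) := by linear_combination hF
  rw [this]
  exact h.mul_right _

theorem E4_eq : E4 = atEHom e4 := (atEHom_apply _).symm

theorem constantCoeff_E4 : constantCoeff E4 = 1 := by
  rw [E4_eq, constantCoeff_atE, ← PowerSeries.coeff_zero_eq_constantCoeff_apply, coeff_e4_zero]

theorem z₁_dvd_E4 : z₁ ∣ E4 - 1 := by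
  have := z₁_dvd_atEHom e4
  rwa [← PowerSeries.coeff_zero_eq_constantCoeff_apply, coeff_e4_zero, map_one,
    ← E4_eq] at this

theorem z₁_dvd_Z : z₁ ∣ Z - z₂ := by
  have h1 : z₁ ∣ (1 - 432 * z₁) - 1 := ⟨-432, by ring⟩
  have h2 := z₁_dvd_pow_sub h1 3
  rw [one_pow] at h2
  have h3 := z₁_dvd_mul_sub h2 (z₁_dvd_ratPow z₁_dvd_E4 (9 / 2))
  rw [one_mul] at h3
  have h4 := z₁_dvd_mul_sub (F := z₂) (F' := z₂) (by rw [sub_self]; exact dvd_zero _)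
    (z₁_dvd_inv h3)
  rwa [mul_one] at h4

theorem coeff_eq_of_z₁_dvd {F G : Ser} (h : z₁ ∣ F - G) (m : ℕ) :
    coeff (ex 0 m) F = coeff (ex 0 m) G := by
  rw [← sub_eq_zero, ← map_sub]
  exact X_dvd_iff.1 h _ (ex_zero 0 m)

theorem z₂_pow (n : ℕ) : z₂ ^ n = monomial (ex 0 n) (1 : ℂ) := by
  rw [z₂, X_pow_eq]
  simp [ex]

/-- Modulo `z₁` the expansion collapses to `∑ cₙ(0) z₂ ^ n`. Hence a series congruent to `1` has
only cuspidal higher coefficients. -/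
theorem coeff_zSeries_of_z₁ (c : ℕ → ℂ⟦X⟧) (m : ℕ) :
    coeff (ex 0 m) (zSeries c) = PowerSeries.constantCoeff (c m) := by
  have h : ∀ n, coeff (ex 0 m) (atE (c n) * Z ^ n)
      = if m = n then PowerSeries.constantCoeff (c n) else 0 := fun n => by
    rw [← atEHom_apply, coeff_eq_of_z₁_dvd (z₁_dvd_mul_sub (z₁_dvd_atEHom (c n))
      (z₁_dvd_pow_sub z₁_dvd_Z n)), coeff_C_mul, z₂_pow, coeff_monomial]
    have : ex 0 m = ex 0 n ↔ m = n :=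
      ⟨fun h => by simpa [ex_one] using congrArg (fun d => d 1) h, fun h => by rw [h]⟩
    simp [this]
  change ∑ n ∈ Finset.range (ex 0 m 1 + 1), coeff (ex 0 m) (atE (c n) * Z ^ n) = _
  rw [Finset.sum_congr rfl fun n _ => h n, ex_one, Finset.sum_ite_eq, if_pos (by simp)]

theorem constantCoeff_eq_zero_of_z₁_dvd {c : ℕ → ℂ⟦X⟧} (h : z₁ ∣ zSeries c - 1) {n : ℕ}
    (hn : 1 ≤ n) : PowerSeries.constantCoeff (c n) = 0 := by
  rw [← coeff_zSeries_of_z₁, coeff_eq_of_z₁_dvd h, ← coeff_col, col_one, if_neg (by omega),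
    map_zero]

/-! ### Expansions in powers of `Z` -/

theorem zSeries_eq {c : ℕ → ℂ⟦X⟧} {F : Ser}
    (h : ∀ M, ∃ H, F = ∑ n ∈ Finset.range M, atEHom (c n) * Z ^ n + H * Z ^ M) :
    F = zSeries c := by
  ext d
  obtain ⟨H, hH⟩ := h (d 1 + 1)
  rw [hH, map_add, coeff_mul_Z_pow _ _ _ (Nat.lt_succ_self _), add_zero, map_sum]
  exact Finset.sum_congr rfl fun n _ => by rw [atEHom_apply]

theorem exists_Z_eq : ∃ V : Ser, Z = z₂ * V ∧ constantCoeff V = 1 := by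
  refine ⟨_, rfl, ?_⟩
  rw [MvPowerSeries.constantCoeff_inv, map_mul, constantCoeff_ratPow constantCoeff_E4]
  simp [z₁]

theorem col_z₂_pow_mul (n : ℕ) (F : Ser) : col n (z₂ ^ n * F) = col 0 F := by
  induction n with
  | zero => rw [pow_zero, one_mul]
  | succ n ih => rw [pow_succ', mul_assoc, col_z₂_mul_succ, ih]

/-- Triangularity in `z₂`: once the earlier coefficients agree, column `n` isolates `cₙ(q_E)` at `z₂
= 0` times a unit. -/
theorem zSeries_injective : Function.Injective zSeries := by
  intro c c' h
  funext n
  induction n using Nat.strong_induction_on with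
  | _ n ih =>
    obtain ⟨V, hZ, hV⟩ := exists_Z_eq
    have h1 : col n (atEHom (c n - c' n) * Z ^ n) = 0 := by
      ext l
      have h2 := congrArg (coeff (ex l n)) h
      change ∑ k ∈ Finset.range (ex l n 1 + 1), coeff (ex l n) (atE (c k) * Z ^ k)
        = ∑ k ∈ Finset.range (ex l n 1 + 1), coeff (ex l n) (atE (c' k) * Z ^ k) at h2
      rw [ex_one, Finset.sum_range_succ, Finset.sum_range_succ,
        Finset.sum_congr rfl fun k hk => by rw [ih k (Finset.mem_range.1 hk)],
        add_right_inj] at h2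
      rw [coeff_col, map_sub, sub_mul, map_sub, atEHom_apply, atEHom_apply, h2, sub_self,
        map_zero]
    rw [hZ, mul_pow, mul_left_comm, col_z₂_pow_mul, ← col₀_apply, map_mul] at h1
    have h3 : col₀ (V ^ n) ≠ 0 := fun h => by
      have := congrArg PowerSeries.constantCoeff h
      rw [col₀_apply, constantCoeff_col₀, map_pow, hV, one_pow, map_zero] at this
      exact one_ne_zero this
    have h4 := (mul_eq_zero.1 h1).resolve_right h3
    rw [map_sub, map_sub, sub_eq_zero] at h4
    exact col₀_atEHom_injective h4

theorem isZExpansion_of_eq {F N : Ser} {c : ℕ → ℂ⟦X⟧} (hF : F ≠ 0) (h : F = N * zSeries c) :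
    IsZExpansion F N c := by
  refine ⟨h, fun c' h' => zSeries_injective ?_⟩
  have hN : N ≠ 0 := fun h0 => hF (by rw [h, h0, zero_mul])
  exact mul_left_cancel₀ hN (h'.symm.trans h)

/-! ### Expansion of the filtration in powers of `Z` -/

/-- `E₆(q_E) / E₄(q_E) ^ (3/2)`. -/
def sE : Ser := atEHom e6 * ratPow E4 (-(3 / 2))

/-- `E₄(q_E) ^ (3/2)`. -/
def rE : Ser := ratPow E4 (3 / 2)

theorem rE_mul_sE : rE * sE = atEHom e6 := by
  rw [rE, sE, mul_left_comm, ratPow_neg E4 constantCoeff_E4, mul_one]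

theorem rE_sq : rE ^ 2 = E4 ^ 3 := by
  rw [rE, ratPow_mul_natCast E4 constantCoeff_E4, ← ratPow_natCast E4 constantCoeff_E4]
  norm_num

theorem constantCoeff_rE : constantCoeff rE = 1 := constantCoeff_ratPow constantCoeff_E4 _

/-- Both sides have constant term `1` and the same `b`-th power, so no multiplicativity of
fractional powers in the base is needed. -/
theorem ratPow_mul_eq {W F : Ser} (hW : constantCoeff W = 1) {k b n : ℕ} (hb : b ≠ 0)
    (hF : constantCoeff F = 1) (hk : 4 * n = k * b) :
    ratPow F ((n : ℚ) / b) * W ^ k = ratPow (F * W ^ 4) ((n : ℚ) / b) := by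
  have hG : constantCoeff (F * W ^ 4) = 1 := by rw [map_mul, map_pow, hW, hF]; norm_num
  have hb' : (b : ℚ) ≠ 0 := Nat.cast_ne_zero.2 hb
  refine eq_of_pow_eq (n := b) ?_ (constantCoeff_ratPow hG _) hb ?_
  · rw [map_mul, map_pow, hW, constantCoeff_ratPow hF]; norm_num
  · rw [mul_pow, ratPow_mul_natCast F hF, ratPow_mul_natCast _ hG, mul_div_cancel₀ _ hb',
      ratPow_natCast F hF, ratPow_natCast _ hG, mul_pow, ← pow_mul, ← pow_mul, hk]

/-- The weight factor cancels: `sE = (E₆ W ^ 6) (E₄ W ^ 4) ^ (-3/2)`. In the same way `X₀ E₄ ^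
(-1/4) = (X₀ W) (E₄ W ^ 4) ^ (-1/4)` below. -/
theorem sE_mem_Fil : sE ∈ Fil 1 ∧ col 0 sE = ss := by
  obtain ⟨W, hW, -, -, m4, k4, m6, k6⟩ := exists_weight_factor
  rw [← E4_eq] at m4 k4
  have hc := constantCoeff_of_col k4
  have h1 := ratPow_mul_eq hW (k := 6) (b := 2) (n := 3) (by norm_num) constantCoeff_E4
    (by norm_num)
  have h2 := ratPow_neg _ hc (3 / 2)
  have hs : sE = (atEHom e6 * W ^ 6) * ratPow (E4 * W ^ 4) (-(3 / 2)) := by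
    have h3 := rE_mul_sE
    rw [rE] at h3
    push_cast at h1
    rw [← h3]
    linear_combination -sE * h2 - sE * ratPow (E4 * W ^ 4) (-(3 / 2)) * h1
  have hm := ratPow_mem_Fil m4 k4 (-(3 / 2))
  refine ⟨by simpa [hs] using mul_mem_Fil m6 hm, ?_⟩
  rw [hs, col_zero_mul, k6, col₀_ratPow k4, mul_one]

theorem X₀_div_mem_Fil : X₀ * ratPow E4 (-(1 / 4)) ∈ Fil 0 ∧
    col 0 (X₀ * ratPow E4 (-(1 / 4))) = 1 := by
  obtain ⟨W, hW, mP, kP, m4, k4, -, -⟩ := exists_weight_factor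
  rw [← E4_eq] at m4 k4
  have hc := constantCoeff_of_col k4
  have h1 := ratPow_mul_eq hW (k := 1) (b := 4) (n := 1) (by norm_num) constantCoeff_E4
    (by norm_num)
  push_cast at h1
  have h2 := ratPow_neg _ hc (1 / 4)
  have h3 := ratPow_neg _ constantCoeff_E4 (1 / 4)
  have hs : X₀ * ratPow E4 (-(1 / 4)) = (X₀ * W) * ratPow (E4 * W ^ 4) (-(1 / 4)) := by
    linear_combination -X₀ * ratPow E4 (-(1 / 4)) * h2
      - X₀ * ratPow E4 (-(1 / 4)) * ratPow (E4 * W ^ 4) (-(1 / 4)) * h1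
      + X₀ * W * ratPow (E4 * W ^ 4) (-(1 / 4)) * h3
  have hm := ratPow_mem_Fil m4 k4 (-(1 / 4))
  refine ⟨by rw [hs]; simpa only [add_zero] using mul_mem_Fil mP hm, ?_⟩
  rw [hs, col_zero_mul, kP, col₀_ratPow k4, mul_one]

/-- `z₂ / (1 - 432 z₁) ^ 3`. -/
def yy : Ser := z₂ * ((1 - 432 * z₁) ^ 3)⁻¹

theorem inc_rr : inc rr = 1 - 432 * z₁ := by
  rw [rr, map_sub, map_mul, map_one, map_ofNat, inc_X]

theorem inc_ss : inc ss = 1 - 864 * z₁ := by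
  rw [ss, map_sub, map_mul, map_one, map_ofNat, inc_X]

theorem rr_mul_inv : rr * rr⁻¹ = 1 :=
  PowerSeries.mul_inv_cancel _ (by rw [constantCoeff_rr]; exact one_ne_zero)

theorem yy_mul_cube : yy * (1 - 432 * z₁) ^ 3 = z₂ := by
  have := mul_inv_cancel_ser (F := (1 - 432 * z₁) ^ 3) (by simp [z₁])
  rw [yy]
  linear_combination z₂ * this

theorem yy_eq : yy = inc (rr⁻¹ ^ 3) * z₂ := by
  have h := congrArg inc rr_mul_inv
  rw [map_mul, map_one, inc_rr] at h
  rw [← yy_mul_cube, map_pow, mul_left_comm, ← mul_pow, mul_comm (inc rr⁻¹), h, one_pow, mul_one]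

theorem col_yy_mul_succ (m : ℕ) (F : Ser) : col (m + 1) (yy * F) = rr⁻¹ ^ 3 * col m F := by
  rw [yy_eq, mul_assoc, col_inc_mul, col_z₂_mul_succ]

theorem col_yy_mul_zero (F : Ser) : col 0 (yy * F) = 0 := by
  rw [yy_eq, mul_assoc, col_inc_mul, col_z₂_mul_zero, mul_zero]

theorem rr_pow_mul_inv (n : ℕ) : rr ^ n * rr⁻¹ ^ n = 1 := by rw [← mul_pow, rr_mul_inv, one_pow]

theorem yy_mul_mem_Fil {j k : ℤ} (hk : k + 3 = j) {F : Ser} (h : F ∈ Fil j) :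
    yy * F ∈ Fil k := fun m => by
  rw [FilCol]
  cases m with
  | zero => rw [col_yy_mul_zero, mul_zero]; exact zero_mem _
  | succ m =>
    have h1 : rr ^ (3 * (m + 1)) * (rr⁻¹ ^ 3 * col m F) = rr ^ (3 * m) * col m F := by
      rw [show 3 * (m + 1) = 3 * m + 3 by ring, pow_add]
      linear_combination rr ^ (3 * m) * col m F * rr_pow_mul_inv 3
    rw [col_yy_mul_succ, h1]
    have := h m
    rw [FilCol] at this
    rwa [show (3 * ((m + 1 : ℕ) : ℤ) + k) = 3 * m + j by push_cast; omega]

theorem exists_eq_yy_mul {j : ℤ} {F : Ser} (h : F ∈ Fil j) (h0 : col 0 F = 0) :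
    ∃ G ∈ Fil (j + 3), F = yy * G := by
  refine ⟨ofCol fun m => rr ^ 3 * col (m + 1) F, fun m => ?_, col_ext fun m => ?_⟩
  · have := h (m + 1)
    rw [FilCol] at this ⊢
    rw [col_ofCol, ← mul_assoc, ← pow_add]
    rwa [show (3 * ((m + 1 : ℕ) : ℤ) + j) = 3 * m + (j + 3) by push_cast; ring] at this
  · cases m with
    | zero => rw [col_yy_mul_zero, h0]
    | succ m =>
      rw [col_yy_mul_succ, col_ofCol]
      linear_combination -col (m + 1) F * rr_pow_mul_inv 3

theorem yy_eq_Z_mul : yy = Z * rE ^ 3 := by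
  have h1 : ratPow E4 (9 / 2) = rE ^ 3 := by
    rw [rE, ratPow_mul_natCast E4 constantCoeff_E4]; norm_num
  have h2 := mul_inv_cancel_ser (F := (1 - 432 * z₁) ^ 3 * rE ^ 3)
    (by simp [z₁, constantCoeff_rE])
  have h3 := mul_inv_cancel_ser (F := (1 - 432 * z₁) ^ 3) (by simp [z₁])
  rw [yy, Z, h1]
  linear_combination z₂ * rE ^ 3 * ((1 - 432 * z₁) ^ 3 * rE ^ 3)⁻¹ * h3
    - z₂ * ((1 - 432 * z₁) ^ 3)⁻¹ * h2

/-- Degree and parity together remove the fractional powers: for `d = i + 2k`, `sE ^ i rE ^ d = E₆ ^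
i E₄ ^ (3k)`. -/
theorem exists_isModular_of_parPoly (d : ℕ) {p : Polynomial ℂ} (hp : p ∈ parPoly d) :
    ∃ c, IsModular (6 * d) c ∧ atEHom c = Polynomial.aeval sE p * rE ^ d := by
  refine Submodule.span_induction (p := fun p _ => ∃ c, IsModular (6 * d) c ∧
    atEHom c = Polynomial.aeval sE p * rE ^ d) ?_ ?_ ?_ ?_ hp
  · rintro _ ⟨i, k, h, rfl⟩
    have hd : d = i + 2 * k := by omega
    refine ⟨e6 ^ i * e4 ^ (3 * k), IsModular.mul (IsModular.pow ⟨ModularForm.E₆, rfl⟩ i rfl)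
      (IsModular.pow ⟨ModularForm.E₄, rfl⟩ (3 * k) rfl) (by push_cast [hd]; ring), ?_⟩
    rw [map_mul, map_pow, map_pow, map_pow, Polynomial.aeval_X, ← rE_mul_sE, ← E4_eq, hd, pow_mul,
      ← rE_sq, ← pow_mul, pow_add, mul_pow]
    ring
  · exact ⟨0, isModular_zero _, by simp⟩
  · rintro p q - - ⟨c, hc, h⟩ ⟨c', hc', h'⟩
    exact ⟨c + c', hc.add hc', by rw [map_add, h, h', map_add, add_mul]⟩
  · rintro a p - ⟨c, hc, h⟩
    exact ⟨a • c, hc.smul a, by rw [map_smul, h, map_smul, smul_mul_assoc]⟩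

theorem aeval_sE_mem_Fil {d : ℤ} {p : Polynomial ℂ} (hp : p ∈ parPoly d) :
    Polynomial.aeval sE p ∈ Fil d := by
  refine Submodule.span_induction (p := fun p _ => Polynomial.aeval sE p ∈ Fil d) ?_
    (by simp) ?_ ?_ hp
  · rintro _ ⟨i, k, h, rfl⟩
    rw [map_pow, Polynomial.aeval_X]
    clear hp
    subst h
    induction k with
    | zero => simpa using pow_mem_Fil sE_mem_Fil.1 i
    | succ k ih =>
      have := Fil_le ih
      rwa [show ((i : ℤ) + 2 * (k : ℕ) + 2) = i + 2 * ((k + 1 : ℕ) : ℤ) by push_cast; ring] at this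
  · intro p q _ _ h h'
    rw [map_add]; exact add_mem h h'
  · intro a p _ h
    rw [map_smul]; exact Submodule.smul_mem _ _ h

/-- `F` and `p(sE)` have the same first column `p(s)`, so their difference is divisible by `y = Z rE
^ 3`, and the quotient gains `3` in the filtration. -/
theorem exists_expansion_step {d : ℕ} {F : Ser} (hF : F ∈ Fil d) :
    ∃ c, IsModular (6 * d) c ∧ ∃ G ∈ Fil ((d + 3 : ℕ) : ℤ),
      F * rE ^ d = atEHom c + G * rE ^ (d + 3) * Z := by
  obtain ⟨p, hp, hp0⟩ := exists_of_mem_par (col₀_mem_par hF)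
  obtain ⟨c, hc, hcp⟩ := exists_isModular_of_parPoly d hp
  have h0 : col 0 (F - Polynomial.aeval sE p) = 0 := by
    rw [map_sub, ← hp0, ← col₀_apply, ← Polynomial.aeval_algHom_apply, col₀_apply, sE_mem_Fil.2,
      sub_self]
  obtain ⟨G, hG, h⟩ := exists_eq_yy_mul (sub_mem hF (aeval_sE_mem_Fil hp)) h0
  refine ⟨c, hc, G, by simpa using hG, ?_⟩
  rw [yy_eq_Z_mul] at h
  rw [hcp, pow_add]
  linear_combination rE ^ d * h

/-- Members of the filtration expand in powers of `Z` with modular coefficients. -/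
theorem exists_zSeries {j : ℕ} {F : Ser} (hF : F ∈ Fil j) :
    ∃ c : ℕ → ℂ⟦X⟧, (∀ n : ℕ, IsModular (6 * (j + 3 * n)) (c n)) ∧ F * rE ^ j = zSeries c := by
  -- The hypothesis on `H` sits inside the existential so that choice yields total functions that
  -- can be iterated; outside the intended domain the values are `0`.
  have step : ∀ (n : ℕ) (H : Ser), ∃ (c : ℂ⟦X⟧) (H' : Ser),
      (∃ G ∈ Fil ((j + 3 * n : ℕ) : ℤ), H = G * rE ^ (j + 3 * n)) →
      IsModular (6 * ((j + 3 * n : ℕ) : ℤ)) c ∧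
      (∃ G ∈ Fil ((j + 3 * (n + 1) : ℕ) : ℤ), H' = G * rE ^ (j + 3 * (n + 1))) ∧
      H = atEHom c + H' * Z := by
    intro n H
    by_cases h : ∃ G ∈ Fil ((j + 3 * n : ℕ) : ℤ), H = G * rE ^ (j + 3 * n)
    · obtain ⟨G, hG, rfl⟩ := h
      obtain ⟨c, hc, G', hG', h'⟩ := exists_expansion_step hG
      exact ⟨c, _, fun _ => ⟨hc, ⟨G', hG', rfl⟩, h'⟩⟩
    · exact ⟨0, 0, fun h' => absurd h' h⟩
  choose c H' hstep using step
  let H : ℕ → Ser := fun n => Nat.rec (F * rE ^ j) (fun n G => H' n G) n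
  have hH : ∀ n, ∃ G ∈ Fil ((j + 3 * n : ℕ) : ℤ), H n = G * rE ^ (j + 3 * n) := by
    intro n
    induction n with
    | zero => exact ⟨F, hF, rfl⟩
    | succ n ih => exact (hstep n (H n) ih).2.1
  refine ⟨fun n => c n (H n), fun n => ?_, zSeries_eq fun M => ⟨H M, ?_⟩⟩
  · simpa using (hstep n (H n) (hH n)).1
  · induction M with
    | zero => simp [H]
    | succ M ih =>
      rw [ih, Finset.sum_range_succ, add_assoc, add_right_inj, pow_succ', ← mul_assoc, ← add_mul,
        ← (hstep M (H M) (hH M)).2.2]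

theorem col₀_zSeries (c : ℕ → ℂ⟦X⟧) : col 0 (zSeries c) = col₀ (atEHom (c 0)) := by
  ext n
  rw [coeff_col, col₀_apply, coeff_col]
  change ∑ k ∈ Finset.range (ex n 0 1 + 1), coeff (ex n 0) (atE (c k) * Z ^ k) = _
  rw [ex_one, Finset.sum_range_one, pow_zero, mul_one, atEHom_apply]

/-! ### The four expansions -/

theorem one_sub_ss_sq_ne_zero : 1 - ss ^ 2 ≠ 0 := by
  rw [← X_mul_rr]
  have h1 : rr ≠ 0 := fun h => by
    have := constantCoeff_rr
    rw [h, map_zero] at this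
    exact zero_ne_one this
  have h2 : (1728 : ℂ⟦X⟧) ≠ 0 := fun h => by
    have := congrArg PowerSeries.constantCoeff h
    rw [map_ofNat, map_zero] at this
    norm_num at this
  exact mul_ne_zero h2 (mul_ne_zero PowerSeries.X_ne_zero h1)

theorem z₁_dvd_sE : z₁ ∣ sE - 1 := by
  have h := z₁_dvd_atEHom e6
  rw [← PowerSeries.coeff_zero_eq_constantCoeff_apply, coeff_e6_zero, map_one] at h
  rw [sE]
  simpa only [mul_one] using z₁_dvd_mul_sub h (z₁_dvd_ratPow z₁_dvd_E4 (-(3 / 2)))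

/-- `sE ≡ 1` modulo `z₁`, so each column polynomial of `1 - sE ^ 2` vanishes at `s = 1`, and by
parity at `s = -1` as well. Dividing by `1 - s ^ 2` lowers `Fil 2` to `Fil 0`. -/
theorem exists_one_sub_sE_sq : ∃ U ∈ Fil 0, col 0 U = 1 ∧
    1 - sE ^ 2 = inc (1 - ss ^ 2) * U := by
  obtain ⟨hs, hs0⟩ := sE_mem_Fil
  have h2 : 1 - sE ^ 2 ∈ Fil 2 := sub_mem (by simpa using Fil_le one_mem_Fil)
    (by simpa using pow_mem_Fil hs 2)
  have hz : z₁ ∣ 1 - sE ^ 2 := by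
    rw [show 1 - sE ^ 2 = (sE - 1) * (-(sE + 1)) by ring]
    exact z₁_dvd_sE.mul_right _
  have hc : ∀ m, PowerSeries.constantCoeff (rr ^ (3 * m) * col m (1 - sE ^ 2)) = 0 := fun m => by
    rw [map_mul, ← PowerSeries.coeff_zero_eq_constantCoeff_apply (col m _), coeff_col,
      X_dvd_iff.1 hz _ (ex_zero 0 m), mul_zero]
  choose ψ hψ h using fun m => exists_eq_one_sub_ss_sq_mul (h2 m) (hc m)
  have hU : 1 - sE ^ 2 = inc (1 - ss ^ 2) * ofCol fun m => rr⁻¹ ^ (3 * m) * ψ m :=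
    col_ext fun m => by
      rw [col_inc_mul, col_ofCol]
      linear_combination rr⁻¹ ^ (3 * m) * h m - col m (1 - sE ^ 2) * rr_pow_mul_inv (3 * m)
  refine ⟨_, fun m => ?_, ?_, hU⟩
  · rw [FilCol, col_ofCol, ← mul_assoc, rr_pow_mul_inv, one_mul]
    have := hψ m
    rwa [add_sub_assoc, sub_self] at this
  · have h0 := congrArg col₀ hU
    rw [map_mul, col₀_inc, map_sub, map_pow, map_one, col₀_apply sE, hs0] at h0
    exact (mul_left_cancel₀ one_sub_ss_sq_ne_zero (by rw [mul_one]; exact h0)).symm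

theorem isModular_eighteen {c : ℕ → ℂ⟦X⟧}
    (h : ∀ n : ℕ, IsModular (6 * ((0 : ℕ) + 3 * n)) (c n)) (n : ℕ) : IsModular (18 * n) (c n) := by
  have := h n
  rwa [show (6 * (((0 : ℕ) : ℤ) + 3 * n)) = 18 * n by push_cast; ring] at this

theorem exists_zSeries_of_mem_Fil_zero {F : Ser} (hF : F ∈ Fil 0) (h0 : col 0 F = 1) :
    ∃ c : ℕ → ℂ⟦X⟧, F = zSeries c ∧ c 0 = 1 ∧ ∀ n : ℕ, IsModular (18 * n) (c n) := by
  obtain ⟨c, hc, h⟩ := exists_zSeries (j := 0) (F := F) (by simpa using hF)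
  rw [pow_zero, mul_one] at h
  refine ⟨c, h, col₀_atEHom_injective ?_, isModular_eighteen hc⟩
  change col₀ (atEHom (c 0)) = col₀ (atEHom 1)
  rw [← col₀_zSeries, ← h, h0, map_one, map_one]

theorem eta24_eq : 1728 * eta24 = E4 ^ 3 * (1 - sE ^ 2) := by
  have h := congrArg atEHom qExp_discriminant
  rw [Algebra.smul_def, map_mul, AlgHom.commutes, map_sub, map_pow, map_pow, map_ofNat,
    ← rE_mul_sE, atEHom_apply (qExp _), ← E4_eq] at h
  rw [eta24, h, mul_pow, rE_sq]; ring

/-- `1728 z₁ (1 - 432 z₁) = 1 - s ^ 2` and `1728 η ^ 24 / E₄ ^ 3 = 1 - sE ^ 2`, so the series to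
expand is `U⁻¹`. -/
theorem z₁_expansion : ∃ a : ℕ → ℂ⟦X⟧,
    IsZExpansion (z₁ * (1 - 432 * z₁)) (eta24 * (E4 ^ 3)⁻¹) a ∧
      a 0 = 1 ∧ ∀ n : ℕ, IsModular (18 * n) (a n) := by
  obtain ⟨U, hU, hU0, h⟩ := exists_one_sub_sE_sq
  have hUi := mul_inv_cancel_ser (F := U) (by rw [constantCoeff_of_col hU0]; exact one_ne_zero)
  have hEi := mul_inv_cancel_ser (F := E4 ^ 3)
    (by rw [map_pow, constantCoeff_E4]; norm_num)
  have hx : 1728 * (z₁ * (1 - 432 * z₁)) = inc (1 - ss ^ 2) := by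
    rw [← X_mul_rr, map_mul, map_mul, inc_X, inc_rr, map_ofNat]
  have h1728 : (1728 : Ser) ≠ 0 := fun h => by
    have := congrArg constantCoeff h
    rw [map_ofNat, map_zero] at this
    norm_num at this
  have h1 := congrArg col₀ hUi
  rw [map_mul, map_one, col₀_apply, hU0, one_mul, col₀_apply] at h1
  obtain ⟨a, ha, ha0, ham⟩ := exists_zSeries_of_mem_Fil_zero (inv_mem_Fil hU hU0) h1
  refine ⟨a, isZExpansion_of_eq ?_ ?_, ha0, ham⟩
  · intro h0
    have h2 := congrArg col₀ hx
    rw [h0, mul_zero, map_zero, col₀_inc] at h2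
    exact one_sub_ss_sq_ne_zero h2.symm
  · refine mul_left_cancel₀ h1728 ?_
    rw [hx, ← ha]
    linear_combination -(E4 ^ 3)⁻¹ * U⁻¹ * eta24_eq - (1 - sE ^ 2) * U⁻¹ * hEi
      - U⁻¹ * h - inc (1 - ss ^ 2) * hUi

theorem discriminant_mem_Fil : Δ₁ * Δ₂ * ((1 - 432 * z₁) ^ 3)⁻¹ ∈ Fil 0 ∧
    col 0 (Δ₁ * Δ₂ * ((1 - 432 * z₁) ^ 3)⁻¹) = 1 := by
  have hi := mul_inv_cancel_ser (F := (1 - 432 * z₁) ^ 3) (by simp [z₁])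
  -- The left side is `(1 - 27 y (432 z₁)³) (1 + 27 y r³)`, and `r = (1 + s) / 2`, `432 z₁ = (1 - s)
  -- / 2`. The linear term has `r³ - (432 z₁)³ = (3s + s³) / 4`, odd in `s`; the quadratic one is
  -- even.
  have h1 : Δ₁ * Δ₂ * ((1 - 432 * z₁) ^ 3)⁻¹ = 1 + (27 / 4 : ℂ) • (yy * inc (3 * ss + ss ^ 3))
      - (27 ^ 2 / 64 : ℂ) • (yy * (yy * inc ((1 - ss ^ 2) ^ 3))) := by
    have h64 : (64 : ℂ) • (Δ₁ * Δ₂ * ((1 - 432 * z₁) ^ 3)⁻¹) = (64 : ℂ) •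
        (1 + (27 / 4 : ℂ) • (yy * inc (3 * ss + ss ^ 3))
          - (27 ^ 2 / 64 : ℂ) • (yy * (yy * inc ((1 - ss ^ 2) ^ 3)))) := by
      rw [smul_sub, smul_add, smul_smul, smul_smul]
      norm_num only
      simp only [Algebra.smul_def, map_ofNat, map_add, map_mul, map_pow, map_sub, map_one,
        inc_ss]
      rw [Δ₁, Δ₂, ← yy_mul_cube]
      linear_combination 64 * (1 - 27 * yy * (432 * z₁) ^ 3)
        * (1 + 27 * (yy * (1 - 432 * z₁) ^ 3)) * hi
    exact (smul_right_injective Ser (by norm_num : (64 : ℂ) ≠ 0)) h64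
  have m1 : (3 * ss + ss ^ 3 : ℂ⟦X⟧) ∈ par 3 := by
    have h2 := aeval_mem_par (X_pow_mem_parPoly (d := 3) 3 0 (by norm_num))
    have h3 := aeval_mem_par (X_pow_mem_parPoly (d := 3) 1 1 (by norm_num))
    rw [map_pow, Polynomial.aeval_X] at h2 h3
    rw [pow_one] at h3
    exact add_mem (ofNat_mul_mem 3 h3) h2
  have m2 : ((1 - ss ^ 2) ^ 3 : ℂ⟦X⟧) ∈ par 6 := by
    have h2 := aeval_mem_par (X_pow_mem_parPoly (d := 2) 2 0 (by norm_num))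
    rw [map_pow, Polynomial.aeval_X] at h2
    have h3 := sub_mem one_mem_par_two h2
    have h4 := mul_mem_par h3 (mul_mem_par h3 h3)
    rw [show (2 + (2 + 2) : ℤ) = 6 by norm_num] at h4
    rwa [show (1 - ss ^ 2) ^ 3 = (1 - ss ^ 2) * ((1 - ss ^ 2) * (1 - ss ^ 2)) by ring]
  rw [h1]
  refine ⟨sub_mem (add_mem one_mem_Fil (Submodule.smul_mem _ _ ?_))
    (Submodule.smul_mem _ _ ?_), ?_⟩
  · exact yy_mul_mem_Fil (by norm_num) (inc_mem_Fil m1)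
  · exact yy_mul_mem_Fil (j := 3) (by norm_num) (yy_mul_mem_Fil (by norm_num) (inc_mem_Fil m2))
  · rw [map_sub, map_add, map_smul, map_smul, col_yy_mul_zero, col_yy_mul_zero, col_one]
    simp

theorem discriminant_expansion : ∃ b : ℕ → ℂ⟦X⟧,
    IsZExpansion (Δ₁ * Δ₂ * ((1 - 432 * z₁) ^ 3)⁻¹) 1 b ∧
      b 0 = 1 ∧ ∀ n : ℕ, IsModular (18 * n) (b n) := by
  obtain ⟨h, h0⟩ := discriminant_mem_Fil
  obtain ⟨b, hb, hb0, hbm⟩ := exists_zSeries_of_mem_Fil_zero h h0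
  refine ⟨b, isZExpansion_of_eq (fun h => ?_) (by rw [one_mul, hb]), hb0, hbm⟩
  rw [h, map_zero] at h0
  exact zero_ne_one h0

/-- Here `s ∈ Fil 1`, whence the shift of the weight by `6`. At `z₂ = 0`, `s` coincides with `sE`,
so the leading term is `rE sE = E₆`. -/
theorem ss_expansion : ∃ c : ℕ → ℂ⟦X⟧, IsZExpansion (1 - 864 * z₁) (ratPow E4 (3 / 2))⁻¹ c ∧
      c 0 = qExp ModularForm.E₆ ∧ (∀ n : ℕ, IsModular (18 * n + 6) (c n)) ∧
      ∀ n : ℕ, 1 ≤ n → IsEtaDivisible (18 * n + 6) (c n) := by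
  obtain ⟨c, hc, h⟩ := exists_zSeries (j := 1) (F := inc ss) (by
    simpa using inc_mem_Fil ss_mem_par)
  have hcm : ∀ n : ℕ, IsModular (18 * n + 6) (c n) := fun n => by
    have := hc n
    rwa [show (6 * (((1 : ℕ) : ℤ) + 3 * n)) = 18 * n + 6 by push_cast; ring] at this
  have hr := mul_inv_cancel_ser (F := rE) (by rw [constantCoeff_rE]; exact one_ne_zero)
  rw [pow_one] at h
  refine ⟨c, isZExpansion_of_eq ?_ ?_, col₀_atEHom_injective ?_, hcm, fun n hn =>
    (hcm n).isEtaDivisible (constantCoeff_eq_zero_of_z₁_dvd ?_ hn)⟩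
  · intro h0
    have := congrArg constantCoeff h0
    simp [z₁] at this
  · change _ = rE⁻¹ * zSeries c
    rw [← inc_ss, ← h]
    linear_combination -inc ss * hr
  · change col₀ (atEHom (c 0)) = col₀ (atEHom e6)
    rw [← col₀_zSeries, ← h, ← rE_mul_sE, ← col₀_apply, map_mul, map_mul, col₀_inc, col₀_apply sE,
      sE_mem_Fil.2, mul_comm]
  · have h2 := z₁_dvd_mul_sub (F := inc ss) (F' := 1) (by rw [inc_ss]; exact ⟨-864, by ring⟩)
      (z₁_dvd_ratPow z₁_dvd_E4 (3 / 2))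
    rw [mul_one] at h2
    rwa [← h]

theorem z₁_dvd_X₀ : z₁ ∣ X₀ - 1 := by
  refine X_dvd_iff.2 fun d hd => ?_
  rw [ex_eq d, hd, map_sub, ← coeff_col _ _ (1 : Ser), col_one, coeff_X₀, periodCoeff]
  by_cases h : d 1 = 0 <;> simp [h]

theorem X₀_expansion : ∃ x : ℕ → ℂ⟦X⟧, IsZExpansion X₀ (ratPow E4 (1 / 4)) x ∧
      x 0 = 1 ∧ (∀ n : ℕ, IsModular (18 * n) (x n)) ∧
      ∀ n : ℕ, 1 ≤ n → IsEtaDivisible (18 * n) (x n) := by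
  obtain ⟨h, h0⟩ := X₀_div_mem_Fil
  obtain ⟨x, hx, hx0, hxm⟩ := exists_zSeries_of_mem_Fil_zero h h0
  have hr := ratPow_neg _ constantCoeff_E4 (1 / 4)
  refine ⟨x, isZExpansion_of_eq (fun h => ?_) ?_, hx0, hxm, fun n hn =>
    (hxm n).isEtaDivisible (constantCoeff_eq_zero_of_z₁_dvd ?_ hn)⟩
  · have := X₀_constantCoeff
    rw [h, map_zero] at this
    exact zero_ne_one this
  · rw [← hx]
    linear_combination -X₀ * hr
  · have h2 := z₁_dvd_mul_sub z₁_dvd_X₀ (z₁_dvd_ratPow z₁_dvd_E4 (-(1 / 4)))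
    rw [mul_one] at h2
    rwa [← hx]

end X18

end

open X18
theorem mainTheorem2 :
    (∃ a : ℕ → ℂ⟦X⟧, IsZExpansion (z₁ * (1 - 432 * z₁)) (eta24 * (E4 ^ 3)⁻¹) a ∧
      a 0 = 1 ∧ ∀ n : ℕ, IsModular (18 * n) (a n)) ∧
    (∃ b : ℕ → ℂ⟦X⟧, IsZExpansion (Δ₁ * Δ₂ * ((1 - 432 * z₁) ^ 3)⁻¹) 1 b ∧
      b 0 = 1 ∧ ∀ n : ℕ, IsModular (18 * n) (b n)) ∧
    (∃ c : ℕ → ℂ⟦X⟧, IsZExpansion (1 - 864 * z₁) (ratPow E4 (3 / 2))⁻¹ c ∧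
      c 0 = qExp ModularForm.E₆ ∧ (∀ n : ℕ, IsModular (18 * n + 6) (c n)) ∧
      ∀ n : ℕ, 1 ≤ n → IsEtaDivisible (18 * n + 6) (c n)) ∧
    (∃ x : ℕ → ℂ⟦X⟧, IsZExpansion X₀ (ratPow E4 (1 / 4)) x ∧
      x 0 = 1 ∧ (∀ n : ℕ, IsModular (18 * n) (x n)) ∧
      ∀ n : ℕ, 1 ≤ n → IsEtaDivisible (18 * n) (x n)) := by
  exact ⟨z₁_expansion, discriminant_expansion, ss_expansion, X₀_expansion⟩
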